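/- Let $\mathbb{X}\subseteq\mathbb{R}^2$ be a measurable set and let $\Xi=(\xi_n)_{n\ge 0}$ be a time-homogeneous Markov chain on $\mathbb{X}$; write $\mathbb{P}_x,\mathbb{E}_x$ for probability and expectation given $\xi_0=x$, and $\theta=\xi_1-\xi_0$. For $x\neq 0$ let $u_x=x/\|x\|$ and let $v_x$ be $u_x$ rotated anticlockwise by $\pi/2$. Write $t_+=\max(t,0)$ and $t_-=\max(-t,0)$. Suppose that $\mathbb{P}_0[\theta=0]<1$ if $0\in\mathbb{X}$, and that for each $x\in\mathbb{X}\setminus\{0\}$, under $\mathbb{P}_x$ the jump is $\theta=\chi\,\theta^{R}u_x+(1-\chi)\,\theta^{T}v_x$ in law, where $\chi\in\{0,1\}$ a.s. and each of the real random variables $\theta^{R},\theta^{T}$ is independent of $\chi$. Suppose that there are constants $p^R\in(0,1)$, $p^T=1-p^R$, $\alpha\in(1,2)$, $\beta>\alpha$ and $c^R,c^T\in(0,\infty)$ such that, with $x$ ranging over $\mathbb{X}\setminus\{0\}$: (A) $\mathbb{P}_x[\chi=1]=p^R$ and $\mathbb{P}_x[\chi=0]=p^T$ for all $x$; (B) $\mathbb{E}_x[\theta^R]=\mathbb{E}_x[\theta^T]=0$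 for all $x$; (C) $\lim_{y\to\infty}\sup_{x}\bigl|y^\alpha\,\mathbb{P}_x[\theta^R_+>y]-c^R\bigr|=0$; (D) $\sup_{x}\mathbb{E}_x[(\theta^R_-)^\beta]<\infty$; (E) $\mathbb{P}_x[\theta^T_->y]=\mathbb{P}_x[\theta^T_+>y]$ for all $x$ and all $y\ge0$, and $\lim_{y\to\infty}\sup_{x}\bigl|y^\alpha\,\mathbb{P}_x[\theta^T_+>y]-c^T\bigr|=0$. For $a\in\mathbb{R}$ let $\tau_a=\min\{n\ge0:\|\xi_n\|\le a\}$ (with $\min\emptyset=\infty$). Call $\Xi$ transient if $\|\xi_n\|\to\infty$ a.s. for every initial law; recurrent if there is a constant $r_0\ge 0$ such that $\liminf_{n\to\infty}\|\xi_n\|\le r_0$ a.s. for every initial law; and null recurrent if it is recurrent and, for all sufficiently large $a$ and all $x\in\mathbb{X}$ with $\|x\|>a$, $\mathbb{E}_x[\tau_a]=\infty$. Then: (i) If $p^Rc^R+2p^Tc^T\cos(\pi\alpha/2)>0$, then $\Xi$ is null recurrent. (ii) If $p^Rc^R+2p^Tc^T\cos(\pi\alpha/2)<0$, then $\Xi$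 is transient. Moreover, in case (i) the equation $$p^Rc^R\,\frac{\Gamma(\alpha-\nu)\,\Gamma(1-\alpha)}{\Gamma(1-\nu)}+p^Tc^T\,\frac{\Gamma\left(\frac{\alpha-\nu}{2}\right)\Gamma\left(1-\frac{\alpha}{2}\right)}{\Gamma\left(1-\frac{\nu}{2}\right)}=0$$ has a unique solution $\nu^\star\in(0,1)$, and there is $a_0$ such that for all $a\ge a_0$ and all $q>0$: if $q<\nu^\star/\alpha$ then $\mathbb{E}_x[\tau_a^q]<\infty$ for all $x\in\mathbb{X}$, and if $q>\nu^\star/\alpha$ then $\mathbb{E}_x[\tau_a^q]=\infty$ for all $x\in\mathbb{X}$ with $\|x\|>a$. -/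

import Mathlib

open MeasureTheory ProbabilityTheory Filter Topology
open scoped ENNReal

noncomputable section

namespace HeavyTailPlane

/-- The Euclidean plane. -/
abbrev Plane : Type := EuclideanSpace ℝ (Fin 2)

/-- The radial unit vector `x / ‖x‖` (used only for `x ≠ 0`). -/
def radialUnit (x : Plane) : Plane := ‖x‖⁻¹ • x

/-- The transverse unit vector: `radialUnit x` rotated anticlockwise by a right angle. -/
def transverseUnit (x : Plane) : Plane := !₂[-(radialUnit x 1), radialUnit x 0]

/-- The law on path space of the time-homogeneous Markov chain with transition kernel `P` and
initial law `μ₀`, given by the Ionescu-Tulcea theorem. -/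
def chainLaw {S : Type*} [MeasurableSpace S] (P : Kernel S S) [IsMarkovKernel P]
    (μ₀ : Measure S) [IsProbabilityMeasure μ₀] : Measure (ℕ → S) :=
  Kernel.trajMeasure (X := fun _ : ℕ => S) μ₀
    (fun n => P.comap (fun h : (i : Finset.Iic n) → S => h ⟨n, Finset.mem_Iic.2 le_rfl⟩)
      (measurable_pi_apply _))

/-- The assumptions on the chain with state space `𝕏 ⊆ ℝ²` and transition kernel `P`.
For every nonzero `x ∈ 𝕏`, the measure `Pr x` governs the random variables `χ`, `θR`, `θT` out of
which the jump from `x` is made. -/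
structure IsRadialTransverseChain {Ω : Type*} [MeasurableSpace Ω] (𝕏 : Set Plane)
    (P : Kernel 𝕏 𝕏) (Pr : 𝕏 → Measure Ω) (χ θR θT : Ω → ℝ)
    (α β pR pT cR cT : ℝ) : Prop where
  measurableSet : MeasurableSet 𝕏
  measurable_χ : Measurable χ
  measurable_θR : Measurable θR
  measurable_θT : Measurable θT
  isProbabilityMeasure : ∀ x : 𝕏, (x : Plane) ≠ 0 → IsProbabilityMeasure (Pr x)
  χ_zero_or_one : ∀ x : 𝕏, (x : Plane) ≠ 0 → ∀ᵐ ω ∂(Pr x), χ ω = 0 ∨ χ ω = 1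
  indep_θR : ∀ x : 𝕏, (x : Plane) ≠ 0 → IndepFun χ θR (Pr x)
  indep_θT : ∀ x : 𝕏, (x : Plane) ≠ 0 → IndepFun χ θT (Pr x)
  /-- Given `ξ₀ = x ≠ 0`, the jump is `χ u_x θR + (1 - χ) v_x θT` in law. -/
  jump_law : ∀ x : 𝕏, (x : Plane) ≠ 0 →
    (P x).map (fun y : 𝕏 => (y : Plane) - (x : Plane)) =
      (Pr x).map (fun ω => (χ ω * θR ω) • radialUnit x + ((1 - χ ω) * θT ω) • transverseUnit x)
  /-- The origin, if it belongs to the state space, is not absorbing. -/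
  origin_not_absorbing : ∀ x : 𝕏, (x : Plane) = 0 → P x {x} < 1
  pR_mem : pR ∈ Set.Ioo (0 : ℝ) 1
  pT_eq : pT = 1 - pR
  prob_radial : ∀ x : 𝕏, (x : Plane) ≠ 0 → (Pr x).real {ω | χ ω = 1} = pR
  prob_transverse : ∀ x : 𝕏, (x : Plane) ≠ 0 → (Pr x).real {ω | χ ω = 0} = pT
  mean_θR : ∀ x : 𝕏, (x : Plane) ≠ 0 → Integrable θR (Pr x) ∧ ∫ ω, θR ω ∂(Pr x) = 0
  mean_θT : ∀ x : 𝕏, (x : Plane) ≠ 0 → Integrable θT (Pr x) ∧ ∫ ω, θT ω ∂(Pr x) = 0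
  α_mem : α ∈ Set.Ioo (1 : ℝ) 2
  cR_pos : 0 < cR
  /-- Outward radial tail: `y ^ α * Pr_x[θR₊ > y] → cR` uniformly in `x ≠ 0`. -/
  radial_tail_out : TendstoUniformlyOn
    (fun (y : ℝ) (x : 𝕏) => y ^ α * (Pr x).real {ω | y < max (θR ω) 0}) (fun _ => cR)
    atTop {x : 𝕏 | (x : Plane) ≠ 0}
  β_gt : α < β
  /-- Inward radial jumps have uniformly bounded `β`-th moments. -/
  radial_moment_in :
    (⨆ (x : 𝕏) (_ : (x : Plane) ≠ 0),
      ∫⁻ ω, ENNReal.ofReal (max (-(θR ω)) 0 ^ β) ∂(Pr x)) < ∞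
  transverse_symm : ∀ x : 𝕏, (x : Plane) ≠ 0 → ∀ y : ℝ, 0 ≤ y →
    (Pr x).real {ω | y < max (-(θT ω)) 0} = (Pr x).real {ω | y < max (θT ω) 0}
  cT_pos : 0 < cT
  /-- Transverse tail: `y ^ α * Pr_x[θT₊ > y] → cT` uniformly in `x ≠ 0`. -/
  transverse_tail : TendstoUniformlyOn
    (fun (y : ℝ) (x : 𝕏) => y ^ α * (Pr x).real {ω | y < max (θT ω) 0}) (fun _ => cT)
    atTop {x : 𝕏 | (x : Plane) ≠ 0}

/-- `τ_a = min {n ≥ 0 : ‖ξ_n‖ ≤ a}`, equal to `∞` if there is no such `n`. -/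
def passageTime {𝕏 : Set Plane} (a : ℝ) (ξ : ℕ → 𝕏) : ℝ≥0∞ :=
  ⨅ (n : ℕ) (_ : ‖(ξ n : Plane)‖ ≤ a), (n : ℝ≥0∞)

/-- `𝔼_x[τ_a ^ q] ∈ [0, ∞]`, for the chain started at `x`. -/
def passageMoment {𝕏 : Set Plane} (P : Kernel 𝕏 𝕏) [IsMarkovKernel P] (a q : ℝ) (x : 𝕏) : ℝ≥0∞ :=
  ∫⁻ ξ, passageTime a ξ ^ q ∂(chainLaw P (Measure.dirac x))

/-- Transience: `‖ξ_n‖ → ∞` almost surely, whatever the initial law. -/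
def IsTransient {𝕏 : Set Plane} (P : Kernel 𝕏 𝕏) [IsMarkovKernel P] : Prop :=
  ∀ (μ₀ : Measure 𝕏) [IsProbabilityMeasure μ₀],
    ∀ᵐ ξ ∂(chainLaw P μ₀), Tendsto (fun n => ‖(ξ n : Plane)‖) atTop atTop

/-- Recurrence: for some constant `r₀ ≥ 0`, almost surely `liminf ‖ξ_n‖ ≤ r₀`, whatever the
initial law. -/
def IsRecurrent {𝕏 : Set Plane} (P : Kernel 𝕏 𝕏) [IsMarkovKernel P] : Prop :=
  ∃ r₀ : ℝ, 0 ≤ r₀ ∧ ∀ (μ₀ : Measure 𝕏) [IsProbabilityMeasure μ₀],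
    ∀ᵐ ξ ∂(chainLaw P μ₀),
      liminf (fun n => ENNReal.ofReal ‖(ξ n : Plane)‖) atTop ≤ ENNReal.ofReal r₀

/-- Null recurrence: recurrence, and `𝔼_x[τ_a] = ∞` for all large `a` and all `‖x‖ > a`. -/
def IsNullRecurrent {𝕏 : Set Plane} (P : Kernel 𝕏 𝕏) [IsMarkovKernel P] : Prop :=
  IsRecurrent P ∧ ∃ a₀ : ℝ, ∀ a : ℝ, a₀ ≤ a → ∀ x : 𝕏, a < ‖(x : Plane)‖ →
    passageMoment P a 1 x = ∞

/-- The equation for the exponent `ν`. -/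
def IsCriticalRoot (α pR pT cR cT ν : ℝ) : Prop :=
  pR * cR * (Real.Gamma (α - ν) * Real.Gamma (1 - α) / Real.Gamma (1 - ν)) +
    pT * cT * (Real.Gamma ((α - ν) / 2) * Real.Gamma (1 - α / 2) / Real.Gamma (1 - ν / 2)) = 0

end HeavyTailPlane

end

/-! Write f_ν(x) = max(‖x‖, 1)^ν and r = ‖x‖. By homogeneity of the limiting tails, for ν < 1, ν ≠ 0
and ν not too negative, the mean one-step increment of f_ν at x is (ν F(ν) + o(1)) r^(ν-α), where F
is `criticalFun`, the left-hand side of the equation for the exponent (`drift_asymptotics`). The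
mean-zero condition removes the linear term of the radial jump. Inward jumps have a moment of order
above α and contribute only to the error. What remains is an outward radial part and a transverse
part; both become integrals against the tail of the jump, with Beta integrals in the limit.

Everything rests on the sign of ν F(ν). The reflection formula shows that F(0) has the sign opposite
to that of p^R c^R + 2 p^T c^T cos(πα/2) (`criticalFun_zero`). The duplication formula writes F(ν)
as a positive factor times an expression that increases strictly with ν on (-∞, 1), by log-convexity
of Γ (`criticalFun_eq`, `Gamma_ratio_strictMono`). Hence in case (i) F has exactly one zero ν* in
(0,1), is negative to its left and positive to its right.

The chain is studied through the probability `survival P a n x` of staying outside the ball of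
radius a up to time n. First-step analysis (`survival_succ`) turns drift conditions into bounds by
induction on n, in place of optional stopping.

Upper bound (`survival_upper_bound`): for 0 < ν < ν* the drift of f_ν is negative, so a modification
of f_ν contracts by the factor 1 - c r^(-α) in the shell a < ‖x‖ ≤ r. With r = n^s and s just below
1/α, the chance of still being in the shell after n steps is negligible and the chance of having
left it outwards is of order r^(-ν). Survival therefore decays at least like n^(-q) for each q <
ν*/α.

Lower bound (`survival_lower_bound`): for ν* < ν < 1 the drift is positive, so from far enough out
distance n^(1/α) is reached before the ball with probability at least of order n^(-ν/α). From that
distance the chain needs about n further steps to return (`exists_stay_far`). Together the two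
bounds locate the moment threshold at ν*/α, and since ν* < 1 < α the first moment is infinite.

Transience (`isTransient_of_criticalFun_pos`): if F(0) > 0, a slightly negative ν gives ν F(ν) < 0,
so f_ν is a positive supermartingale far out that tends to 0 at infinity. Returning to a ball is
unlikely from far away, and a maximum principle for the probability of infinitely many returns makes
that probability zero. -/

noncomputable section

namespace HeavyTailPlane

/-! ### Path measures: uniqueness in law and the Markov property. -/

section MarkovProperty

variable {S : Type*} [MeasurableSpace S] (P : Kernel S S) [IsMarkovKernel P]

/-- The history-dependent kernel through which `chainLaw` is built. -/
abbrev historyKernel (n : ℕ) : Kernel ((i : Finset.Iic n) → S) S :=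
  P.comap (fun h => h ⟨n, Finset.mem_Iic.2 le_rfl⟩) (measurable_pi_apply _)

instance instIsProbabilityMeasureChainLaw (μ : Measure S) [IsProbabilityMeasure μ] :
    IsProbabilityMeasure (chainLaw P μ) := by
  unfold chainLaw; infer_instance

/-- A path measure `Q` has initial law `μ` and one-step transitions given by `P`. -/
def IsMarkovLaw (μ : Measure S) (Q : Measure (ℕ → S)) : Prop :=
  Q.map (fun ξ => ξ 0) = μ ∧ ∀ (n : ℕ) (F : ((i : Finset.Iic n) → S) × S → ℝ≥0∞), Measurable F →
    ∫⁻ ξ, F (Preorder.frestrictLe n ξ, ξ (n + 1)) ∂Q =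
      ∫⁻ ξ, ∫⁻ y, F (Preorder.frestrictLe n ξ, y) ∂(P (ξ n)) ∂Q

lemma chainLaw_map_zero (μ : Measure S) [IsProbabilityMeasure μ] :
    (chainLaw P μ).map (fun ξ => ξ 0) = μ := by
  have h1 : (chainLaw P μ).map (Preorder.frestrictLe 0) =
      μ.map (MeasurableEquiv.piUnique (fun _ : Finset.Iic 0 => S)).symm := by
    unfold chainLaw Kernel.trajMeasure
    rw [Measure.map_comp _ _ (by fun_prop), Kernel.traj_map_frestrictLe, Kernel.partialTraj_self,
      Measure.id_comp]
  have h2 : (fun ξ : ℕ → S => ξ 0) =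
      (fun h : (i : Finset.Iic 0) → S => h ⟨0, Finset.mem_Iic.2 le_rfl⟩) ∘
        Preorder.frestrictLe 0 := rfl
  rw [h2, ← Measure.map_map (by fun_prop) (by fun_prop), h1,
    Measure.map_map (by fun_prop) (by fun_prop)]
  have h3 : (fun h : (i : Finset.Iic 0) → S => h ⟨0, Finset.mem_Iic.2 le_rfl⟩) ∘
      (MeasurableEquiv.piUnique (fun _ : Finset.Iic 0 => S)).symm = id := by
    funext s
    rfl
  rw [h3, Measure.map_id]

lemma chainLaw_isMarkovLaw (μ : Measure S) [IsProbabilityMeasure μ] :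
    IsMarkovLaw P μ (chainLaw P μ) := by
  refine ⟨chainLaw_map_zero P μ, fun n F hF => ?_⟩
  have h := Kernel.map_frestrictLe_trajMeasure_compProd_eq_map_trajMeasure (X := fun _ : ℕ => S)
    (μ₀ := μ) (κ := fun n => historyKernel P n) (a := n)
  have h' : ∫⁻ z, F z ∂((chainLaw P μ).map (Preorder.frestrictLe n) ⊗ₘ historyKernel P n) =
      ∫⁻ z, F z ∂((chainLaw P μ).map (fun ξ => (Preorder.frestrictLe n ξ, ξ (n + 1)))) :=
    congrArg (fun m => ∫⁻ z, F z ∂m) h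
  rw [Measure.lintegral_compProd hF, lintegral_map (by fun_prop) (by fun_prop),
    lintegral_map hF (by fun_prop)] at h'
  exact h'.symm

variable {P}

/-- Induction on time: the history up to n + 1 is a measurable function of the history up to n and
the next state, and the joint law of these two is determined by the law of the former and the
kernel. -/
lemma IsMarkovLaw.map_frestrictLe_eq {μ : Measure S} {Q Q' : Measure (ℕ → S)}
    (h : IsMarkovLaw P μ Q) (h' : IsMarkovLaw P μ Q') (n : ℕ) :
    Q.map (Preorder.frestrictLe n) = Q'.map (Preorder.frestrictLe (π := fun _ => S) n) := by
  induction n with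
  | zero =>
    have h2 : (Preorder.frestrictLe (π := fun _ : ℕ => S) 0) =
        (MeasurableEquiv.piUnique (fun _ : Finset.Iic 0 => S)).symm ∘ (fun ξ => ξ 0) := by
      funext ξ i
      obtain ⟨i, hi⟩ := i
      have : i = 0 := by simpa using hi
      subst this
      rfl
    rw [h2, ← Measure.map_map (by fun_prop) (by fun_prop),
      ← Measure.map_map (by fun_prop) (by fun_prop), h.1, h'.1]
  | succ n ih =>
    have h2 : (Preorder.frestrictLe (π := fun _ : ℕ => S) (n + 1)) = fun ξ : ℕ → S =>
        IicProdIoc (X := fun _ => S) n (n + 1) (Preorder.frestrictLe n ξ,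
          MeasurableEquiv.piSingleton (X := fun _ => S) n (ξ (n + 1))) := by
      funext ξ i
      obtain ⟨i, hi⟩ := i
      simp only [IicProdIoc_def]
      split_ifs with hin
      · rfl
      · have : i = n + 1 := by
          have := Finset.mem_Iic.1 hi
          simp at hin; omega
        subst this
        rfl
    ext B hB
    rw [Measure.map_apply (by fun_prop) hB, Measure.map_apply (by fun_prop) hB,
      ← lintegral_indicator_one (measurableSet_preimage (by fun_prop) hB),
      ← lintegral_indicator_one (measurableSet_preimage (by fun_prop) hB)]
    have hg : Measurable (fun z : ((i : Finset.Iic n) → S) × S =>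
        IicProdIoc (X := fun _ => S) n (n + 1)
          (z.1, MeasurableEquiv.piSingleton (X := fun _ => S) n z.2)) :=
      measurable_IicProdIoc.comp (measurable_fst.prodMk
        ((MeasurableEquiv.piSingleton (X := fun _ => S) n).measurable.comp measurable_snd))
    set G : ((i : Finset.Iic n) → S) × S → ℝ≥0∞ := fun z =>
      (((fun z : ((i : Finset.Iic n) → S) × S =>
        IicProdIoc (X := fun _ => S) n (n + 1)
          (z.1, MeasurableEquiv.piSingleton (X := fun _ => S) n z.2)) ⁻¹' B).indicator 1) z with hG
    have hGm : Measurable G := measurable_one.indicator (hg hB)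
    have e1 : ∀ ρ : Measure (ℕ → S),
        ∫⁻ ξ, (((Preorder.frestrictLe (π := fun _ : ℕ => S) (n + 1)) ⁻¹' B).indicator 1 ξ : ℝ≥0∞) ∂ρ =
        ∫⁻ ξ : ℕ → S, G (Preorder.frestrictLe n ξ, ξ (n + 1)) ∂ρ := by
      intro ρ
      rw [h2]
      rfl
    have e2 : ∀ ρ : Measure (ℕ → S),
        ∫⁻ ξ, ∫⁻ y, G (Preorder.frestrictLe n ξ, y) ∂(P (ξ n)) ∂ρ =
        ∫⁻ z, ∫⁻ y, G (z, y) ∂(historyKernel P n z) ∂(ρ.map (Preorder.frestrictLe n)) := by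
      intro ρ
      rw [lintegral_map (by fun_prop) (by fun_prop)]
      rfl
    rw [e1, e1, h.2 n G hGm, h'.2 n G hGm, e2, e2, ih]

/-- Both measures are projective limits of one family of finite marginals, and for sequences it
suffices to compare initial segments. -/
lemma IsMarkovLaw.unique {μ : Measure S} {Q Q' : Measure (ℕ → S)} [IsProbabilityMeasure Q]
    [IsProbabilityMeasure Q'] (h : IsMarkovLaw P μ Q) (h' : IsMarkovLaw P μ Q') : Q = Q' := by
  have hp : IsProjectiveMeasureFamily (α := fun _ : ℕ => S) (fun I : Finset ℕ => Q.map (I.restrict (π := fun _ : ℕ => S))) := by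
    intro I J hJI
    simp only
    rw [Measure.map_map (Finset.measurable_restrict₂ (X := fun _ : ℕ => S) hJI) (by fun_prop)]
    rfl
  have hQ : IsProjectiveLimit Q (fun I : Finset ℕ => Q.map (I.restrict (π := fun _ : ℕ => S))) :=
    fun I => rfl
  have hQ' : IsProjectiveLimit Q' (fun I : Finset ℕ => Q.map (I.restrict (π := fun _ : ℕ => S))) := by
    rw [isProjectiveLimit_nat_iff hp]
    intro n
    exact (h.map_frestrictLe_eq h' n).symm
  have : ∀ I : Finset ℕ, IsFiniteMeasure (Q.map (I.restrict (π := fun _ : ℕ => S))) :=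
    fun I => inferInstance
  exact hQ.unique hQ'

variable (P)

/-- The law of the chain as a kernel in the starting point. -/
def pathKernel : Kernel S (ℕ → S) :=
  (Kernel.traj (X := fun _ : ℕ => S) (fun n => historyKernel P n) 0).comap
    (MeasurableEquiv.piUnique (fun _ : Finset.Iic 0 => S)).symm (by fun_prop)

lemma chainLaw_apply (μ : Measure S) [IsProbabilityMeasure μ] {B : Set (ℕ → S)}
    (hB : MeasurableSet B) : chainLaw P μ B = ∫⁻ x, pathKernel P x B ∂μ := by
  unfold chainLaw Kernel.trajMeasure
  rw [Measure.bind_apply hB (Kernel.aemeasurable _),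
    lintegral_map (Kernel.measurable_coe _ hB) (by fun_prop)]
  rfl

lemma chainLaw_dirac_apply (x : S) {B : Set (ℕ → S)} (hB : MeasurableSet B) :
    chainLaw P (Measure.dirac x) B = pathKernel P x B := by
  rw [chainLaw_apply P _ hB, lintegral_dirac' x (Kernel.measurable_coe _ hB)]

lemma chainLaw_eq_lintegral (μ : Measure S) [IsProbabilityMeasure μ] {B : Set (ℕ → S)}
    (hB : MeasurableSet B) :
    chainLaw P μ B = ∫⁻ x, chainLaw P (Measure.dirac x) B ∂μ := by
  rw [chainLaw_apply P _ hB]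
  exact lintegral_congr fun x => (chainLaw_dirac_apply P x hB).symm

lemma measurable_chainLaw_dirac {B : Set (ℕ → S)} (hB : MeasurableSet B) :
    Measurable fun x => chainLaw P (Measure.dirac x) B := by
  simp only [chainLaw_dirac_apply P _ hB]
  exact Kernel.measurable_coe _ hB

/-- The shifted path again has initial law `P x` at time zero and transitions `P`, so uniqueness in
law identifies it. -/
lemma chainLaw_map_shift (x : S) :
    (chainLaw P (Measure.dirac x)).map (fun ξ n => ξ (n + 1)) = chainLaw P (P x) := by
  have hM := chainLaw_isMarkovLaw P (Measure.dirac x)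
  have hsh : Measurable (fun (ξ : ℕ → S) n => ξ (n + 1)) :=
    measurable_pi_lambda _ fun n => measurable_pi_apply (n + 1)
  have : IsProbabilityMeasure ((chainLaw P (Measure.dirac x)).map
    (fun (ξ : ℕ → S) n => ξ (n + 1))) := Measure.isProbabilityMeasure_map hsh.aemeasurable
  refine IsMarkovLaw.unique (μ := P x) ⟨?_, fun n F hF => ?_⟩ (chainLaw_isMarkovLaw P (P x))
  · rw [Measure.map_map (by fun_prop) hsh]
    ext B hB
    rw [Measure.map_apply ((measurable_pi_apply 0).comp hsh) hB]
    have h0 := hM.2 0 (fun z => B.indicator 1 z.2)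
      ((measurable_one.indicator hB).comp measurable_snd)
    simp only [lintegral_indicator_one hB] at h0
    have h1 : ∫⁻ ξ, P (ξ 0) B ∂(chainLaw P (Measure.dirac x)) =
        ∫⁻ y, P y B ∂((chainLaw P (Measure.dirac x)).map (fun ξ => ξ 0)) := by
      rw [lintegral_map (Kernel.measurable_coe _ hB) (by fun_prop)]
    rw [h1, hM.1, lintegral_dirac' _ (Kernel.measurable_coe _ hB)] at h0
    rw [← h0, ← lintegral_indicator_one (((measurable_pi_apply 0).comp hsh) hB)]
    rfl
  -- The history of the shifted path up to n is the original history up to n + 1 with its first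
  -- entry dropped, so the transition identity at n + 1 applies.
  · have hs : Measurable (fun (h : (i : Finset.Iic (n + 1)) → S) (i : Finset.Iic n) =>
        h ⟨i.1 + 1, Finset.mem_Iic.2 (Nat.succ_le_succ (Finset.mem_Iic.1 i.2))⟩) :=
      measurable_pi_lambda _ fun i => measurable_pi_apply _
    have h0 := hM.2 (n + 1) (fun z => F (fun i : Finset.Iic n =>
        z.1 ⟨i.1 + 1, Finset.mem_Iic.2 (Nat.succ_le_succ (Finset.mem_Iic.1 i.2))⟩, z.2))
      (hF.comp ((hs.comp measurable_fst).prodMk measurable_snd))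
    rw [lintegral_map (by fun_prop) hsh, lintegral_map ?_ hsh]
    · exact h0
    · have : Measurable fun z : (i : Finset.Iic n) → S =>
          ∫⁻ y, F (z, y) ∂(historyKernel P n z) := by fun_prop
      exact this.comp (Preorder.measurable_frestrictLe (X := fun _ : ℕ => S) n)

/-- The Markov property at time one. -/
lemma chainLaw_preimage_shift (x : S) {B : Set (ℕ → S)} (hB : MeasurableSet B) :
    chainLaw P (Measure.dirac x) ((fun (ξ : ℕ → S) n => ξ (n + 1)) ⁻¹' B) =
      ∫⁻ y, chainLaw P (Measure.dirac y) B ∂(P x) := by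
  have hsh : Measurable (fun (ξ : ℕ → S) n => ξ (n + 1)) :=
    measurable_pi_lambda _ fun n => measurable_pi_apply (n + 1)
  rw [← chainLaw_eq_lintegral P (P x) hB, ← chainLaw_map_shift, Measure.map_apply hsh hB]

lemma chainLaw_dirac_ae_zero (x : S) {A : Set S} (hA : MeasurableSet A) (hx : x ∈ A) :
    ∀ᵐ ξ ∂(chainLaw P (Measure.dirac x)), ξ 0 ∈ A := by
  have h := chainLaw_map_zero P (Measure.dirac x)
  have h2 : ∀ᵐ y ∂((chainLaw P (Measure.dirac x)).map (fun ξ => ξ 0)), y ∈ A := by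
    rw [h]; exact (ae_dirac_iff (p := fun y => y ∈ A) hA).2 hx
  exact ae_of_ae_map (measurable_pi_apply 0).aemeasurable h2

end MarkovProperty

/-! ### Survival probabilities, moments of the passage time, recurrence. -/

section Survival

variable {𝕏 : Set Plane} (P : Kernel 𝕏 𝕏) [IsMarkovKernel P]

/-- The paths staying outside the ball of radius `a` up to time `n`. -/
def survivalSet (𝕏 : Set Plane) (a : ℝ) (n : ℕ) : Set (ℕ → 𝕏) :=
  {ξ | ∀ k ≤ n, a < ‖(ξ k : Plane)‖}

/-- The probability that the chain started at `x` stays outside the ball of radius `a` up to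
time `n`. -/
def survival (a : ℝ) (n : ℕ) (x : 𝕏) : ℝ :=
  (chainLaw P (Measure.dirac x)).real (survivalSet 𝕏 a n)

lemma measurableSet_norm_gt (a : ℝ) : MeasurableSet {x : 𝕏 | a < ‖(x : Plane)‖} :=
  measurableSet_lt measurable_const (by fun_prop)

lemma measurableSet_norm_gt_at (a : ℝ) (k : ℕ) :
    MeasurableSet {ξ : ℕ → 𝕏 | a < ‖(ξ k : Plane)‖} :=
  measurableSet_lt measurable_const (by fun_prop)

lemma measurableSet_survivalSet (a : ℝ) (n : ℕ) : MeasurableSet (survivalSet 𝕏 a n) := by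
  have : survivalSet 𝕏 a n = ⋂ k ∈ Finset.Iic n, {ξ : ℕ → 𝕏 | a < ‖(ξ k : Plane)‖} := by
    ext ξ; simp [survivalSet]
  rw [this]
  exact Finset.measurableSet_biInter _ fun k _ =>
    measurableSet_norm_gt_at a k

lemma survival_nonneg (a : ℝ) (n : ℕ) (x : 𝕏) : 0 ≤ survival P a n x := measureReal_nonneg

lemma survival_le_one (a : ℝ) (n : ℕ) (x : 𝕏) : survival P a n x ≤ 1 := measureReal_le_one

lemma measurable_survival (a : ℝ) (n : ℕ) : Measurable (survival P a n) :=
  (measurable_chainLaw_dirac P (measurableSet_survivalSet a n)).ennreal_toReal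

lemma integrable_survival (a : ℝ) (n : ℕ) (μ : Measure 𝕏) [IsFiniteMeasure μ] :
    Integrable (survival P a n) μ :=
  Integrable.of_bound (measurable_survival P a n).aestronglyMeasurable 1
    (ae_of_all _ fun x => by
      rw [Real.norm_of_nonneg (survival_nonneg P a n x)]; exact survival_le_one P a n x)

lemma survival_zero_of_lt {a : ℝ} {x : 𝕏} (hx : a < ‖(x : Plane)‖) : survival P a 0 x = 1 := by
  unfold survival
  rw [measureReal_def]
  have h : chainLaw P (Measure.dirac x) (survivalSet 𝕏 a 0) = 1 := by
    rw [← mem_ae_iff_prob_eq_one (measurableSet_survivalSet a 0)]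
    filter_upwards [chainLaw_dirac_ae_zero P x (measurableSet_norm_gt a) hx] with ξ hξ k hk
    rw [Nat.le_zero.1 hk]
    exact hξ
  rw [h]; simp

lemma survival_of_le {a : ℝ} {x : 𝕏} (hx : ‖(x : Plane)‖ ≤ a) (n : ℕ) : survival P a n x = 0 := by
  unfold survival
  rw [measureReal_eq_zero_iff, measure_eq_zero_iff_ae_notMem]
  filter_upwards [chainLaw_dirac_ae_zero P x (measurableSet_norm_gt a).compl
    (by simpa using hx)] with ξ hξ h
  exact hξ (h 0 (Nat.zero_le _))

/-- First-step analysis. All later estimates on survival are inductions based on this identity. -/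
lemma survival_succ {a : ℝ} {x : 𝕏} (hx : a < ‖(x : Plane)‖) (n : ℕ) :
    survival P a (n + 1) x = ∫ y, survival P a n y ∂(P x) := by
  have h : chainLaw P (Measure.dirac x) (survivalSet 𝕏 a (n + 1)) =
      chainLaw P (Measure.dirac x)
        ((fun (ξ : ℕ → 𝕏) n => ξ (n + 1)) ⁻¹' (survivalSet 𝕏 a n)) := by
    apply measure_congr
    filter_upwards [chainLaw_dirac_ae_zero P x (measurableSet_norm_gt a) hx] with ξ hξ
    apply propext
    constructor
    · intro h k hk
      exact h (k + 1) (by omega)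
    · intro h k hk
      rcases k with _ | k
      · exact hξ
      · exact h k (by omega)
  unfold survival
  rw [measureReal_def, h, chainLaw_preimage_shift P x (measurableSet_survivalSet a n),
    integral_eq_lintegral_of_nonneg_ae (ae_of_all _ fun _ => measureReal_nonneg)
      (measurable_survival P a n).aestronglyMeasurable]
  congr 1
  exact lintegral_congr fun y => (ofReal_measureReal).symm

lemma survival_antitone_radius {a b : ℝ} (hab : a ≤ b) (n : ℕ) (x : 𝕏) :
    survival P b n x ≤ survival P a n x :=
  measureReal_mono fun ξ hξ k hk => hab.trans_lt (hξ k hk)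

lemma lt_passageTime_iff {a : ℝ} {ξ : ℕ → 𝕏} {n : ℕ} :
    (n : ℝ≥0∞) < passageTime a ξ ↔ ξ ∈ survivalSet 𝕏 a n := by
  constructor
  · intro h k hk
    by_contra! hc
    have : passageTime a ξ ≤ k := iInf₂_le k hc
    have h2 := h.trans_le this
    exact absurd hk (not_le.2 (by exact_mod_cast h2))
  · intro h
    have : ((n + 1 : ℕ) : ℝ≥0∞) ≤ passageTime a ξ := by
      refine le_iInf₂ fun k hk => ?_
      have : n < k := by
        by_contra! hkn
        exact absurd (h k hkn) (not_lt.2 hk)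
      exact_mod_cast this
    exact lt_of_lt_of_le (by exact_mod_cast Nat.lt_succ_self n) this

lemma chainLaw_lt_passageTime (a : ℝ) (n : ℕ) (x : 𝕏) :
    chainLaw P (Measure.dirac x) {ξ | (n : ℝ≥0∞) < passageTime a ξ} =
      ENNReal.ofReal (survival P a n x) := by
  simp only [lt_passageTime_iff, Set.ofPred_mem_eq]
  exact (ofReal_measureReal).symm

/-- The moment is at least n^q times the probability that the passage time exceeds n, hence at least
c n^(q-q'), which is unbounded. -/
lemma passageMoment_eq_top {a q q' c : ℝ} {x : 𝕏} (hq : 0 < q) (hq' : q' < q) (hc : 0 < c)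
    (h : ∀ᶠ n : ℕ in atTop, c * (n : ℝ) ^ (-q') ≤ survival P a n x) :
    passageMoment P a q x = ∞ := by
  have key : ∀ᶠ n : ℕ in atTop, ENNReal.ofReal (c * (n : ℝ) ^ (q - q')) ≤ passageMoment P a q x := by
    filter_upwards [h, eventually_gt_atTop 0] with n hn hn0
    have hn0' : (0 : ℝ) < n := by exact_mod_cast hn0
    have h1 : (n : ℝ≥0∞) ^ q * chainLaw P (Measure.dirac x) {ξ | (n : ℝ≥0∞) < passageTime a ξ} ≤
        passageMoment P a q x := by
      unfold passageMoment
      rw [← setLIntegral_const]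
      refine (setLIntegral_mono' ?_ fun ξ hξ => ?_).trans (setLIntegral_le_lintegral _ _)
      · simp only [lt_passageTime_iff, Set.ofPred_mem_eq]
        exact measurableSet_survivalSet a n
      · exact ENNReal.rpow_le_rpow (le_of_lt hξ) hq.le
    refine le_trans ?_ h1
    rw [chainLaw_lt_passageTime, ← ENNReal.ofReal_natCast, ENNReal.ofReal_rpow_of_pos hn0',
      ← ENNReal.ofReal_mul (by positivity)]
    apply ENNReal.ofReal_le_ofReal
    calc c * (n : ℝ) ^ (q - q') = (n : ℝ) ^ q * (c * (n : ℝ) ^ (-q')) := by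
          rw [sub_eq_add_neg, Real.rpow_add hn0']; ring
      _ ≤ _ := by gcongr
  have ht : Tendsto (fun n : ℕ => ENNReal.ofReal (c * (n : ℝ) ^ (q - q'))) atTop (𝓝 ∞) :=
    ENNReal.tendsto_ofReal_atTop.comp (((tendsto_rpow_atTop (sub_pos.2 hq')).comp
      tendsto_natCast_atTop_atTop).const_mul_atTop hc)
  exact top_le_iff.1 (le_of_tendsto ht key)

/-- Dyadic decomposition: for finite t > 1 the term with 2^k < t ≤ 2^(k+1) suffices alone; for t = ∞
every term is at least 1 and the sum diverges. -/
lemma rpow_le_one_add_tsum {t : ℝ≥0∞} {q : ℝ} (hq : 0 < q) :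
    t ^ q ≤ 1 + ∑' k : ℕ, (if ((2 ^ k : ℕ) : ℝ≥0∞) < t then ((2 : ℝ≥0∞) ^ (k + 1)) ^ q else 0) := by
  rcases le_or_gt t 1 with h1 | h1
  · exact (ENNReal.rpow_le_one h1 hq.le).trans le_self_add
  by_cases htop : t = ∞
  · subst htop
    have : ∑' k : ℕ, (if ((2 ^ k : ℕ) : ℝ≥0∞) < ∞ then ((2 : ℝ≥0∞) ^ (k + 1)) ^ q else 0) = ∞ := by
      refine top_le_iff.1 ((ENNReal.tsum_const_eq_top_of_ne_zero (α := ℕ) one_ne_zero).ge.trans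
        (ENNReal.tsum_le_tsum fun k => ?_))
      rw [if_pos (ENNReal.natCast_lt_top _)]
      exact ENNReal.one_le_rpow (one_le_pow₀ (by norm_num)) hq
    rw [this]; simp
  · have hex : ∃ k : ℕ, t ≤ (2 : ℝ≥0∞) ^ (k + 1) := by
      obtain ⟨n, hn⟩ := ENNReal.exists_nat_gt htop
      refine ⟨n, hn.le.trans ?_⟩
      have : n ≤ 2 ^ (n + 1) := (Nat.lt_two_pow_self.trans_le
        (Nat.pow_le_pow_right (by norm_num) (Nat.le_succ n))).le
      exact_mod_cast this
    classical
    have hk := Nat.find_spec hex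
    have hlt : ((2 ^ (Nat.find hex) : ℕ) : ℝ≥0∞) < t := by
      rcases Nat.eq_zero_or_pos (Nat.find hex) with h0 | h0
      · rw [h0]; simpa using h1
      · have := Nat.find_min hex (Nat.sub_lt h0 one_pos)
        rw [show Nat.find hex - 1 + 1 = Nat.find hex by omega, not_le] at this
        exact_mod_cast this
    calc t ^ q ≤ ((2 : ℝ≥0∞) ^ (Nat.find hex + 1)) ^ q := ENNReal.rpow_le_rpow hk hq.le
      _ = (if ((2 ^ (Nat.find hex) : ℕ) : ℝ≥0∞) < t then
            ((2 : ℝ≥0∞) ^ (Nat.find hex + 1)) ^ q else 0) := (if_pos hlt).symm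
      _ ≤ ∑' k : ℕ, (if ((2 ^ k : ℕ) : ℝ≥0∞) < t then ((2 : ℝ≥0∞) ^ (k + 1)) ^ q else 0) :=
          ENNReal.le_tsum _
      _ ≤ _ := le_add_self

/-- Survival at dyadic times bounds the moment by a geometric series of ratio 2^(q-q') < 1. -/
lemma passageMoment_lt_top {a q q' C : ℝ} {x : 𝕏} (hq : 0 < q) (hq' : q < q')
    (h : ∀ n : ℕ, 0 < n → survival P a n x ≤ C * (n : ℝ) ^ (-q')) :
    passageMoment P a q x < ∞ := by
  have hC : 0 ≤ C := by
    have := (survival_nonneg P a 1 x).trans (h 1 one_pos)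
    simpa using this
  have hm : ∀ k : ℕ, MeasurableSet {ξ : ℕ → 𝕏 | ((2 ^ k : ℕ) : ℝ≥0∞) < passageTime a ξ} := by
    intro k
    simp only [lt_passageTime_iff, Set.ofPred_mem_eq]
    exact measurableSet_survivalSet a _
  have hrw : ∀ k : ℕ, (fun ξ : ℕ → 𝕏 => if ((2 ^ k : ℕ) : ℝ≥0∞) < passageTime a ξ then
      ((2 : ℝ≥0∞) ^ (k + 1)) ^ q else 0) =
      {ξ : ℕ → 𝕏 | ((2 ^ k : ℕ) : ℝ≥0∞) < passageTime a ξ}.indicator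
        (fun _ => ((2 : ℝ≥0∞) ^ (k + 1)) ^ q) := by
    intro k; funext ξ; simp [Set.indicator_apply]
  have h1 : passageMoment P a q x ≤ 1 + ∑' k : ℕ, ((2 : ℝ≥0∞) ^ (k + 1)) ^ q *
      ENNReal.ofReal (survival P a (2 ^ k) x) := by
    unfold passageMoment
    refine (lintegral_mono fun ξ => rpow_le_one_add_tsum hq).trans ?_
    rw [lintegral_add_left measurable_const, lintegral_tsum]
    · simp only [lintegral_const, measure_univ, mul_one]
      gcongr with k
      rw [hrw k, lintegral_indicator (hm k), setLIntegral_const, chainLaw_lt_passageTime]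
    · intro k
      rw [hrw k]
      exact (measurable_const.indicator (hm k)).aemeasurable
  have hr1 : (2 : ℝ) ^ (q - q') < 1 := Real.rpow_lt_one_of_one_lt_of_neg (by norm_num) (by linarith)
  have h2 : ∀ k : ℕ, ((2 : ℝ≥0∞) ^ (k + 1)) ^ q * ENNReal.ofReal (survival P a (2 ^ k) x) ≤
      ENNReal.ofReal (C * 2 ^ q * ((2 : ℝ) ^ (q - q')) ^ k) := by
    intro k
    have e : ((2 : ℝ≥0∞) ^ (k + 1)) ^ q = ENNReal.ofReal (((2 : ℝ) ^ (k + 1)) ^ q) := by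
      rw [← ENNReal.ofReal_rpow_of_pos (by positivity), ENNReal.ofReal_pow (by norm_num)]
      simp
    rw [e, ← ENNReal.ofReal_mul (by positivity)]
    apply ENNReal.ofReal_le_ofReal
    have h3 := h (2 ^ k) (by positivity)
    push_cast at h3
    calc ((2 : ℝ) ^ (k + 1)) ^ q * survival P a (2 ^ k) x
        ≤ ((2 : ℝ) ^ (k + 1)) ^ q * (C * ((2 : ℝ) ^ k) ^ (-q')) := by gcongr
      _ = C * 2 ^ q * ((2 : ℝ) ^ (q - q')) ^ k := by
        rw [← Real.rpow_natCast, ← Real.rpow_natCast, ← Real.rpow_natCast, ← Real.rpow_mul (by norm_num),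
          ← Real.rpow_mul (by norm_num), ← Real.rpow_mul (by norm_num)]
        rw [show (2 : ℝ) ^ (((k + 1 : ℕ) : ℝ) * q) * (C * 2 ^ ((k : ℝ) * -q')) =
          C * (2 ^ (((k + 1 : ℕ) : ℝ) * q) * 2 ^ ((k : ℝ) * -q')) by ring,
          ← Real.rpow_add (by norm_num), mul_assoc, ← Real.rpow_add (by norm_num)]
        push_cast
        ring_nf
  refine h1.trans_lt (ENNReal.add_lt_top.2 ⟨ENNReal.one_lt_top, ?_⟩)
  refine (ENNReal.tsum_le_tsum h2).trans_lt ?_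
  have hs : Summable fun k : ℕ => C * 2 ^ q * ((2 : ℝ) ^ (q - q')) ^ k :=
    (summable_geometric_of_lt_one (by positivity) hr1).mul_left _
  rw [← ENNReal.ofReal_tsum_of_nonneg (fun k => by positivity) hs]
  exact ENNReal.ofReal_lt_top

/-- The chain eventually stays outside the ball of radius `a` with probability zero, as soon as its
survival probabilities tend to zero. -/
lemma isRecurrent_of_survival {a : ℝ} (ha : 0 ≤ a)
    (h : ∀ x : 𝕏, Tendsto (fun n => survival P a n x) atTop (𝓝 0)) : IsRecurrent P := by
  have hmeas : ∀ N : ℕ, MeasurableSet {ξ : ℕ → 𝕏 | ∀ n, N ≤ n → a < ‖(ξ n : Plane)‖} := by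
    intro N
    simp only [Set.ofPred_forall]
    exact MeasurableSet.iInter fun n => MeasurableSet.iInter fun _ =>
      measurableSet_norm_gt_at a n
  -- Staying outside from time N on is, after a shift, staying outside from time N - 1 on; the case
  -- N = 0 is the limit of the survival probabilities.
  have h0 : ∀ (N : ℕ) (x : 𝕏),
      chainLaw P (Measure.dirac x) {ξ | ∀ n, N ≤ n → a < ‖(ξ n : Plane)‖} = 0 := by
    intro N
    induction N with
    | zero =>
      intro x
      have hle : ∀ n, chainLaw P (Measure.dirac x) {ξ | ∀ n, 0 ≤ n → a < ‖(ξ n : Plane)‖} ≤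
          ENNReal.ofReal (survival P a n x) := by
        intro n
        unfold survival
        rw [ofReal_measureReal]
        exact measure_mono fun ξ hξ k _ => hξ k (Nat.zero_le k)
      have := ge_of_tendsto' (ENNReal.tendsto_ofReal (h x)) hle
      simpa using this
    | succ N ih =>
      intro x
      have : {ξ : ℕ → 𝕏 | ∀ n, N + 1 ≤ n → a < ‖(ξ n : Plane)‖} =
          (fun (ξ : ℕ → 𝕏) n => ξ (n + 1)) ⁻¹' {ξ | ∀ n, N ≤ n → a < ‖(ξ n : Plane)‖} := by
        ext ξ
        simp only [Set.mem_ofPred_eq, Set.mem_preimage]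
        constructor
        · intro H n hn
          exact H (n + 1) (by omega)
        · intro H n hn
          obtain ⟨m, rfl⟩ : ∃ m, n = m + 1 := ⟨n - 1, by omega⟩
          exact H m (by omega)
      rw [this, chainLaw_preimage_shift P x (hmeas N)]
      simp [ih]
  refine ⟨a, ha, fun μ₀ _ => ?_⟩
  have h1 : ∀ N : ℕ, ∀ᵐ ξ ∂(chainLaw P μ₀), ¬ ∀ n, N ≤ n → a < ‖(ξ n : Plane)‖ := by
    intro N
    rw [ae_iff]
    simp only [not_not]
    rw [chainLaw_eq_lintegral P μ₀ (hmeas N)]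
    simp [h0]
  filter_upwards [ae_all_iff.2 h1] with ξ hξ
  refine liminf_le_of_frequently_le' ?_
  rw [frequently_atTop]
  intro N
  have := hξ N
  push Not at this
  obtain ⟨n, hn, hle⟩ := this
  exact ⟨n, hn, ENNReal.ofReal_le_ofReal hle⟩

end Survival

/-! ### The two limiting drift integrals in terms of Γ. -/

section GammaIntegrals

lemma lintegral_rpow_mul_exp {a r : ℝ} (ha : 0 < a) (hr : 0 < r) :
    ∫⁻ t in Set.Ioi (0 : ℝ), ENNReal.ofReal (t ^ (a - 1) * Real.exp (-(r * t))) =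
      ENNReal.ofReal ((1 / r) ^ a * Real.Gamma a) := by
  have h := Real.integral_rpow_mul_exp_neg_mul_Ioi ha hr
  have hpos : 0 < (1 / r) ^ a * Real.Gamma a :=
    mul_pos (Real.rpow_pos_of_pos (by positivity) _) (Real.Gamma_pos_of_pos ha)
  -- A non-integrable function has Bochner integral 0 by convention, whereas this integral is
  -- positive.
  have hint : Integrable (fun t : ℝ => t ^ (a - 1) * Real.exp (-(r * t)))
      (volume.restrict (Set.Ioi 0)) := by
    by_contra hc
    rw [integral_undef hc] at h
    exact hpos.ne h
  rw [← h, ofReal_integral_eq_lintegral_ofReal hint]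
  filter_upwards [ae_restrict_mem measurableSet_Ioi] with t ht
  exact mul_nonneg (Real.rpow_nonneg (le_of_lt ht) _) (Real.exp_nonneg _)

/-- Multiply by Γ(a+b), write Γ(a+b)(1+s)^(-(a+b)) as the integral of t^(a+b-1) e^(-(1+s)t) over t >
0, and exchange the order by Tonelli. -/
lemma lintegral_beta {a b : ℝ} (ha : 0 < a) (hb : 0 < b) :
    ∫⁻ s in Set.Ioi (0 : ℝ), ENNReal.ofReal (s ^ (a - 1) * (1 + s) ^ (-(a + b))) =
      ENNReal.ofReal (Real.Gamma a * Real.Gamma b / Real.Gamma (a + b)) := by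
  have hG := Real.Gamma_pos_of_pos (add_pos ha hb)
  have hGa := Real.Gamma_pos_of_pos ha
  have h1 : ENNReal.ofReal (Real.Gamma (a + b)) *
      ∫⁻ s in Set.Ioi (0 : ℝ), ENNReal.ofReal (s ^ (a - 1) * (1 + s) ^ (-(a + b))) =
      ENNReal.ofReal (Real.Gamma a * Real.Gamma b) := by
    calc ENNReal.ofReal (Real.Gamma (a + b)) *
        ∫⁻ s in Set.Ioi (0 : ℝ), ENNReal.ofReal (s ^ (a - 1) * (1 + s) ^ (-(a + b)))
        = ∫⁻ s in Set.Ioi (0 : ℝ), ∫⁻ t in Set.Ioi (0 : ℝ), ENNReal.ofReal (s ^ (a - 1) *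
            (t ^ (a + b - 1) * Real.exp (-((1 + s) * t)))) := by
          rw [← lintegral_const_mul _ (by fun_prop)]
          refine setLIntegral_congr_fun measurableSet_Ioi fun s hs => ?_
          have hs' : (0 : ℝ) < s := hs
          rw [show (fun t : ℝ => ENNReal.ofReal (s ^ (a - 1) *
            (t ^ (a + b - 1) * Real.exp (-((1 + s) * t))))) = fun t : ℝ =>
            ENNReal.ofReal (s ^ (a - 1)) * ENNReal.ofReal
            (t ^ (a + b - 1) * Real.exp (-((1 + s) * t))) from
            funext fun t => ENNReal.ofReal_mul (by positivity),
            lintegral_const_mul _ (by fun_prop),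
            lintegral_rpow_mul_exp (add_pos ha hb) (by positivity),
            ← ENNReal.ofReal_mul (by positivity), ← ENNReal.ofReal_mul (by positivity),
            Real.rpow_neg (by positivity), one_div, Real.inv_rpow (by positivity)]
          ring_nf
      _ = ∫⁻ t in Set.Ioi (0 : ℝ), ∫⁻ s in Set.Ioi (0 : ℝ), ENNReal.ofReal (s ^ (a - 1) *
            (t ^ (a + b - 1) * Real.exp (-((1 + s) * t)))) :=
          lintegral_lintegral_swap (by fun_prop)
      _ = ∫⁻ t in Set.Ioi (0 : ℝ), ENNReal.ofReal (Real.Gamma a) *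
            ENNReal.ofReal (t ^ (b - 1) * Real.exp (-(1 * t))) := by
          refine setLIntegral_congr_fun measurableSet_Ioi fun t ht => ?_
          have ht' : (0 : ℝ) < t := ht
          rw [show (fun s : ℝ => ENNReal.ofReal (s ^ (a - 1) *
            (t ^ (a + b - 1) * Real.exp (-((1 + s) * t))))) = fun s : ℝ =>
            ENNReal.ofReal (t ^ (a + b - 1) * Real.exp (-t)) * ENNReal.ofReal
            (s ^ (a - 1) * Real.exp (-(t * s))) from
            funext fun s => by
              rw [← ENNReal.ofReal_mul (by positivity),
                show -((1 + s) * t) = -t + -(t * s) by ring, Real.exp_add]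
              ring_nf,
            lintegral_const_mul _ (by fun_prop), lintegral_rpow_mul_exp ha ht',
            ← ENNReal.ofReal_mul (by positivity), ← ENNReal.ofReal_mul (by positivity),
            one_div, Real.inv_rpow ht'.le, ← Real.rpow_neg ht'.le,
            show b - 1 = (a + b - 1) + -a by ring, Real.rpow_add ht']
          ring_nf
      _ = _ := by
          rw [lintegral_const_mul _ (by fun_prop), lintegral_rpow_mul_exp hb one_pos,
            ← ENNReal.ofReal_mul hGa.le]
          simp
  rw [ENNReal.ofReal_div_of_pos hG, ← h1, mul_comm, ENNReal.mul_div_cancel_right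
    (by simpa using hG) ENNReal.ofReal_ne_top]

lemma integrable_beta {a b : ℝ} (ha : 0 < a) (hb : 0 < b) :
    IntegrableOn (fun s : ℝ => s ^ (a - 1) * (1 + s) ^ (-(a + b))) (Set.Ioi 0) := by
  refine (lintegral_ofReal_ne_top_iff_integrable (by fun_prop) ?_).1 ?_
  · filter_upwards [ae_restrict_mem measurableSet_Ioi] with s hs
    have hs' : (0 : ℝ) < s := hs
    simp only [Pi.zero_apply]
    positivity
  · rw [lintegral_beta ha hb]
    exact ENNReal.ofReal_ne_top

lemma integral_beta {a b : ℝ} (ha : 0 < a) (hb : 0 < b) :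
    ∫ s in Set.Ioi (0 : ℝ), s ^ (a - 1) * (1 + s) ^ (-(a + b)) =
      Real.Gamma a * Real.Gamma b / Real.Gamma (a + b) := by
  have := Real.Gamma_pos_of_pos ha
  have := Real.Gamma_pos_of_pos hb
  have := Real.Gamma_pos_of_pos (add_pos ha hb)
  rw [integral_eq_lintegral_of_nonneg_ae, lintegral_beta ha hb, ENNReal.toReal_ofReal]
  · positivity
  · filter_upwards [ae_restrict_mem measurableSet_Ioi] with s hs
    have hs' : (0 : ℝ) < s := hs
    simp only [Pi.zero_apply]
    positivity
  · fun_prop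

/-- The measure `s ^ (-α) ds` on the half-line. -/
def powerMeasure (α : ℝ) : Measure ℝ :=
  (volume.restrict (Set.Ioi 0)).withDensity fun s => ENNReal.ofReal (s ^ (-α))

lemma powerMeasure_Ioi {α w : ℝ} (hα : 1 < α) (hw : 0 < w) :
    powerMeasure α {s | w < s} = ENNReal.ofReal (w ^ (1 - α) / (α - 1)) := by
  have h1 : {s : ℝ | w < s} = Set.Ioi w := rfl
  have hI : IntegrableOn (fun s : ℝ => s ^ (-α)) (Set.Ioi w) :=
    integrableOn_Ioi_rpow_of_lt (by linarith) hw
  rw [h1, powerMeasure, withDensity_apply _ measurableSet_Ioi,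
    Measure.restrict_restrict measurableSet_Ioi, Set.inter_eq_left.2 (Set.Ioi_subset_Ioi hw.le),
    ← ofReal_integral_eq_lintegral_ofReal hI, integral_Ioi_rpow_of_lt (by linarith) hw]
  · congr 1
    rw [show -α + 1 = -(α - 1) by ring, show 1 - α = -(α - 1) by ring, neg_div_neg_eq]
  · filter_upwards [ae_restrict_mem measurableSet_Ioi] with s hs
    exact Real.rpow_nonneg (hw.le.trans (le_of_lt hs)) _

lemma intervalIntegral_one_add_rpow {c : ℝ} {s : ℝ} (hs : 0 ≤ s) :
    ∫ w in (0 : ℝ)..s, c * (1 + w) ^ (-c - 1) = 1 - (1 + s) ^ (-c) := by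
  have hd : ∀ w ∈ Set.uIcc 0 s, HasDerivAt (fun w : ℝ => -(1 + w) ^ (-c))
      (c * (1 + w) ^ (-c - 1)) w := by
    intro w hw
    rw [Set.uIcc_of_le hs] at hw
    have h1 : HasDerivAt (fun w : ℝ => 1 + w) 1 w := (hasDerivAt_id w).const_add 1
    have := (h1.rpow_const (p := -c) (Or.inl (by linarith [hw.1]))).neg
    exact this.congr_deriv (by ring)
  rw [intervalIntegral.integral_eq_sub_of_hasDerivAt hd]
  · simp; ring
  · apply ContinuousOn.intervalIntegrable
    intro w hw
    rw [Set.uIcc_of_le hs] at hw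
    have h1 : (1 : ℝ) + w ≠ 0 := by linarith [hw.1]
    exact (continuousAt_const.mul ((continuousAt_const.add continuousAt_id).rpow_const
      (Or.inl h1))).continuousWithinAt

/-- Integration by parts in the form of the layer-cake formula for s^(-α) ds, whose mass beyond w is
w^(1-α)/(α-1). The result is a Beta integral with parameters 2-α and α-ν; the recursion for Γ at 1-α
introduces the negative number Γ(1-α). -/
lemma lintegral_radial {α ν : ℝ} (hα : α ∈ Set.Ioo (1 : ℝ) 2) (hν : ν < 1) :
    ∫⁻ s in Set.Ioi (0 : ℝ), ENNReal.ofReal ((1 - (1 + s) ^ (ν - 1)) * s ^ (-α)) =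
      ENNReal.ofReal (-(Real.Gamma (1 - α) * Real.Gamma (α - ν) / Real.Gamma (1 - ν))) := by
  obtain ⟨hα1, hα2⟩ := hα
  set c := 1 - ν with hc
  have hc0 : 0 < c := by linarith
  have hint : ∀ t > 0, IntervalIntegrable (fun w : ℝ => c * (1 + w) ^ (-c - 1)) volume 0 t := by
    intro t ht
    apply ContinuousOn.intervalIntegrable
    intro w hw
    rw [Set.uIcc_of_le ht.le] at hw
    have h1 : (1 : ℝ) + w ≠ 0 := by linarith [hw.1]
    exact (continuousAt_const.mul ((continuousAt_const.add continuousAt_id).rpow_const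
      (Or.inl h1))).continuousWithinAt
  have hae : ∀ᵐ s ∂(powerMeasure α), 0 ≤ s := by
    refine (withDensity_absolutelyContinuous _ _).ae_le ?_
    filter_upwards [ae_restrict_mem measurableSet_Ioi] with s hs using le_of_lt hs
  have hlc := lintegral_comp_eq_lintegral_meas_lt_mul (powerMeasure α) (f := fun s => s) hae
    aemeasurable_id hint (by
      filter_upwards [ae_restrict_mem measurableSet_Ioi] with w hw
      have hw' : (0 : ℝ) < w := hw
      positivity)
  have hL : ∫⁻ s, ENNReal.ofReal (∫ w in (0 : ℝ)..s, c * (1 + w) ^ (-c - 1)) ∂(powerMeasure α) =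
      ∫⁻ s in Set.Ioi (0 : ℝ), ENNReal.ofReal ((1 - (1 + s) ^ (ν - 1)) * s ^ (-α)) := by
    have : ∫⁻ s, ENNReal.ofReal (∫ w in (0 : ℝ)..s, c * (1 + w) ^ (-c - 1)) ∂(powerMeasure α) =
        ∫⁻ s, ENNReal.ofReal (1 - (1 + s) ^ (-c)) ∂(powerMeasure α) := by
      refine lintegral_congr_ae ?_
      filter_upwards [hae] with s hs
      rw [intervalIntegral_one_add_rpow hs]
    rw [this, powerMeasure, lintegral_withDensity_eq_lintegral_mul _ (by fun_prop) (by fun_prop)]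
    refine setLIntegral_congr_fun measurableSet_Ioi fun s hs => ?_
    have hs' : (0 : ℝ) < s := hs
    simp only [Pi.mul_apply]
    rw [← ENNReal.ofReal_mul (by positivity), mul_comm, show -c = ν - 1 by rw [hc]; ring]
  rw [← hL, hlc]
  have hR : ∀ w ∈ Set.Ioi (0 : ℝ), powerMeasure α {a | w < a} * ENNReal.ofReal (c * (1 + w) ^ (-c - 1)) =
      ENNReal.ofReal (c / (α - 1)) *
        ENNReal.ofReal (w ^ ((2 - α) - 1) * (1 + w) ^ (-((2 - α) + (α - ν)))) := by
    intro w hw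
    have hw' : (0 : ℝ) < w := hw
    have : 0 < α - 1 := by linarith
    rw [powerMeasure_Ioi hα1 hw', ← ENNReal.ofReal_mul (by positivity),
      ← ENNReal.ofReal_mul (by positivity)]
    rw [show 2 - α - 1 = 1 - α by ring, show -(2 - α + (α - ν)) = -c - 1 by rw [hc]; ring]
    ring_nf
  rw [setLIntegral_congr_fun measurableSet_Ioi hR, lintegral_const_mul _ (by fun_prop),
    lintegral_beta (by linarith) (by linarith), ← ENNReal.ofReal_mul (by
      have : 0 < α - 1 := by linarith
      positivity)]
  congr 1
  have e1 : Real.Gamma (2 - α) = (1 - α) * Real.Gamma (1 - α) := by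
    rw [← Real.Gamma_add_one (by linarith)]; ring_nf
  have e2 : Real.Gamma (2 - α + (α - ν)) = c * Real.Gamma c := by
    rw [← Real.Gamma_add_one hc0.ne']; rw [hc]; ring_nf
  have hGc := Real.Gamma_pos_of_pos hc0
  have h3 : α - 1 ≠ 0 := by linarith
  rw [e1, e2]
  field_simp
  ring

lemma radial_integrand_nonneg {α ν s : ℝ} (hν : ν < 1) (hs : 0 < s) :
    0 ≤ (1 - (1 + s) ^ (ν - 1)) * s ^ (-α) := by
  have : (1 + s) ^ (ν - 1) ≤ 1 := Real.rpow_le_one_of_one_le_of_nonpos (by linarith) (by linarith)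
  exact mul_nonneg (by linarith) (by positivity)

lemma integrable_radial {α ν : ℝ} (hα : α ∈ Set.Ioo (1 : ℝ) 2) (hν : ν < 1) :
    IntegrableOn (fun s : ℝ => (1 - (1 + s) ^ (ν - 1)) * s ^ (-α)) (Set.Ioi 0) := by
  refine (lintegral_ofReal_ne_top_iff_integrable (by fun_prop) ?_).1 ?_
  · filter_upwards [ae_restrict_mem measurableSet_Ioi] with s hs
    exact radial_integrand_nonneg hν hs
  · rw [lintegral_radial hα hν]
    exact ENNReal.ofReal_ne_top

lemma Gamma_one_sub_neg {α : ℝ} (hα : α ∈ Set.Ioo (1 : ℝ) 2) : Real.Gamma (1 - α) < 0 := by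
  have h := Real.Gamma_add_one (s := 1 - α) (by linarith [hα.1])
  have h2 : 0 < Real.Gamma (1 - α + 1) := Real.Gamma_pos_of_pos (by linarith [hα.2])
  rw [h] at h2
  by_contra! hc
  nlinarith [hα.1]

lemma integral_radial {α ν : ℝ} (hα : α ∈ Set.Ioo (1 : ℝ) 2) (hν : ν < 1) :
    ∫ s in Set.Ioi (0 : ℝ), (1 - (1 + s) ^ (ν - 1)) * s ^ (-α) =
      -(Real.Gamma (1 - α) * Real.Gamma (α - ν) / Real.Gamma (1 - ν)) := by
  have h1 := Gamma_one_sub_neg hα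
  have h2 := Real.Gamma_pos_of_pos (s := α - ν) (by linarith [hα.1])
  have h3 := Real.Gamma_pos_of_pos (s := 1 - ν) (by linarith)
  rw [integral_eq_lintegral_of_nonneg_ae, lintegral_radial hα hν, ENNReal.toReal_ofReal]
  · have : Real.Gamma (1 - α) * Real.Gamma (α - ν) / Real.Gamma (1 - ν) ≤ 0 :=
      div_nonpos_of_nonpos_of_nonneg (mul_nonpos_of_nonpos_of_nonneg h1.le h2.le) h3.le
    linarith
  · filter_upwards [ae_restrict_mem measurableSet_Ioi] with s hs
    exact radial_integrand_nonneg hν hs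
  · fun_prop

/-- The substitution u = s² leads to the Beta integral with parameters 1-α/2 and (α-ν)/2. -/
lemma transverse_substitution {α ν s : ℝ} (hs : 0 < s) :
    s * (1 + s ^ 2) ^ (ν / 2 - 1) * s ^ (-α) = (1 / 2 : ℝ) * ((|(2 : ℝ)| * s ^ ((2 : ℝ) - 1)) •
      ((s ^ (2 : ℝ)) ^ ((1 - α / 2) - 1) *
        (1 + s ^ (2 : ℝ)) ^ (-((1 - α / 2) + (α - ν) / 2)))) := by
  rw [smul_eq_mul, abs_of_pos two_pos, ← Real.rpow_mul hs.le,
    show (2 : ℝ) - 1 = 1 by norm_num, Real.rpow_one, show (s ^ (2 : ℝ)) = s ^ 2 from Real.rpow_two s,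
    show 2 * (1 - α / 2 - 1) = -α by ring,
    show -(1 - α / 2 + (α - ν) / 2) = ν / 2 - 1 by ring]
  ring

lemma integrable_transverse {α ν : ℝ} (hα : α ∈ Set.Ioo (1 : ℝ) 2) (hν : ν < 1) :
    IntegrableOn (fun s : ℝ => s * (1 + s ^ 2) ^ (ν / 2 - 1) * s ^ (-α)) (Set.Ioi 0) := by
  have h := (integrableOn_Ioi_comp_rpow_iff _ (two_ne_zero (α := ℝ))).2
    (integrable_beta (a := 1 - α / 2) (b := (α - ν) / 2) (by linarith [hα.2]) (by linarith [hα.1]))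
  exact (integrableOn_congr_fun (fun s hs => transverse_substitution hs) measurableSet_Ioi).2
    (h.const_mul (1 / 2))

lemma integral_transverse {α ν : ℝ} (hα : α ∈ Set.Ioo (1 : ℝ) 2) (hν : ν < 1) :
    ∫ s in Set.Ioi (0 : ℝ), s * (1 + s ^ 2) ^ (ν / 2 - 1) * s ^ (-α) =
      Real.Gamma ((α - ν) / 2) * Real.Gamma (1 - α / 2) / (2 * Real.Gamma (1 - ν / 2)) := by
  rw [setIntegral_congr_fun measurableSet_Ioi (fun s hs => transverse_substitution hs),
    integral_const_mul, integral_comp_rpow_Ioi (fun y : ℝ => y ^ ((1 - α / 2) - 1) *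
        (1 + y) ^ (-((1 - α / 2) + (α - ν) / 2))) (two_ne_zero (α := ℝ)),
    integral_beta (by linarith [hα.2]) (by linarith [hα.1]),
    show 1 - α / 2 + (α - ν) / 2 = 1 - ν / 2 by ring]
  have := Real.Gamma_pos_of_pos (s := 1 - ν / 2) (by linarith)
  field_simp

end GammaIntegrals

/-! ### Sign and zero of the critical function. -/

section CriticalRoot

/-- The left-hand side of the equation for the critical exponent. -/
def criticalFun (α pR pT cR cT ν : ℝ) : ℝ :=
  pR * cR * (Real.Gamma (α - ν) * Real.Gamma (1 - α) / Real.Gamma (1 - ν)) +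
    pT * cT * (Real.Gamma ((α - ν) / 2) * Real.Gamma (1 - α / 2) / Real.Gamma (1 - ν / 2))

/-- Legendre duplication at (α-ν)/2 and (1-ν)/2 turns both summands into multiples of one positive Γ
quotient. The other factor depends on ν only through a quotient Γ(s+h)/Γ(s) with s = (1-ν)/2 and h =
α/2, which is monotone in s. -/
lemma criticalFun_eq {α ν : ℝ} (hν : ν < 1) (pR pT cR cT : ℝ) :
    criticalFun α pR pT cR cT ν = Real.Gamma ((α - ν) / 2) / Real.Gamma (1 - ν / 2) *
      (pT * cT * Real.Gamma (1 - α / 2) - pR * cR * (-Real.Gamma (1 - α)) * 2 ^ (α - 1) *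
        (Real.Gamma ((1 - ν) / 2 + α / 2) / Real.Gamma ((1 - ν) / 2))) := by
  have h1 := Real.Gamma_mul_Gamma_add_half ((α - ν) / 2)
  have h2 := Real.Gamma_mul_Gamma_add_half ((1 - ν) / 2)
  rw [show 2 * ((α - ν) / 2) = α - ν by ring,
    show (α - ν) / 2 + 1 / 2 = (1 - ν) / 2 + α / 2 by ring] at h1
  rw [show 2 * ((1 - ν) / 2) = 1 - ν by ring, show (1 - ν) / 2 + 1 / 2 = 1 - ν / 2 by ring] at h2
  have g1 := Real.Gamma_pos_of_pos (s := 1 - ν) (by linarith)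
  have g2 := Real.Gamma_pos_of_pos (s := 1 - ν / 2) (by linarith)
  have g3 := Real.Gamma_pos_of_pos (s := (1 - ν) / 2) (by linarith)
  have hpi : 0 < √Real.pi := Real.sqrt_pos.2 Real.pi_pos
  have h3 : Real.Gamma (α - ν) / Real.Gamma (1 - ν) = 2 ^ (α - 1) *
      (Real.Gamma ((α - ν) / 2) / Real.Gamma (1 - ν / 2)) *
        (Real.Gamma ((1 - ν) / 2 + α / 2) / Real.Gamma ((1 - ν) / 2)) := by
    have hp : (2 : ℝ) ^ (1 - (1 - ν)) = 2 ^ (α - 1) * 2 ^ (1 - (α - ν)) := by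
      rw [← Real.rpow_add two_pos]; ring_nf
    have hp2 : (0 : ℝ) < 2 ^ (1 - (α - ν)) := by positivity
    rw [hp] at h2
    have : 2 ^ (α - 1) * (Real.Gamma ((α - ν) / 2) / Real.Gamma (1 - ν / 2)) *
        (Real.Gamma ((1 - ν) / 2 + α / 2) / Real.Gamma ((1 - ν) / 2)) =
        2 ^ (α - 1) * (Real.Gamma ((α - ν) / 2) * Real.Gamma ((1 - ν) / 2 + α / 2)) /
          (Real.Gamma ((1 - ν) / 2) * Real.Gamma (1 - ν / 2)) := by
      field_simp
    rw [this, h1, h2]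
    field_simp
  unfold criticalFun
  rw [mul_div_right_comm, h3]
  ring

/-- The points s+h and t are convex combinations of s and t+h with interchanged weights; adding the
two convexity inequalities for log Γ gives the claim. -/
lemma Gamma_ratio_mono {h s t : ℝ} (hh : 0 < h) (hs : 0 < s) (hst : s < t) :
    Real.Gamma (s + h) / Real.Gamma s ≤ Real.Gamma (t + h) / Real.Gamma t := by
  have g1 := Real.Gamma_pos_of_pos hs
  have g2 := Real.Gamma_pos_of_pos (hs.trans hst)
  have g3 := Real.Gamma_pos_of_pos (add_pos hs hh)
  have g4 := Real.Gamma_pos_of_pos (add_pos (hs.trans hst) hh)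
  have hc := Real.convexOn_log_Gamma
  have h1 := hc.2 (show s ∈ Set.Ioi (0 : ℝ) from hs) (show t + h ∈ Set.Ioi (0 : ℝ) by
      simp only [Set.mem_Ioi]; linarith)
    (show 0 ≤ (t - s) / (t + h - s) from div_nonneg (by linarith) (by linarith))
    (show 0 ≤ h / (t + h - s) from div_nonneg (by linarith) (by linarith))
    (by rw [← add_div, div_eq_one_iff_eq (by linarith)]; ring)
  have h2 := hc.2 (show s ∈ Set.Ioi (0 : ℝ) from hs) (show t + h ∈ Set.Ioi (0 : ℝ) by
      simp only [Set.mem_Ioi]; linarith)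
    (show 0 ≤ h / (t + h - s) from div_nonneg (by linarith) (by linarith))
    (show 0 ≤ (t - s) / (t + h - s) from div_nonneg (by linarith) (by linarith))
    (by rw [← add_div, div_eq_one_iff_eq (by linarith)]; ring)
  have hd : t + h - s ≠ 0 := by linarith
  simp only [smul_eq_mul, Function.comp] at h1 h2
  rw [show (t - s) / (t + h - s) * s + h / (t + h - s) * (t + h) = s + h by field_simp; ring] at h1
  rw [show h / (t + h - s) * s + (t - s) / (t + h - s) * (t + h) = t by field_simp; ring] at h2
  have h3 : Real.log (Real.Gamma (s + h)) + Real.log (Real.Gamma t) ≤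
      Real.log (Real.Gamma s) + Real.log (Real.Gamma (t + h)) := by
    have e : (t - s) / (t + h - s) = 1 - h / (t + h - s) := by field_simp; ring
    rw [e] at h1 h2
    linarith
  rw [← Real.log_mul g3.ne' g2.ne', ← Real.log_mul g1.ne' g4.ne',
    Real.log_le_log_iff (by positivity) (by positivity)] at h3
  rw [div_le_div_iff₀ g1 g2]
  linarith

/-- The right-hand side has a strictly increasing prefactor, which upgrades monotonicity to
strictness, and it extends continuously to s = 0, where it vanishes. -/
lemma Gamma_ratio_eq {h s : ℝ} (hh : 0 < h) (hs : 0 < s) :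
    Real.Gamma (s + h) / Real.Gamma s =
      s / (s + h) * (Real.Gamma (s + 1 + h) / Real.Gamma (s + 1)) := by
  have g1 := Real.Gamma_pos_of_pos hs
  rw [show s + 1 + h = s + h + 1 by ring, Real.Gamma_add_one hs.ne',
    Real.Gamma_add_one (by positivity)]
  field_simp

lemma Gamma_ratio_strictMono {h s t : ℝ} (hh : 0 < h) (hs : 0 < s) (hst : s < t) :
    Real.Gamma (s + h) / Real.Gamma s < Real.Gamma (t + h) / Real.Gamma t := by
  have ht := hs.trans hst
  rw [Gamma_ratio_eq hh hs, Gamma_ratio_eq hh ht]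
  have g1 := Real.Gamma_pos_of_pos (s := s + 1) (by linarith)
  have g2 := Real.Gamma_pos_of_pos (s := s + 1 + h) (by linarith)
  refine mul_lt_mul ?_ (Gamma_ratio_mono hh (by linarith) (by linarith)) (by positivity)
    (by positivity)
  rw [div_lt_div_iff₀ (by linarith) (by linarith)]
  nlinarith

variable {α pR pT cR cT : ℝ}

lemma criticalFun_neg_of_lt_root (hα : α ∈ Set.Ioo (1 : ℝ) 2) (hR : 0 < pR * cR) {ν ν' : ℝ}
    (hν : ν' < ν) (hν1 : ν < 1) (h : criticalFun α pR pT cR cT ν = 0) :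
    criticalFun α pR pT cR cT ν' < 0 := by
  rw [criticalFun_eq hν1] at h
  rw [criticalFun_eq (hν.trans hν1)]
  have g1 := Gamma_one_sub_neg hα
  have hpos : ∀ μ : ℝ, μ < 1 → 0 < Real.Gamma ((α - μ) / 2) / Real.Gamma (1 - μ / 2) := fun μ hμ =>
    div_pos (Real.Gamma_pos_of_pos (by linarith [hα.1])) (Real.Gamma_pos_of_pos (by linarith))
  have h0 := (mul_eq_zero.1 h).resolve_left (hpos ν hν1).ne'
  have hm := Gamma_ratio_strictMono (h := α / 2) (s := (1 - ν) / 2) (t := (1 - ν') / 2)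
    (by linarith [hα.1]) (by linarith) (by linarith)
  have hD : 0 < pR * cR * (-Real.Gamma (1 - α)) * 2 ^ (α - 1) :=
    mul_pos (mul_pos hR (by linarith)) (by positivity)
  refine mul_neg_of_pos_of_neg (hpos ν' (hν.trans hν1)) ?_
  nlinarith [mul_lt_mul_of_pos_left hm hD]

lemma criticalFun_pos_of_root_lt (hα : α ∈ Set.Ioo (1 : ℝ) 2) (hR : 0 < pR * cR) {ν ν' : ℝ}
    (hν : ν < ν') (hν1 : ν' < 1) (h : criticalFun α pR pT cR cT ν = 0) :
    0 < criticalFun α pR pT cR cT ν' := by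
  rw [criticalFun_eq (hν.trans hν1)] at h
  rw [criticalFun_eq hν1]
  have g1 := Gamma_one_sub_neg hα
  have hpos : ∀ μ : ℝ, μ < 1 → 0 < Real.Gamma ((α - μ) / 2) / Real.Gamma (1 - μ / 2) := fun μ hμ =>
    div_pos (Real.Gamma_pos_of_pos (by linarith [hα.1])) (Real.Gamma_pos_of_pos (by linarith))
  have h0 := (mul_eq_zero.1 h).resolve_left (hpos ν (hν.trans hν1)).ne'
  have hm := Gamma_ratio_strictMono (h := α / 2) (s := (1 - ν') / 2) (t := (1 - ν) / 2)
    (by linarith [hα.1]) (by linarith) (by linarith)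
  have hD : 0 < pR * cR * (-Real.Gamma (1 - α)) * 2 ^ (α - 1) :=
    mul_pos (mul_pos hR (by linarith)) (by positivity)
  refine mul_pos (hpos ν' hν1) ?_
  nlinarith [mul_lt_mul_of_pos_left hm hD]

/-- Euler's reflection formula at α and at α/2, with sin(πα) = 2 sin(πα/2) cos(πα/2). -/
lemma criticalFun_zero (hα : α ∈ Set.Ioo (1 : ℝ) 2) :
    criticalFun α pR pT cR cT 0 = Real.pi / Real.sin (Real.pi * α) *
      (pR * cR + 2 * pT * cT * Real.cos (Real.pi * α / 2)) := by
  have h1 := Real.Gamma_mul_Gamma_one_sub α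
  have h2 := Real.Gamma_mul_Gamma_one_sub (α / 2)
  have hs : Real.sin (Real.pi * α) =
      2 * Real.sin (Real.pi * (α / 2)) * Real.cos (Real.pi * (α / 2)) := by
    rw [← Real.sin_two_mul]; ring_nf
  have hsin : Real.sin (Real.pi * (α / 2)) ≠ 0 :=
    (Real.sin_pos_of_pos_of_lt_pi (by nlinarith [hα.1, Real.pi_pos])
      (by nlinarith [hα.2, Real.pi_pos])).ne'
  have hcos : Real.cos (Real.pi * (α / 2)) ≠ 0 :=
    (Real.cos_neg_of_pi_div_two_lt_of_lt (by nlinarith [hα.1, Real.pi_pos])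
      (by nlinarith [hα.2, Real.pi_pos])).ne
  unfold criticalFun
  simp only [sub_zero, zero_div, Real.Gamma_one, div_one]
  rw [h1, h2, hs, mul_div_assoc Real.pi α 2]
  generalize Real.sin (Real.pi * (α / 2)) = u at *
  generalize Real.cos (Real.pi * (α / 2)) = v at *
  field_simp

lemma sin_pi_mul_neg (hα : α ∈ Set.Ioo (1 : ℝ) 2) : Real.sin (Real.pi * α) < 0 := by
  have : Real.sin (Real.pi * α) = -Real.sin (Real.pi * α - Real.pi) := by
    rw [Real.sin_sub_pi]; ring
  rw [this, neg_neg_iff_pos]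
  exact Real.sin_pos_of_pos_of_lt_pi (by nlinarith [hα.1, Real.pi_pos])
    (by nlinarith [hα.2, Real.pi_pos])

lemma continuousAt_criticalFun_zero (hα : α ∈ Set.Ioo (1 : ℝ) 2) :
    ContinuousAt (criticalFun α pR pT cR cT) 0 := by
  have hG : ∀ s : ℝ, 0 < s → ContinuousAt Real.Gamma s := fun s hs =>
    (Real.differentiableAt_Gamma fun m => by
      have : (0 : ℝ) ≤ m := Nat.cast_nonneg m
      linarith).continuousAt
  have c1 : ContinuousAt (fun ν => Real.Gamma (α - ν)) 0 :=
    ContinuousAt.comp (g := Real.Gamma) (hG _ (by linarith [hα.1])) (by fun_prop)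
  have c2 : ContinuousAt (fun ν : ℝ => Real.Gamma (1 - ν)) 0 :=
    ContinuousAt.comp (g := Real.Gamma) (hG _ (by norm_num)) (by fun_prop)
  have c3 : ContinuousAt (fun ν => Real.Gamma ((α - ν) / 2)) 0 :=
    ContinuousAt.comp (g := Real.Gamma) (hG _ (by linarith [hα.1])) (by fun_prop)
  have c4 : ContinuousAt (fun ν : ℝ => Real.Gamma (1 - ν / 2)) 0 :=
    ContinuousAt.comp (g := Real.Gamma) (hG _ (by norm_num)) (by fun_prop)
  unfold criticalFun
  exact (continuousAt_const.mul ((c1.mul continuousAt_const).div c2 (by simp))).add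
    (continuousAt_const.mul ((c3.mul continuousAt_const).div c4 (by simp)))

/-- Intermediate values in the variable s = (1-ν)/2 on [0, 1/2]: at s = 1/2 (ν = 0) the sign comes
from the hypothesis, at s = 0 (ν = 1) only the positive transverse term is left. -/
lemma exists_criticalRoot (hα : α ∈ Set.Ioo (1 : ℝ) 2) (hT : 0 < pT * cT)
    (h : 0 < pR * cR + 2 * pT * cT * Real.cos (Real.pi * α / 2)) :
    ∃ ν ∈ Set.Ioo (0 : ℝ) 1, criticalFun α pR pT cR cT ν = 0 := by
  have hα0 : 0 < α / 2 := by linarith [hα.1]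
  have hneg : criticalFun α pR pT cR cT 0 < 0 := by
    rw [criticalFun_zero hα]
    exact mul_neg_of_neg_of_pos (div_neg_of_pos_of_neg Real.pi_pos (sin_pi_mul_neg hα)) h
  rw [criticalFun_eq one_pos] at hneg
  have hpos : ∀ μ : ℝ, μ < 1 → 0 < Real.Gamma ((α - μ) / 2) / Real.Gamma (1 - μ / 2) := fun μ hμ =>
    div_pos (Real.Gamma_pos_of_pos (by linarith [hα.1])) (Real.Gamma_pos_of_pos (by linarith))
  have hneg' := neg_of_mul_neg_right hneg (hpos 0 one_pos).le
  set D := pR * cR * (-Real.Gamma (1 - α)) * 2 ^ (α - 1) with hD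
  set k : ℝ → ℝ := fun s => pT * cT * Real.Gamma (1 - α / 2) -
    D * (s / (s + α / 2) * (Real.Gamma (s + 1 + α / 2) / Real.Gamma (s + 1))) with hk
  have hG : ∀ s : ℝ, 0 < s → ContinuousAt Real.Gamma s := fun s hs =>
    (Real.differentiableAt_Gamma fun m => by
      have : (0 : ℝ) ≤ m := Nat.cast_nonneg m
      linarith).continuousAt
  have hcont : ContinuousOn k (Set.Icc 0 (1 / 2)) := by
    intro s hs
    have hs0 := hs.1
    have c1 : ContinuousAt (fun s => Real.Gamma (s + 1 + α / 2)) s :=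
      ContinuousAt.comp (g := Real.Gamma) (hG _ (by positivity)) (by fun_prop)
    have c2 : ContinuousAt (fun s : ℝ => Real.Gamma (s + 1)) s :=
      ContinuousAt.comp (g := Real.Gamma) (hG _ (by positivity)) (by fun_prop)
    have c3 : ContinuousAt (fun s : ℝ => s / (s + α / 2)) s :=
      continuousAt_id.div (by fun_prop) (by positivity)
    exact (continuousAt_const.sub (continuousAt_const.mul (c3.mul (c1.div c2
      (Real.Gamma_pos_of_pos (by positivity)).ne')))).continuousWithinAt
  have hk0 : 0 < k 0 := by
    simp only [hk, zero_div, zero_mul, mul_zero, sub_zero]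
    exact mul_pos hT (Real.Gamma_pos_of_pos (by linarith [hα.2]))
  have hk1 : k (1 / 2) < 0 := by
    simp only [hk]
    rw [← Gamma_ratio_eq hα0 (by norm_num)]
    simpa using hneg'
  obtain ⟨s, hs, hs0⟩ := intermediate_value_Ioo' (by norm_num) hcont ⟨hk1, hk0⟩
  refine ⟨1 - 2 * s, ⟨by linarith [hs.2], by linarith [hs.1]⟩, ?_⟩
  rw [criticalFun_eq (by linarith [hs.1]), show (1 - (1 - 2 * s)) / 2 = s by ring,
    Gamma_ratio_eq hα0 hs.1]
  exact mul_eq_zero_of_right _ hs0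

end CriticalRoot

/-! ### Truncated-power asymptotics from uniform tails. -/

section UniformTails

variable {ι Ω : Type*} [MeasurableSpace Ω]

/-- The tails `y ^ α * μ i {y < Y}` tend to `c` as `y → ∞`, uniformly in `i ∈ A`. -/
def UniformTail (μ : ι → Measure Ω) (A : Set ι) (Y : Ω → ℝ) (α c : ℝ) : Prop :=
  ∀ ε > 0, ∃ y₀ > 0, ∀ y ≥ y₀, ∀ i ∈ A, |y ^ α * (μ i).real {ω | y < Y ω} - c| ≤ ε

variable {μ : ι → Measure Ω} {A : Set ι} {Y : Ω → ℝ} {α c : ℝ}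

lemma UniformTail.exists_bound (h : UniformTail μ A Y α c)
    (hμ : ∀ i ∈ A, IsProbabilityMeasure (μ i)) (hα : 0 < α) :
    ∃ M > 0, ∀ i ∈ A, ∀ y > 0, y ^ α * (μ i).real {ω | y < Y ω} ≤ M := by
  obtain ⟨y₀, hy₀, H⟩ := h 1 one_pos
  refine ⟨y₀ ^ α + |c| + 1, by positivity, fun i hi y hy => ?_⟩
  have := hμ i hi
  rcases le_total y₀ y with h1 | h1
  · have h2 := (abs_le.1 (H y h1 i hi)).2
    have h3 : 0 ≤ y₀ ^ α := by positivity
    linarith [le_abs_self c]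
  · have h2 : y ^ α ≤ y₀ ^ α := Real.rpow_le_rpow hy.le h1 hα.le
    have h3 : (μ i).real {ω | y < Y ω} ≤ 1 := measureReal_le_one
    have h4 : 0 ≤ (μ i).real {ω | y < Y ω} := measureReal_nonneg
    have h5 : y ^ α * (μ i).real {ω | y < Y ω} ≤ y₀ ^ α * 1 :=
      mul_le_mul h2 h3 h4 (by positivity)
    linarith [abs_nonneg c]

/-- A nonnegative density on the half-line that is integrable against `s ^ (-α) ds`. -/
structure TailDensity (α : ℝ) (D : ℝ → ℝ) : Prop where
  measurable : Measurable D
  nonneg : ∀ s > 0, 0 ≤ D s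
  intervalIntegrable : ∀ t > 0, IntervalIntegrable D volume 0 t
  integrable : IntegrableOn (fun s => D s * s ^ (-α)) (Set.Ioi 0)

variable {D : ℝ → ℝ}

lemma antitone_tail (ν : Measure Ω) [IsFiniteMeasure ν] (Y : Ω → ℝ) {r : ℝ} (hr : 0 < r) :
    Antitone fun s => ν.real {ω | r * s < Y ω} := by
  intro s t hst
  refine measureReal_mono fun ω hω => ?_
  exact lt_of_le_of_lt (mul_le_mul_of_nonneg_left hst hr.le) hω

lemma TailDensity.mul_tail_le (hD : TailDensity α D) {ν : Measure Ω} {M r s : ℝ} (hr : 0 < r)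
    (hs : 0 < s) (hM : ∀ y > 0, y ^ α * ν.real {ω | y < Y ω} ≤ M) :
    D s * ν.real {ω | r * s < Y ω} ≤ M * r ^ (-α) * (D s * s ^ (-α)) := by
  have h1 := hM (r * s) (by positivity)
  have hp : 0 < (r * s) ^ α := by positivity
  have h2 : ν.real {ω | r * s < Y ω} ≤ M * (r * s) ^ (-α) := by
    rw [Real.rpow_neg (by positivity), ← div_eq_mul_inv, le_div_iff₀ hp]
    linarith
  rw [Real.mul_rpow hr.le hs.le] at h2
  calc D s * ν.real {ω | r * s < Y ω} ≤ D s * (M * (r ^ (-α) * s ^ (-α))) :=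
        mul_le_mul_of_nonneg_left h2 (hD.nonneg s hs)
    _ = _ := by ring

lemma TailDensity.integrable_mul_tail (hD : TailDensity α D) {ν : Measure Ω} [IsFiniteMeasure ν]
    {M r : ℝ} (hr : 0 < r) (hM : ∀ y > 0, y ^ α * ν.real {ω | y < Y ω} ≤ M) :
    IntegrableOn (fun s => D s * ν.real {ω | r * s < Y ω}) (Set.Ioi 0) := by
  refine Integrable.mono' (hD.integrable.const_mul (M * r ^ (-α)))
    (hD.measurable.mul (antitone_tail ν Y hr).measurable).aestronglyMeasurable ?_
  filter_upwards [ae_restrict_mem measurableSet_Ioi] with s hs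
  rw [Real.norm_of_nonneg (mul_nonneg (hD.nonneg s hs) measureReal_nonneg)]
  exact hD.mul_tail_le hr hs hM

/-- Layer-cake formula. It expresses the mean of a function of the jump through the jump's tail, the
only information available. -/
lemma TailDensity.lintegral_primitive (hD : TailDensity α D) {ν : Measure Ω} [IsFiniteMeasure ν]
    (hY : Measurable Y) (hY0 : ∀ ω, 0 ≤ Y ω) {r : ℝ} (hr : 0 < r) :
    ∫⁻ ω, ENNReal.ofReal (∫ s in (0 : ℝ)..(Y ω / r), D s) ∂ν =
      ∫⁻ s in Set.Ioi (0 : ℝ), ENNReal.ofReal (D s * ν.real {ω | r * s < Y ω}) := by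
  rw [lintegral_comp_eq_lintegral_meas_lt_mul ν (f := fun ω => Y ω / r)
    (ae_of_all _ fun ω => div_nonneg (hY0 ω) hr.le) (by fun_prop) hD.intervalIntegrable
    (by filter_upwards [ae_restrict_mem measurableSet_Ioi] with s hs using hD.nonneg s hs)]
  refine setLIntegral_congr_fun measurableSet_Ioi fun s hs => ?_
  have : {ω | s < Y ω / r} = {ω | r * s < Y ω} := by
    ext ω
    simp only [Set.mem_ofPred_eq]
    rw [lt_div_iff₀ hr, mul_comm]
  rw [this, ENNReal.ofReal_mul (hD.nonneg s hs), ofReal_measureReal, mul_comm]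

lemma TailDensity.primitive_nonneg (hD : TailDensity α D) {t : ℝ} (ht : 0 ≤ t) :
    0 ≤ ∫ s in (0 : ℝ)..t, D s := by
  rw [intervalIntegral.integral_of_le ht]
  exact setIntegral_nonneg measurableSet_Ioc fun s hs => hD.nonneg s hs.1

lemma TailDensity.measurable_primitive (hD : TailDensity α D) (hY : Measurable Y)
    (hY0 : ∀ ω, 0 ≤ Y ω) {r : ℝ} (hr : 0 < r) :
    Measurable fun ω => ∫ s in (0 : ℝ)..(Y ω / r), D s := by
  -- Measurability follows from monotonicity of the primitive; the cut-off at 0 is there because `D`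
  -- is known to be nonnegative only on the positive half-line.
  have hm : Monotone fun t : ℝ => ∫ s in (0 : ℝ)..(max t 0), D s := by
    intro t u htu
    have hle : max t 0 ≤ max u 0 := max_le_max_right 0 htu
    simp only
    have hii : ∀ v : ℝ, 0 ≤ v → IntervalIntegrable D volume 0 v := fun v hv => by
      rcases hv.eq_or_lt with h | h
      · rw [← h]
      · exact hD.intervalIntegrable v h
    rw [← sub_nonneg, intervalIntegral.integral_interval_sub_left (hii _ (le_max_right _ _))
      (hii _ (le_max_right _ _)), intervalIntegral.integral_of_le hle]
    exact setIntegral_nonneg measurableSet_Ioc fun s hs =>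
      hD.nonneg s ((le_max_right t 0).trans_lt hs.1)
  have := hm.measurable.comp (hY.div_const r)
  simpa only [Function.comp_def, max_eq_left (div_nonneg (hY0 _) hr.le)] using this

lemma TailDensity.integrable_primitive (hD : TailDensity α D) {ν : Measure Ω} [IsFiniteMeasure ν]
    (hY : Measurable Y) (hY0 : ∀ ω, 0 ≤ Y ω) {M r : ℝ} (hr : 0 < r)
    (hM : ∀ y > 0, y ^ α * ν.real {ω | y < Y ω} ≤ M) :
    Integrable (fun ω => ∫ s in (0 : ℝ)..(Y ω / r), D s) ν := by
  refine (lintegral_ofReal_ne_top_iff_integrable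
    (hD.measurable_primitive hY hY0 hr).aestronglyMeasurable
    (ae_of_all _ fun ω => hD.primitive_nonneg (div_nonneg (hY0 ω) hr.le))).1 ?_
  rw [hD.lintegral_primitive hY hY0 hr]
  refine (lintegral_ofReal_ne_top_iff_integrable
    (hD.integrable_mul_tail hr hM).aestronglyMeasurable ?_).2 (hD.integrable_mul_tail hr hM)
  filter_upwards [ae_restrict_mem measurableSet_Ioi] with s hs
  exact mul_nonneg (hD.nonneg s hs) measureReal_nonneg

lemma TailDensity.integral_primitive (hD : TailDensity α D) {ν : Measure Ω} [IsFiniteMeasure ν]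
    (hY : Measurable Y) (hY0 : ∀ ω, 0 ≤ Y ω) {r : ℝ} (hr : 0 < r) :
    ∫ ω, (∫ s in (0 : ℝ)..(Y ω / r), D s) ∂ν =
      ∫ s in Set.Ioi (0 : ℝ), D s * ν.real {ω | r * s < Y ω} := by
  rw [integral_eq_lintegral_of_nonneg_ae, integral_eq_lintegral_of_nonneg_ae,
    hD.lintegral_primitive hY hY0 hr]
  · filter_upwards [ae_restrict_mem measurableSet_Ioi] with s hs
    exact mul_nonneg (hD.nonneg s hs) measureReal_nonneg
  · exact (hD.measurable.mul (antitone_tail ν Y hr).measurable).aestronglyMeasurable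
  · exact ae_of_all _ fun ω => hD.primitive_nonneg (div_nonneg (hY0 ω) hr.le)
  · exact (hD.measurable_primitive hY hY0 hr).aestronglyMeasurable

lemma TailDensity.integral_primitive_le (hD : TailDensity α D) {ν : Measure Ω} [IsFiniteMeasure ν]
    (hY : Measurable Y) (hY0 : ∀ ω, 0 ≤ Y ω) {M r : ℝ} (hr : 0 < r)
    (hM : ∀ y > 0, y ^ α * ν.real {ω | y < Y ω} ≤ M) :
    ∫ ω, (∫ s in (0 : ℝ)..(Y ω / r), D s) ∂ν ≤
      M * r ^ (-α) * ∫ s in Set.Ioi (0 : ℝ), D s * s ^ (-α) := by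
  rw [hD.integral_primitive hY hY0 hr, ← integral_const_mul]
  exact setIntegral_mono_on (hD.integrable_mul_tail hr hM) (hD.integrable.const_mul _)
    measurableSet_Ioi fun s hs => hD.mul_tail_le hr hs hM

/-- The scaled tail (rs)^α ν(Y > rs) is within ε of c once s ≥ y₀/r; on the remaining interval,
which shrinks as r grows, it differs from c by at most M + c. -/
lemma TailDensity.abs_integral_primitive_sub_le (hD : TailDensity α D) {ν : Measure Ω}
    [IsFiniteMeasure ν] (hY : Measurable Y) (hY0 : ∀ ω, 0 ≤ Y ω) {M r ε y₀ : ℝ} (hr : 0 < r)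
    (hc : 0 ≤ c) (hM0 : 0 ≤ M) (hε : 0 ≤ ε)
    (hM : ∀ y > 0, y ^ α * ν.real {ω | y < Y ω} ≤ M)
    (hε' : ∀ y ≥ y₀, |y ^ α * ν.real {ω | y < Y ω} - c| ≤ ε) :
    |r ^ α * ∫ ω, (∫ s in (0 : ℝ)..(Y ω / r), D s) ∂ν -
        c * ∫ s in Set.Ioi (0 : ℝ), D s * s ^ (-α)| ≤
      ε * (∫ s in Set.Ioi (0 : ℝ), D s * s ^ (-α)) +
        (M + c) * ∫ s in Set.Ioc (0 : ℝ) (y₀ / r), D s * s ^ (-α) := by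
  have hI1 := (hD.integrable_mul_tail hr hM).const_mul (r ^ α)
  have hI2 := hD.integrable.const_mul c
  have hind : ∫ s in Set.Ioc (0 : ℝ) (y₀ / r), D s * s ^ (-α) =
      ∫ s in Set.Ioi (0 : ℝ), (Set.Ioc (0 : ℝ) (y₀ / r)).indicator (fun s => D s * s ^ (-α)) s := by
    rw [setIntegral_indicator measurableSet_Ioc, Set.inter_eq_right.2 Set.Ioc_subset_Ioi_self]
  have hI3 : IntegrableOn ((Set.Ioc (0 : ℝ) (y₀ / r)).indicator (fun s => D s * s ^ (-α)))
      (Set.Ioi 0) := hD.integrable.indicator measurableSet_Ioc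
  rw [hD.integral_primitive hY hY0 hr, hind, ← integral_const_mul, ← integral_const_mul,
    ← integral_const_mul, ← integral_const_mul, ← integral_sub hI1 hI2,
    ← integral_add (hD.integrable.const_mul ε) (hI3.const_mul (M + c))]
  rw [← Real.norm_eq_abs]
  refine norm_integral_le_of_norm_le ((hD.integrable.const_mul ε).add (hI3.const_mul (M + c))) ?_
  filter_upwards [ae_restrict_mem measurableSet_Ioi] with s hs
  have hs' : (0 : ℝ) < s := hs
  have hDs := hD.nonneg s hs
  have hDp : 0 ≤ D s * s ^ (-α) := mul_nonneg hDs (by positivity)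
  have e : r ^ α * (D s * ν.real {ω | r * s < Y ω}) - c * (D s * s ^ (-α)) =
      (D s * s ^ (-α)) * ((r * s) ^ α * ν.real {ω | r * s < Y ω} - c) := by
    rw [Real.mul_rpow hr.le hs'.le, Real.rpow_neg hs'.le]
    have : s ^ α ≠ 0 := by positivity
    field_simp
  rw [e, Real.norm_eq_abs, abs_mul, abs_of_nonneg hDp]
  by_cases hmem : s ∈ Set.Ioc (0 : ℝ) (y₀ / r)
  · rw [Set.indicator_of_mem hmem]
    have h0 : 0 ≤ (r * s) ^ α * ν.real {ω | r * s < Y ω} :=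
      mul_nonneg (by positivity) measureReal_nonneg
    have h1 : |(r * s) ^ α * ν.real {ω | r * s < Y ω} - c| ≤ M + c := by
      rw [abs_le]
      constructor <;> linarith [hM (r * s) (by positivity)]
    nlinarith [mul_le_mul_of_nonneg_left h1 hDp, mul_nonneg hε hDp]
  · rw [Set.indicator_of_notMem hmem, mul_zero, add_zero]
    have h1 : y₀ ≤ r * s := by
      simp only [Set.mem_Ioc, not_and, not_le] at hmem
      have := hmem hs'
      rw [div_lt_iff₀ hr] at this
      linarith
    have := hε' (r * s) h1
    nlinarith [mul_le_mul_of_nonneg_left this hDp]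

lemma TailDensity.uniform_asymptotics (hD : TailDensity α D) (hT : UniformTail μ A Y α c)
    (hμ : ∀ i ∈ A, IsProbabilityMeasure (μ i)) (hα : 0 < α) (hc : 0 ≤ c)
    (hY : Measurable Y) (hY0 : ∀ ω, 0 ≤ Y ω) {ε : ℝ} (hε : 0 < ε) :
    ∃ r₀ > 0, ∀ r ≥ r₀, ∀ i ∈ A, |r ^ α * ∫ ω, (∫ s in (0 : ℝ)..(Y ω / r), D s) ∂(μ i) -
        c * ∫ s in Set.Ioi (0 : ℝ), D s * s ^ (-α)| ≤ ε := by
  obtain ⟨M, hM0, hM⟩ := hT.exists_bound hμ hα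
  set J := ∫ s in Set.Ioi (0 : ℝ), D s * s ^ (-α) with hJ
  have hJ0 : 0 ≤ J := setIntegral_nonneg measurableSet_Ioi fun s hs =>
    mul_nonneg (hD.nonneg s hs) (Real.rpow_nonneg (le_of_lt hs) _)
  obtain ⟨y₀, hy₀, hT'⟩ := hT (ε / (2 * (J + 1))) (by positivity)
  have hlim : Tendsto (fun r : ℝ => (M + c) * ∫ s in Set.Ioc (0 : ℝ) (y₀ / r), D s * s ^ (-α))
      atTop (𝓝 ((M + c) * 0)) := by
    refine Tendsto.const_mul _ ?_
    have hvol : Tendsto (fun r : ℝ => (volume.restrict (Set.Ioi (0 : ℝ))) (Set.Ioc 0 (y₀ / r)))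
        atTop (𝓝 0) := by
      have h1 : Tendsto (fun r : ℝ => ENNReal.ofReal (y₀ / r)) atTop (𝓝 0) := by
        have := ENNReal.tendsto_ofReal (tendsto_const_nhds (x := y₀).div_atTop tendsto_id)
        simpa using this
      refine tendsto_of_tendsto_of_tendsto_of_le_of_le tendsto_const_nhds h1
        (fun _ => zero_le) fun r => ?_
      refine (Measure.restrict_apply_le _ _).trans ?_
      simp
    have := MeasureTheory.Integrable.tendsto_setIntegral_nhds_zero hD.integrable hvol
    refine this.congr fun r => ?_
    rw [Measure.restrict_restrict measurableSet_Ioc, Set.inter_eq_left.2 Set.Ioc_subset_Ioi_self]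
  rw [mul_zero] at hlim
  obtain ⟨r₁, hr₁⟩ := eventually_atTop.1 (hlim.eventually (gt_mem_nhds (half_pos hε)))
  refine ⟨max r₁ 1, by positivity, fun r hr i hi => ?_⟩
  have := hμ i hi
  have hr0 : 0 < r := lt_of_lt_of_le one_pos ((le_max_right _ _).trans hr)
  refine (hD.abs_integral_primitive_sub_le hY hY0 hr0 hc hM0.le (by positivity) (hM i hi)
    fun y hy => hT' y hy i hi).trans ?_
  have h2 := (hr₁ r ((le_max_left _ _).trans hr)).le
  have h3 : ε / (2 * (J + 1)) * J ≤ ε / 2 := by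
    rw [div_mul_eq_mul_div, div_le_div_iff₀ (by positivity) two_pos]
    nlinarith
  linarith

end UniformTails

/-! ### The radial and transverse densities, and the inward Taylor error. -/

section Densities

variable {α ν : ℝ}

lemma tailDensity_radial (hα : α ∈ Set.Ioo (1 : ℝ) 2) (hν : ν < 1) :
    TailDensity α fun s => 1 - (1 + s) ^ (ν - 1) where
  measurable := by fun_prop
  nonneg s hs := by
    have : (1 + s) ^ (ν - 1) ≤ 1 := Real.rpow_le_one_of_one_le_of_nonpos (by linarith) (by linarith)
    linarith
  intervalIntegrable t ht := by
    apply ContinuousOn.intervalIntegrable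
    intro w hw
    rw [Set.uIcc_of_le ht.le] at hw
    have h1 : (1 : ℝ) + w ≠ 0 := by linarith [hw.1]
    exact (continuousAt_const.sub ((continuousAt_const.add continuousAt_id).rpow_const
      (Or.inl h1))).continuousWithinAt
  integrable := integrable_radial hα hν

lemma tailDensity_transverse (hα : α ∈ Set.Ioo (1 : ℝ) 2) (hν : ν < 1) :
    TailDensity α fun s => s * (1 + s ^ 2) ^ (ν / 2 - 1) where
  measurable := by fun_prop
  nonneg s hs := by positivity
  intervalIntegrable t ht := by
    apply Continuous.intervalIntegrable
    refine continuous_id.mul (Continuous.rpow_const (by fun_prop) fun s => Or.inl ?_)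
    positivity
  integrable := integrable_transverse hα hν

lemma integral_radial_density (hν : ν ≠ 0) {t : ℝ} (ht : 0 ≤ t) :
    ν * ∫ s in (0 : ℝ)..t, (1 - (1 + s) ^ (ν - 1)) = ν * t - ((1 + t) ^ ν - 1) := by
  have hd : ∀ w ∈ Set.uIcc 0 t, HasDerivAt (fun w : ℝ => w - (1 + w) ^ ν / ν)
      (1 - (1 + w) ^ (ν - 1)) w := by
    intro w hw
    rw [Set.uIcc_of_le ht] at hw
    have h1 : HasDerivAt (fun w : ℝ => 1 + w) 1 w := (hasDerivAt_id w).const_add 1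
    have := (hasDerivAt_id w).sub
      ((h1.rpow_const (p := ν) (Or.inl (by linarith [hw.1]))).div_const ν)
    exact this.congr_deriv (by field_simp)
  rw [intervalIntegral.integral_eq_sub_of_hasDerivAt hd]
  · simp only [add_zero, Real.one_rpow]
    field_simp
    ring
  · apply ContinuousOn.intervalIntegrable
    intro w hw
    rw [Set.uIcc_of_le ht] at hw
    have h1 : (1 : ℝ) + w ≠ 0 := by linarith [hw.1]
    exact (continuousAt_const.sub ((continuousAt_const.add continuousAt_id).rpow_const
      (Or.inl h1))).continuousWithinAt

lemma integral_transverse_density (ν t : ℝ) :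
    ν * ∫ s in (0 : ℝ)..t, s * (1 + s ^ 2) ^ (ν / 2 - 1) = (1 + t ^ 2) ^ (ν / 2) - 1 := by
  have hd : ∀ w ∈ Set.uIcc 0 t, HasDerivAt (fun w : ℝ => (1 + w ^ 2) ^ (ν / 2))
      (ν * (w * (1 + w ^ 2) ^ (ν / 2 - 1))) w := by
    intro w hw
    have h1 : HasDerivAt (fun w : ℝ => 1 + w ^ 2) (2 * w) w := by
      simpa using (hasDerivAt_pow 2 w).const_add 1
    have := h1.rpow_const (p := ν / 2) (Or.inl (by positivity))
    exact this.congr_deriv (by ring)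
  rw [← intervalIntegral.integral_const_mul, intervalIntegral.integral_eq_sub_of_hasDerivAt hd]
  · simp
  · apply Continuous.intervalIntegrable
    refine continuous_const.mul (continuous_id.mul (Continuous.rpow_const (by fun_prop)
      fun s => Or.inl ?_))
    positivity

lemma exists_taylor_bound_rpow (ν : ℝ) :
    ∃ C : ℝ, 0 ≤ C ∧ ∀ s ∈ Set.Icc (0 : ℝ) (1 / 2), |(1 - s) ^ ν - 1 + ν * s| ≤ C * s ^ 2 := by
  have hf : ContDiffOn ℝ (1 + 1 : ℕ) (fun s : ℝ => (1 - s) ^ ν) (Set.Icc 0 (1 / 2)) := by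
    intro s hs
    have h1 : (1 : ℝ) - s ≠ 0 := by linarith [hs.2]
    exact ((contDiffAt_const.sub contDiffAt_id).rpow_const_of_ne h1).contDiffWithinAt
  obtain ⟨C, hC⟩ := exists_taylor_mean_remainder_bound (n := 1) (by norm_num) hf
  refine ⟨|C|, abs_nonneg C, fun s hs => ?_⟩
  have h := hC s hs
  have hder : derivWithin (fun s : ℝ => (1 - s) ^ ν) (Set.Icc 0 (1 / 2)) 0 = -ν := by
    have hd : HasDerivAt (fun s : ℝ => (1 - s) ^ ν) (-ν) 0 := by
      have h1 : HasDerivAt (fun s : ℝ => 1 - s) (-1) 0 := (hasDerivAt_id 0).const_sub 1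
      have := h1.rpow_const (p := ν) (Or.inl (by norm_num))
      exact this.congr_deriv (by simp)
    exact hd.hasDerivWithinAt.derivWithin
      (uniqueDiffOn_Icc (by norm_num) 0 ⟨le_rfl, by norm_num⟩)
  rw [taylorWithinEval_succ, taylor_within_zero_eval, iteratedDerivWithin_one, hder] at h
  simp only [Real.norm_eq_abs, sub_zero, Real.one_rpow, smul_eq_mul] at h
  have e : (1 - s) ^ ν - (1 + ((((0 : ℕ) : ℝ) + 1) * ((0 : ℕ).factorial : ℝ))⁻¹ * s ^ (0 + 1) * -ν) =
      (1 - s) ^ ν - 1 + ν * s := by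
    simp; ring
  rw [e] at h
  refine h.trans ?_
  norm_num
  exact mul_le_mul_of_nonneg_right (le_abs_self C) (by positivity)

/-- The error of the linear approximation to `t ↦ max |r - t| 1 ^ ν`. -/
def inwardError (ν r t : ℝ) : ℝ := max |r - t| 1 ^ ν - r ^ ν + ν * (r ^ ν * (t / r))

/-- For t ≤ r/2 this is a second-order Taylor estimate, weakened from exponent 2 to b. For t > r/2
each of the three terms is bounded separately by a multiple of (2t/r)^b. The prefactor cannot be r^ν
for negative ν, since an inward jump may land near the origin, where the function is of order 1. -/
lemma exists_inwardError_bound (hν : ν ≤ 1) {b : ℝ} (hb1 : 1 ≤ b) (hb2 : b ≤ 2) :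
    ∃ C : ℝ, 0 ≤ C ∧ ∀ r ≥ 2, ∀ t ≥ 0, |inwardError ν r t| ≤ C * (r ^ (max ν 0) * (t / r) ^ b) := by
  obtain ⟨C, hC0, hC⟩ := exists_taylor_bound_rpow ν
  refine ⟨C + (2 + |ν|) * 2 ^ b, by positivity, fun r hr t ht => ?_⟩
  have hr0 : (0 : ℝ) < r := by linarith
  have hs0 : 0 ≤ t / r := by positivity
  have hrm : r ^ ν ≤ r ^ (max ν 0) :=
    Real.rpow_le_rpow_of_exponent_le (by linarith) (le_max_left _ _)
  have hrn : 0 ≤ r ^ ν := by positivity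
  rcases le_or_gt (t / r) (1 / 2) with h | h
  · have ht2 : t ≤ r / 2 := by
      rw [div_le_div_iff₀ hr0 two_pos] at h; linarith
    have e1 : max |r - t| 1 = r * (1 - t / r) := by
      rw [abs_of_nonneg (by linarith), max_eq_left (by linarith)]
      field_simp
    have e2 : inwardError ν r t = r ^ ν * ((1 - t / r) ^ ν - 1 + ν * (t / r)) := by
      unfold inwardError
      rw [e1, Real.mul_rpow hr0.le (by linarith)]
      ring
    have h3 := hC (t / r) ⟨hs0, h⟩
    have h4 : (t / r) ^ 2 ≤ (t / r) ^ b := by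
      rcases hs0.eq_or_lt with h0 | h0
      · rw [← h0, Real.zero_rpow (by linarith)]; norm_num
      · rw [← Real.rpow_two]
        exact Real.rpow_le_rpow_of_exponent_ge h0 (by linarith) hb2
    rw [e2, abs_mul, abs_of_nonneg hrn]
    calc r ^ ν * |(1 - t / r) ^ ν - 1 + ν * (t / r)| ≤ r ^ (max ν 0) * (C * (t / r) ^ b) :=
          mul_le_mul hrm (h3.trans (mul_le_mul_of_nonneg_left h4 hC0)) (abs_nonneg _) (by positivity)
      _ = C * (r ^ (max ν 0) * (t / r) ^ b) := by ring
      _ ≤ _ := by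
        apply mul_le_mul_of_nonneg_right _ (by positivity)
        have : 0 ≤ (2 + |ν|) * 2 ^ b := by positivity
        linarith
  · have ht2 : r < 2 * t := by
      rw [lt_div_iff₀ hr0] at h; linarith
    have hs1 : 1 ≤ 2 * (t / r) := by linarith
    have hm0 : 0 ≤ max ν 0 := le_max_right _ _
    have hm1 : max ν 0 ≤ 1 := max_le hν zero_le_one
    have hsb : 2 * (t / r) ≤ (2 * (t / r)) ^ b := by
      conv_lhs => rw [← Real.rpow_one (2 * (t / r))]
      exact Real.rpow_le_rpow_of_exponent_le hs1 hb1
    have k1 : max |r - t| 1 ^ ν ≤ r ^ (max ν 0) * (2 * (t / r)) ^ b := by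
      have hle : max |r - t| 1 ≤ r * (2 * (t / r)) := by
        have : r * (2 * (t / r)) = 2 * t := by field_simp
        rw [this]
        refine max_le ?_ (by linarith)
        rw [abs_le]; constructor <;> linarith
      calc max |r - t| 1 ^ ν ≤ max |r - t| 1 ^ (max ν 0) :=
            Real.rpow_le_rpow_of_exponent_le (le_max_right _ _) (le_max_left _ _)
        _ ≤ (r * (2 * (t / r))) ^ (max ν 0) := Real.rpow_le_rpow (by positivity) hle hm0
        _ = r ^ (max ν 0) * (2 * (t / r)) ^ (max ν 0) := Real.mul_rpow hr0.le (by positivity)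
        _ ≤ r ^ (max ν 0) * (2 * (t / r)) ^ b := by
            apply mul_le_mul_of_nonneg_left _ (by positivity)
            exact Real.rpow_le_rpow_of_exponent_le hs1 (hm1.trans hb1)
    have k2 : r ^ ν ≤ r ^ (max ν 0) * (2 * (t / r)) ^ b := by
      calc r ^ ν ≤ r ^ (max ν 0) * 1 := by rw [mul_one]; exact hrm
        _ ≤ _ := mul_le_mul_of_nonneg_left (hs1.trans hsb) (by positivity)
    have k3 : |ν * (r ^ ν * (t / r))| ≤ |ν| * (r ^ (max ν 0) * (2 * (t / r)) ^ b) := by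
      rw [abs_mul, abs_of_nonneg (by positivity : 0 ≤ r ^ ν * (t / r))]
      apply mul_le_mul_of_nonneg_left _ (abs_nonneg ν)
      exact mul_le_mul hrm (by linarith) hs0 (by positivity)
    have k0 : 0 ≤ max |r - t| 1 ^ ν := by positivity
    have k4 : |inwardError ν r t| ≤ (2 + |ν|) * (r ^ (max ν 0) * (2 * (t / r)) ^ b) := by
      unfold inwardError
      rw [abs_le] at k3 ⊢
      constructor <;> linarith [k3.1, k3.2]
    refine k4.trans ?_
    rw [Real.mul_rpow (by norm_num) hs0]
    have : 0 ≤ C * (r ^ (max ν 0) * (t / r) ^ b) := by positivity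
    linarith

end Densities

/-! ### Exact one-step formulas for the Lyapunov function. -/

section OneStep

variable {Ω : Type*} [MeasurableSpace Ω] {m : Measure Ω} [IsProbabilityMeasure m] {α ν : ℝ}

/-- The linear term is kept whole, so that it integrates to zero; the outward nonlinear part is a
primitive to which the tail asymptotics apply, and the inward part is pure error. -/
lemma radial_decomposition (hν : ν ≠ 0) {r : ℝ} (hr : 2 ≤ r) (X : ℝ) :
    max |r + X| 1 ^ ν = r ^ ν + ν * r ^ ν / r * X -
      ν * r ^ ν * (∫ s in (0 : ℝ)..(max X 0 / r), (1 - (1 + s) ^ (ν - 1))) +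
      inwardError ν r (max (-X) 0) := by
  have hr0 : 0 < r := by linarith
  rw [show ν * r ^ ν * (∫ s in (0 : ℝ)..(max X 0 / r), (1 - (1 + s) ^ (ν - 1))) = r ^ ν *
    (ν * ∫ s in (0 : ℝ)..(max X 0 / r), (1 - (1 + s) ^ (ν - 1))) by ring,
    integral_radial_density hν (by positivity)]
  unfold inwardError
  rcases le_total 0 X with h | h
  · rw [max_eq_left h, max_eq_right (by linarith : -X ≤ 0), sub_zero, abs_of_nonneg hr0.le,
      max_eq_left (by linarith : (1 : ℝ) ≤ r), abs_of_nonneg (by linarith), max_eq_left (by linarith),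
      show r + X = r * (1 + X / r) by field_simp, Real.mul_rpow hr0.le (by positivity)]
    ring
  · rw [max_eq_right h, max_eq_left (by linarith : 0 ≤ -X), sub_neg_eq_add]
    simp
    ring

lemma radial_integral (hν : ν ≠ 0) (hν1 : ν < 1) (hα : α ∈ Set.Ioo (1 : ℝ) 2) {X : Ω → ℝ}
    (hX : Measurable X) (hXi : Integrable X m) (hX0 : ∫ ω, X ω ∂m = 0) {b B C M r : ℝ}
    (hC0 : 0 ≤ C)
    (hC : ∀ r ≥ 2, ∀ t ≥ 0, |inwardError ν r t| ≤ C * (r ^ (max ν 0) * (t / r) ^ b))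
    (hB : Integrable (fun ω => max (-X ω) 0 ^ b) m) (hB' : ∫ ω, max (-X ω) 0 ^ b ∂m ≤ B)
    (hM : ∀ y > 0, y ^ α * m.real {ω | y < max (X ω) 0} ≤ M) (hr : 2 ≤ r) :
    Integrable (fun ω => max |r + X ω| 1 ^ ν) m ∧
    |∫ ω, max |r + X ω| 1 ^ ν ∂m - r ^ ν + ν * r ^ ν *
      ∫ ω, (∫ s in (0 : ℝ)..(max (X ω) 0 / r), (1 - (1 + s) ^ (ν - 1))) ∂m| ≤
      C * B * r ^ (max ν 0 - b) := by
  have hr0 : 0 < r := by linarith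
  have hD := tailDensity_radial hα hν1
  have hI1 := hD.integrable_primitive (ν := m) (Y := fun ω => max (X ω) 0) (hX.max measurable_const)
    (fun ω => le_max_right _ _) hr0 hM
  have hbd : ∀ ω, |inwardError ν r (max (-X ω) 0)| ≤
      C * r ^ (max ν 0 - b) * max (-X ω) 0 ^ b := by
    intro ω
    refine (hC r hr _ (le_max_right _ _)).trans (le_of_eq ?_)
    rw [Real.div_rpow (le_max_right _ _) hr0.le, Real.rpow_sub hr0]
    ring
  have hmeas : Measurable fun ω => inwardError ν r (max (-X ω) 0) := by
    unfold inwardError; fun_prop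
  have hI2 : Integrable (fun ω => inwardError ν r (max (-X ω) 0)) m :=
    Integrable.mono' (hB.const_mul (C * r ^ (max ν 0 - b))) hmeas.aestronglyMeasurable
      (ae_of_all _ hbd)
  have hfun : (fun ω => max |r + X ω| 1 ^ ν) = fun ω => r ^ ν + ν * r ^ ν / r * X ω -
      ν * r ^ ν * (∫ s in (0 : ℝ)..(max (X ω) 0 / r), (1 - (1 + s) ^ (ν - 1))) +
      inwardError ν r (max (-X ω) 0) := funext fun ω => radial_decomposition hν hr (X ω)
  have hJ1 : Integrable (fun ω => r ^ ν + ν * r ^ ν / r * X ω) m :=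
    (integrable_const _).add (hXi.const_mul _)
  have hJ2 : Integrable (fun ω => r ^ ν + ν * r ^ ν / r * X ω -
      ν * r ^ ν * (∫ s in (0 : ℝ)..(max (X ω) 0 / r), (1 - (1 + s) ^ (ν - 1)))) m :=
    hJ1.sub (hI1.const_mul (ν * r ^ ν))
  refine ⟨hfun ▸ hJ2.add hI2, ?_⟩
  have hint : ∫ ω, max |r + X ω| 1 ^ ν ∂m = r ^ ν - ν * r ^ ν *
      ∫ ω, (∫ s in (0 : ℝ)..(max (X ω) 0 / r), (1 - (1 + s) ^ (ν - 1))) ∂m +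
      ∫ ω, inwardError ν r (max (-X ω) 0) ∂m := by
    rw [hfun, integral_add hJ2 hI2, integral_sub hJ1 (hI1.const_mul _),
      integral_add (integrable_const _) (hXi.const_mul _), integral_const_mul, integral_const_mul,
      hX0]
    simp
  rw [hint, show ∀ a c d : ℝ, a - c + d - a + c = d from fun a c d => by ring]
  rw [← Real.norm_eq_abs]
  refine (norm_integral_le_of_norm_le (hB.const_mul (C * r ^ (max ν 0 - b)))
    (ae_of_all _ hbd)).trans ?_
  rw [integral_const_mul]
  calc C * r ^ (max ν 0 - b) * ∫ ω, max (-X ω) 0 ^ b ∂m ≤ C * r ^ (max ν 0 - b) * B :=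
        mul_le_mul_of_nonneg_left hB' (by positivity)
    _ = _ := by ring

lemma transverse_decomposition {r : ℝ} (hr : 2 ≤ r) (T : ℝ) :
    max (√(r ^ 2 + T ^ 2)) 1 ^ ν = r ^ ν +
      ν * r ^ ν * ∫ s in (0 : ℝ)..(|T| / r), s * (1 + s ^ 2) ^ (ν / 2 - 1) := by
  have hr0 : 0 < r := by linarith
  rw [show ν * r ^ ν * (∫ s in (0 : ℝ)..(|T| / r), s * (1 + s ^ 2) ^ (ν / 2 - 1)) = r ^ ν *
    (ν * ∫ s in (0 : ℝ)..(|T| / r), s * (1 + s ^ 2) ^ (ν / 2 - 1)) by ring,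
    integral_transverse_density]
  have h1 : (1 : ℝ) ≤ √(r ^ 2 + T ^ 2) := Real.one_le_sqrt.2 (by nlinarith [sq_nonneg T])
  have h2 : r ^ 2 + T ^ 2 = r ^ 2 * (1 + (|T| / r) ^ 2) := by
    rw [div_pow, sq_abs]; field_simp
  rw [max_eq_left h1, Real.sqrt_eq_rpow, ← Real.rpow_mul (by positivity), h2,
    Real.mul_rpow (by positivity) (by positivity), ← Real.rpow_natCast r 2,
    ← Real.rpow_mul hr0.le]
  rw [show ((2 : ℕ) : ℝ) * (1 / 2 * ν) = ν by push_cast; ring, show 1 / 2 * ν = ν / 2 by ring]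
  ring

lemma transverse_integral (hν1 : ν < 1) (hα : α ∈ Set.Ioo (1 : ℝ) 2) {T : Ω → ℝ}
    (hT : Measurable T) {M r : ℝ}
    (hM : ∀ y > 0, y ^ α * m.real {ω | y < |T ω|} ≤ M) (hr : 2 ≤ r) :
    Integrable (fun ω => max (√(r ^ 2 + T ω ^ 2)) 1 ^ ν) m ∧
    ∫ ω, max (√(r ^ 2 + T ω ^ 2)) 1 ^ ν ∂m = r ^ ν + ν * r ^ ν *
      ∫ ω, (∫ s in (0 : ℝ)..(|T ω| / r), s * (1 + s ^ 2) ^ (ν / 2 - 1)) ∂m := by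
  have hr0 : 0 < r := by linarith
  have hD := tailDensity_transverse hα hν1
  have hI1 := hD.integrable_primitive (ν := m) (Y := fun ω => |T ω|) (by fun_prop)
    (fun ω => abs_nonneg _) hr0 hM
  simp only [transverse_decomposition hr]
  refine ⟨(integrable_const _).add (hI1.const_mul _), ?_⟩
  rw [integral_add (integrable_const _) (hI1.const_mul _), integral_const_mul]
  simp

end OneStep

/-! ### Norms after radial and transverse displacements. -/

section Geometry

lemma norm_add_radial {x : Plane} (hx : x ≠ 0) (t : ℝ) : ‖x + t • radialUnit x‖ = |‖x‖ + t| := by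
  have hn : 0 < ‖x‖ := norm_pos_iff.2 hx
  have : x + t • radialUnit x = (1 + t * ‖x‖⁻¹) • x := by
    rw [radialUnit, smul_smul, add_smul, one_smul]
  rw [this, norm_smul, Real.norm_eq_abs]
  conv_lhs => rw [← abs_of_pos hn, ← abs_mul, abs_of_pos hn]
  congr 1
  field_simp

lemma norm_add_transverse {x : Plane} (hx : x ≠ 0) (t : ℝ) :
    ‖x + t • transverseUnit x‖ = √(‖x‖ ^ 2 + t ^ 2) := by
  have hn : 0 < ‖x‖ := norm_pos_iff.2 hx
  have h2 : ‖x‖ ^ 2 = x 0 ^ 2 + x 1 ^ 2 := by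
    rw [EuclideanSpace.norm_sq_eq, Fin.sum_univ_two, Real.norm_eq_abs, Real.norm_eq_abs, sq_abs,
      sq_abs]
  rw [EuclideanSpace.norm_eq, Fin.sum_univ_two]
  congr 1
  simp only [transverseUnit, radialUnit, PiLp.add_apply, PiLp.smul_apply, smul_eq_mul,
    Real.norm_eq_abs, sq_abs]
  simp only [Fin.isValue, Matrix.cons_val_zero, Matrix.cons_val_one]
  have h3 : ‖x‖⁻¹ ^ 2 * (x 0 ^ 2 + x 1 ^ 2) = 1 := by
    rw [← h2]; field_simp
  rw [h2]
  linear_combination t ^ 2 * h3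

end Geometry

/-! ### Tails, moments and the one-step law of the norm. -/

section Chain

variable {Ω : Type*} [MeasurableSpace Ω] {𝕏 : Set Plane} {P : Kernel 𝕏 𝕏}
  {Pr : 𝕏 → Measure Ω} {χ θR θT : Ω → ℝ} {α β pR pT cR cT : ℝ}

namespace IsRadialTransverseChain

variable (h : IsRadialTransverseChain 𝕏 P Pr χ θR θT α β pR pT cR cT)

include h

lemma prob (x : 𝕏) (hx : x ∈ {x : 𝕏 | (x : Plane) ≠ 0}) : IsProbabilityMeasure (Pr x) :=
  h.isProbabilityMeasure x hx

lemma pR_pos : 0 < pR := h.pR_mem.1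

lemma pT_pos : 0 < pT := by rw [h.pT_eq]; linarith [h.pR_mem.2]

lemma uniformTail_radial :
    UniformTail Pr {x : 𝕏 | (x : Plane) ≠ 0} (fun ω => max (θR ω) 0) α cR := by
  intro ε hε
  have := Metric.tendstoUniformlyOn_iff.1 h.radial_tail_out ε hε
  obtain ⟨y₀, hy₀⟩ := eventually_atTop.1 this
  refine ⟨max y₀ 1, by positivity, fun y hy x hx => ?_⟩
  have := hy₀ y ((le_max_left _ _).trans hy) x hx
  rw [dist_comm, Real.dist_eq] at this
  exact this.le

lemma tail_abs_transverse {x : 𝕏} (hx : (x : Plane) ≠ 0) {y : ℝ} (hy : 0 ≤ y) :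
    (Pr x).real {ω | y < |θT ω|} = 2 * (Pr x).real {ω | y < max (θT ω) 0} := by
  have := h.isProbabilityMeasure x hx
  have hm : MeasurableSet {ω | y < max (-(θT ω)) 0} :=
    measurableSet_lt measurable_const (h.measurable_θT.neg.max measurable_const)
  have hu : {ω | y < |θT ω|} = {ω | y < max (θT ω) 0} ∪ {ω | y < max (-(θT ω)) 0} := by
    ext ω
    simp only [Set.mem_ofPred_eq, Set.mem_union, lt_max_iff, lt_abs]
    constructor
    · rintro (h | h)
      · exact Or.inl (Or.inl h)
      · exact Or.inr (Or.inl h)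
    · rintro ((h | h) | (h | h))
      · exact Or.inl h
      · linarith
      · exact Or.inr h
      · linarith
  have hd : Disjoint {ω | y < max (θT ω) 0} {ω | y < max (-(θT ω)) 0} := by
    rw [Set.disjoint_left]
    intro ω h1 h2
    simp only [Set.mem_ofPred_eq, lt_max_iff] at h1 h2
    rcases h1 with h1 | h1 <;> rcases h2 with h2 | h2 <;> linarith
  rw [hu, measureReal_union hd hm, h.transverse_symm x hx y hy]
  ring

lemma uniformTail_transverse :
    UniformTail Pr {x : 𝕏 | (x : Plane) ≠ 0} (fun ω => |θT ω|) α (2 * cT) := by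
  intro ε hε
  have := Metric.tendstoUniformlyOn_iff.1 h.transverse_tail (ε / 2) (half_pos hε)
  obtain ⟨y₀, hy₀⟩ := eventually_atTop.1 this
  refine ⟨max y₀ 1, by positivity, fun y hy x hx => ?_⟩
  have h1 := hy₀ y ((le_max_left _ _).trans hy) x hx
  have hy0 : 0 ≤ y := zero_le_one.trans ((le_max_right _ _).trans hy)
  rw [dist_comm, Real.dist_eq] at h1
  rw [h.tail_abs_transverse hx hy0, show y ^ α * (2 * (Pr x).real {ω | y < max (θT ω) 0}) - 2 * cT =
    2 * (y ^ α * (Pr x).real {ω | y < max (θT ω) 0} - cT) by ring, abs_mul, abs_two]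
  linarith

/-- From t^b ≤ 1 + t^β for t ≥ 0. Lower exponents are needed because the Taylor estimate cannot use
more than b = 2. -/
lemma exists_moment_bound {b : ℝ} (hb0 : 0 < b) (hb : b ≤ β) :
    ∃ B : ℝ, 0 ≤ B ∧ ∀ x : 𝕏, (x : Plane) ≠ 0 →
      Integrable (fun ω => max (-(θR ω)) 0 ^ b) (Pr x) ∧
        ∫ ω, max (-(θR ω)) 0 ^ b ∂(Pr x) ≤ B := by
  set S := ⨆ (x : 𝕏) (_ : (x : Plane) ≠ 0),
      ∫⁻ ω, ENNReal.ofReal (max (-(θR ω)) 0 ^ β) ∂(Pr x) with hS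
  have hSfin : 1 + S ≠ ∞ := ENNReal.add_ne_top.2 ⟨ENNReal.one_ne_top, h.radial_moment_in.ne⟩
  refine ⟨(1 + S).toReal, ENNReal.toReal_nonneg, fun x hx => ?_⟩
  have := h.isProbabilityMeasure x hx
  have hm : Measurable fun ω => max (-(θR ω)) 0 ^ b :=
    (h.measurable_θR.neg.max measurable_const).pow_const b
  have hle : ∫⁻ ω, ENNReal.ofReal (max (-(θR ω)) 0 ^ b) ∂(Pr x) ≤ 1 + S := by
    calc ∫⁻ ω, ENNReal.ofReal (max (-(θR ω)) 0 ^ b) ∂(Pr x)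
        ≤ ∫⁻ ω, 1 + ENNReal.ofReal (max (-(θR ω)) 0 ^ β) ∂(Pr x) := by
          refine lintegral_mono fun ω => ?_
          simp only
          rw [← ENNReal.ofReal_one, ← ENNReal.ofReal_add zero_le_one (by positivity)]
          apply ENNReal.ofReal_le_ofReal
          have h0 : 0 ≤ max (-(θR ω)) 0 := le_max_right _ _
          rcases le_total (max (-(θR ω)) 0) 1 with h1 | h1
          · have := Real.rpow_le_one h0 h1 hb0.le
            have : 0 ≤ max (-(θR ω)) 0 ^ β := by positivity
            linarith
          · have := Real.rpow_le_rpow_of_exponent_le h1 hb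
            linarith
      _ = 1 + ∫⁻ ω, ENNReal.ofReal (max (-(θR ω)) 0 ^ β) ∂(Pr x) := by
          rw [lintegral_add_left measurable_const]; simp
      _ ≤ 1 + S := by
          gcongr
          exact le_iSup₂ (f := fun (x : 𝕏) (_ : (x : Plane) ≠ 0) =>
            ∫⁻ ω, ENNReal.ofReal (max (-(θR ω)) 0 ^ β) ∂(Pr x)) x hx
  have hnn : 0 ≤ᵐ[Pr x] fun ω => max (-(θR ω)) 0 ^ b :=
    ae_of_all _ fun ω => Real.rpow_nonneg (le_max_right _ _) _
  refine ⟨(lintegral_ofReal_ne_top_iff_integrable hm.aestronglyMeasurable hnn).1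
    (ne_top_of_le_ne_top hSfin hle), ?_⟩
  rw [integral_eq_lintegral_of_nonneg_ae hnn hm.aestronglyMeasurable]
  exact ENNReal.toReal_mono hSfin hle

/-- Splitting according to the value of χ: in each summand only one of `θR`, `θT` occurs, so its
independence from χ is enough and no joint independence is required. -/
lemma lintegral_norm {x : 𝕏} (hx : (x : Plane) ≠ 0) {G : ℝ → ℝ≥0∞} (hG : Measurable G) :
    ∫⁻ y, G ‖(y : Plane)‖ ∂(P x) =
      ENNReal.ofReal pR * ∫⁻ ω, G |‖(x : Plane)‖ + θR ω| ∂(Pr x) +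
      ENNReal.ofReal pT * ∫⁻ ω, G (√(‖(x : Plane)‖ ^ 2 + θT ω ^ 2)) ∂(Pr x) := by
  have := h.isProbabilityMeasure x hx
  have hχ := h.measurable_χ
  have hR := h.measurable_θR
  have hT := h.measurable_θT
  have hS1 : MeasurableSet ({1} : Set ℝ) := measurableSet_singleton 1
  have hS0 : MeasurableSet ({0} : Set ℝ) := measurableSet_singleton 0
  have e1 : ∫⁻ y, G ‖(y : Plane)‖ ∂(P x) =
      ∫⁻ ω, G ‖(x : Plane) + ((χ ω * θR ω) • radialUnit x + ((1 - χ ω) * θT ω) • transverseUnit x)‖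
        ∂(Pr x) := by
    have a1 : ∫⁻ y, G ‖(y : Plane)‖ ∂(P x) =
        ∫⁻ z, G ‖(x : Plane) + z‖ ∂((P x).map (fun y : 𝕏 => (y : Plane) - (x : Plane))) := by
      rw [lintegral_map (by fun_prop) (by fun_prop)]
      simp
    rw [a1, h.jump_law x hx, lintegral_map (by fun_prop) (by fun_prop)]
  have e2 : ∫⁻ ω, G ‖(x : Plane) + ((χ ω * θR ω) • radialUnit x +
      ((1 - χ ω) * θT ω) • transverseUnit x)‖ ∂(Pr x) =
      ∫⁻ ω, ({1} : Set ℝ).indicator 1 (χ ω) * G |‖(x : Plane)‖ + θR ω| +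
        ({0} : Set ℝ).indicator 1 (χ ω) * G (√(‖(x : Plane)‖ ^ 2 + θT ω ^ 2)) ∂(Pr x) := by
    refine lintegral_congr_ae ?_
    filter_upwards [h.χ_zero_or_one x hx] with ω hω
    rcases hω with h0 | h1
    · rw [h0]
      simp [norm_add_transverse hx]
    · rw [h1]
      simp [norm_add_radial hx]
  have hind : ∀ s : ℝ, ∫⁻ ω, ({s} : Set ℝ).indicator 1 (χ ω) ∂(Pr x) =
      ENNReal.ofReal ((Pr x).real {ω | χ ω = s}) := by
    intro s
    rw [ofReal_measureReal]
    exact lintegral_indicator_one (hχ (measurableSet_singleton s))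
  rw [e1, e2, lintegral_add_left (by fun_prop (disch := assumption)),
    ← h.prob_radial x hx, ← h.prob_transverse x hx, ← hind, ← hind]
  congr 1
  · exact lintegral_mul_eq_lintegral_mul_lintegral_of_indepFun''
      (f := fun ω => ({1} : Set ℝ).indicator 1 (χ ω)) (g := fun ω => G |‖(x : Plane)‖ + θR ω|)
      ((measurable_one.indicator hS1).comp hχ).aemeasurable (by fun_prop)
      ((h.indep_θR x hx).comp (φ := ({1} : Set ℝ).indicator (1 : ℝ → ℝ≥0∞))
        (ψ := fun t => G |‖(x : Plane)‖ + t|) (measurable_one.indicator hS1) (by fun_prop))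
  · exact lintegral_mul_eq_lintegral_mul_lintegral_of_indepFun''
      (f := fun ω => ({0} : Set ℝ).indicator 1 (χ ω))
      (g := fun ω => G (√(‖(x : Plane)‖ ^ 2 + θT ω ^ 2)))
      ((measurable_one.indicator hS0).comp hχ).aemeasurable (by fun_prop)
      ((h.indep_θT x hx).comp (φ := ({0} : Set ℝ).indicator (1 : ℝ → ℝ≥0∞))
        (ψ := fun t => G (√(‖(x : Plane)‖ ^ 2 + t ^ 2))) (measurable_one.indicator hS0)
        (by fun_prop))

lemma integral_norm {x : 𝕏} (hx : (x : Plane) ≠ 0) {G : ℝ → ℝ} (hG : Measurable G)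
    (hG0 : ∀ t, 0 ≤ G t) (h1 : Integrable (fun ω => G |‖(x : Plane)‖ + θR ω|) (Pr x))
    (h2 : Integrable (fun ω => G (√(‖(x : Plane)‖ ^ 2 + θT ω ^ 2))) (Pr x)) :
    Integrable (fun y : 𝕏 => G ‖(y : Plane)‖) (P x) ∧ ∫ y, G ‖(y : Plane)‖ ∂(P x) =
      pR * ∫ ω, G |‖(x : Plane)‖ + θR ω| ∂(Pr x) +
      pT * ∫ ω, G (√(‖(x : Plane)‖ ^ 2 + θT ω ^ 2)) ∂(Pr x) := by
  have hm : AEStronglyMeasurable (fun y : 𝕏 => G ‖(y : Plane)‖) (P x) :=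
    (hG.comp (by fun_prop)).aestronglyMeasurable
  have key := h.lintegral_norm hx (G := fun t => ENNReal.ofReal (G t)) (by fun_prop)
  rw [← ofReal_integral_eq_lintegral_ofReal h1 (ae_of_all _ fun _ => hG0 _),
    ← ofReal_integral_eq_lintegral_ofReal h2 (ae_of_all _ fun _ => hG0 _),
    ← ENNReal.ofReal_mul h.pR_pos.le, ← ENNReal.ofReal_mul h.pT_pos.le,
    ← ENNReal.ofReal_add (mul_nonneg h.pR_pos.le (integral_nonneg fun _ => hG0 _))
      (mul_nonneg h.pT_pos.le (integral_nonneg fun _ => hG0 _))] at key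
  constructor
  · exact (lintegral_ofReal_ne_top_iff_integrable hm (ae_of_all _ fun _ => hG0 _)).1
      (key ▸ ENNReal.ofReal_ne_top)
  · rw [integral_eq_lintegral_of_nonneg_ae (ae_of_all _ fun _ => hG0 _) hm, key,
      ENNReal.toReal_ofReal (add_nonneg (mul_nonneg h.pR_pos.le (integral_nonneg fun _ => hG0 _))
      (mul_nonneg h.pT_pos.le (integral_nonneg fun _ => hG0 _)))]

end IsRadialTransverseChain

end Chain

/-! ### The drift of the Lyapunov function. -/

section Drift

/-- The Lyapunov function `max ‖x‖ 1 ^ ν`. -/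
def lyapunov {𝕏 : Set Plane} (ν : ℝ) (x : 𝕏) : ℝ := max ‖(x : Plane)‖ 1 ^ ν

lemma lyapunov_pos {𝕏 : Set Plane} (ν : ℝ) (x : 𝕏) : 0 < lyapunov ν x := by
  unfold lyapunov; positivity

lemma lyapunov_of_one_le {𝕏 : Set Plane} (ν : ℝ) {x : 𝕏} (hx : 1 ≤ ‖(x : Plane)‖) :
    lyapunov ν x = ‖(x : Plane)‖ ^ ν := by
  unfold lyapunov; rw [max_eq_left hx]

variable {Ω : Type*} [MeasurableSpace Ω] {𝕏 : Set Plane} {P : Kernel 𝕏 𝕏}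
  {Pr : 𝕏 → Measure Ω} {χ θR θT : Ω → ℝ} {α β pR pT cR cT : ℝ}

namespace IsRadialTransverseChain

variable (h : IsRadialTransverseChain 𝕏 P Pr χ θR θT α β pR pT cR cT)

include h

/-- The mean increment of `lyapunov ν` from `x`, up to the error caused by inward jumps. -/
lemma drift_decomposition {ν : ℝ} (hν : ν ≠ 0) (hν1 : ν < 1) {b : ℝ} (hb1 : 1 ≤ b)
    (hb2 : b ≤ 2) (hbβ : b ≤ β) :
    ∃ K : ℝ, 0 ≤ K ∧ ∀ x : 𝕏, 2 ≤ ‖(x : Plane)‖ → Integrable (lyapunov ν) (P x) ∧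
      |∫ y, lyapunov ν y ∂(P x) - ‖(x : Plane)‖ ^ ν - ν * ‖(x : Plane)‖ ^ ν *
        (pT * ∫ ω, (∫ s in (0 : ℝ)..(|θT ω| / ‖(x : Plane)‖),
            s * (1 + s ^ 2) ^ (ν / 2 - 1)) ∂(Pr x) -
          pR * ∫ ω, (∫ s in (0 : ℝ)..(max (θR ω) 0 / ‖(x : Plane)‖),
            (1 - (1 + s) ^ (ν - 1))) ∂(Pr x))| ≤
      K * ‖(x : Plane)‖ ^ (max ν 0 - b) := by
  have hα0 : 0 < α := by linarith [h.α_mem.1]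
  obtain ⟨C, hC0, hC⟩ := exists_inwardError_bound hν1.le hb1 hb2
  obtain ⟨B, hB0, hB⟩ := h.exists_moment_bound (by linarith) hbβ
  obtain ⟨M, hM0, hM⟩ := h.uniformTail_radial.exists_bound h.prob hα0
  obtain ⟨M', hM0', hM'⟩ := h.uniformTail_transverse.exists_bound h.prob hα0
  refine ⟨pR * (C * B), mul_nonneg h.pR_pos.le (mul_nonneg hC0 hB0), fun x hx => ?_⟩
  have hx0 : (x : Plane) ≠ 0 := norm_pos_iff.1 (by linarith)
  have := h.isProbabilityMeasure x hx0
  obtain ⟨i1, e1⟩ := radial_integral hν hν1 h.α_mem h.measurable_θR (h.mean_θR x hx0).1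
    (h.mean_θR x hx0).2 hC0 hC (hB x hx0).1 (hB x hx0).2 (hM x hx0) hx
  obtain ⟨i2, e2⟩ := transverse_integral hν1 h.α_mem h.measurable_θT (hM' x hx0) hx
  obtain ⟨i3, e3⟩ := h.integral_norm hx0 (G := fun t => max t 1 ^ ν) (by fun_prop)
    (fun t => by positivity) i1 i2
  refine ⟨i3, ?_⟩
  have e4 : ∫ y, lyapunov ν y ∂(P x) = _ := e3
  rw [e4, e2]
  have hpT : pT = 1 - pR := h.pT_eq
  have hr : ∀ a r c d u v : ℝ, pR * a + pT * (r + ν * r * u) - r - ν * r * (pT * u - pR * v) =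
      pR * (a - r + ν * r * v) := by
    intro a r c d u v
    rw [hpT]; ring
  rw [hr _ _ 0 0, abs_mul, abs_of_pos h.pR_pos, mul_assoc pR]
  exact mul_le_mul_of_nonneg_left e1 h.pR_pos.le

/-- Identifies the drift coefficient: the factor 2 from the two-sided transverse tail cancels the
1/2 of the substitution u = s². -/
lemma two_criticalFun_eq {ν : ℝ} (hν1 : ν < 1) :
    criticalFun α pR pT cR cT ν =
      pT * (2 * cT * ∫ s in Set.Ioi (0 : ℝ), s * (1 + s ^ 2) ^ (ν / 2 - 1) * s ^ (-α)) -
      pR * (cR * ∫ s in Set.Ioi (0 : ℝ), (1 - (1 + s) ^ (ν - 1)) * s ^ (-α)) := by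
  rw [integral_transverse h.α_mem hν1, integral_radial h.α_mem hν1]
  have := Real.Gamma_pos_of_pos (s := 1 - ν / 2) (by linarith)
  unfold criticalFun
  field_simp
  ring

/-- A crude two-sided estimate from the tail bounds alone. Unlike the asymptotics it holds from
radius 2 on, so it covers the region where the sign of the drift is not yet known. The condition on
ν makes the inward error of smaller order than r^(ν-α). -/
lemma exists_drift_bound {ν : ℝ} (hν : ν ≠ 0) (hν1 : ν < 1)
    (hνα : max ν 0 - min β 2 < ν - α) :
    ∃ C : ℝ, 0 ≤ C ∧ ∀ x : 𝕏, 2 ≤ ‖(x : Plane)‖ → Integrable (lyapunov ν) (P x) ∧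
      |∫ y, lyapunov ν y ∂(P x) - ‖(x : Plane)‖ ^ ν| ≤ C * ‖(x : Plane)‖ ^ (ν - α) := by
  have hα0 : 0 < α := by linarith [h.α_mem.1]
  have hb1 : 1 ≤ min β 2 := le_min (by linarith [h.α_mem.1, h.β_gt]) one_le_two
  obtain ⟨K, hK0, hK⟩ := h.drift_decomposition hν hν1 hb1 (min_le_right _ _) (min_le_left _ _)
  obtain ⟨M, hM0, hM⟩ := h.uniformTail_radial.exists_bound h.prob hα0
  obtain ⟨M', hM0', hM'⟩ := h.uniformTail_transverse.exists_bound h.prob hα0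
  have hD1 := tailDensity_radial h.α_mem hν1
  have hD2 := tailDensity_transverse h.α_mem hν1
  set J1 := ∫ s in Set.Ioi (0 : ℝ), (1 - (1 + s) ^ (ν - 1)) * s ^ (-α) with hJ1
  set J2 := ∫ s in Set.Ioi (0 : ℝ), s * (1 + s ^ 2) ^ (ν / 2 - 1) * s ^ (-α) with hJ2
  have hJ1n : 0 ≤ J1 := setIntegral_nonneg measurableSet_Ioi fun s hs =>
    mul_nonneg (hD1.nonneg s hs) (Real.rpow_nonneg (le_of_lt hs) _)
  have hJ2n : 0 ≤ J2 := setIntegral_nonneg measurableSet_Ioi fun s hs =>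
    mul_nonneg (hD2.nonneg s hs) (Real.rpow_nonneg (le_of_lt hs) _)
  have hpT := h.pT_pos
  have hpR := h.pR_pos
  refine ⟨|ν| * (pT * (M' * J2) + pR * (M * J1)) + K, by positivity, fun x hx => ?_⟩
  have hr0 : 0 < ‖(x : Plane)‖ := by linarith
  have hx0 : (x : Plane) ≠ 0 := norm_pos_iff.1 hr0
  have := h.isProbabilityMeasure x hx0
  obtain ⟨i1, e1⟩ := hK x hx
  refine ⟨i1, ?_⟩
  have u1 := hD1.integral_primitive_le (Y := fun ω => max (θR ω) 0)
    (h.measurable_θR.max measurable_const) (fun ω => le_max_right _ _) hr0 (hM x hx0)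
  have u2 := hD2.integral_primitive_le (Y := fun ω => |θT ω|)
    (by have := h.measurable_θT; fun_prop) (fun ω => abs_nonneg _) hr0 (hM' x hx0)
  have v1 : 0 ≤ ∫ ω, (∫ s in (0 : ℝ)..(max (θR ω) 0 / ‖(x : Plane)‖),
      (1 - (1 + s) ^ (ν - 1))) ∂(Pr x) :=
    integral_nonneg fun ω => hD1.primitive_nonneg (div_nonneg (le_max_right _ _) hr0.le)
  have v2 : 0 ≤ ∫ ω, (∫ s in (0 : ℝ)..(|θT ω| / ‖(x : Plane)‖),
      s * (1 + s ^ 2) ^ (ν / 2 - 1)) ∂(Pr x) :=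
    integral_nonneg fun ω => hD2.primitive_nonneg (div_nonneg (abs_nonneg _) hr0.le)
  rw [← hJ1] at u1
  rw [← hJ2] at u2
  generalize (∫ ω, (∫ s in (0 : ℝ)..(max (θR ω) 0 / ‖(x : Plane)‖),
      (1 - (1 + s) ^ (ν - 1))) ∂(Pr x)) = I1 at *
  generalize (∫ ω, (∫ s in (0 : ℝ)..(|θT ω| / ‖(x : Plane)‖),
      s * (1 + s ^ 2) ^ (ν / 2 - 1)) ∂(Pr x)) = I2 at *
  generalize (∫ y, lyapunov ν y ∂(P x)) = E at *
  set r := ‖(x : Plane)‖ with hr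
  have w1 : |ν * r ^ ν * (pT * I2 - pR * I1)| ≤
      |ν| * (pT * (M' * J2) + pR * (M * J1)) * r ^ (ν - α) := by
    rw [abs_mul, abs_mul, abs_of_nonneg (by positivity : 0 ≤ r ^ ν)]
    have z1 : |pT * I2 - pR * I1| ≤ (pT * (M' * J2) + pR * (M * J1)) * r ^ (-α) := by
      have y1 : pR * I1 ≤ pR * (M * r ^ (-α) * J1) := mul_le_mul_of_nonneg_left u1 hpR.le
      have y2 : pT * I2 ≤ pT * (M' * r ^ (-α) * J2) := mul_le_mul_of_nonneg_left u2 hpT.le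
      have y3 : 0 ≤ pR * I1 := by positivity
      have y4 : 0 ≤ pT * I2 := by positivity
      rw [abs_le]
      constructor <;> nlinarith
    calc |ν| * r ^ ν * |pT * I2 - pR * I1| ≤
          |ν| * r ^ ν * ((pT * (M' * J2) + pR * (M * J1)) * r ^ (-α)) :=
          mul_le_mul_of_nonneg_left z1 (by positivity)
      _ = _ := by rw [sub_eq_add_neg ν α, Real.rpow_add hr0]; ring
  have w2 : K * r ^ (max ν 0 - min β 2) ≤ K * r ^ (ν - α) :=
    mul_le_mul_of_nonneg_left (Real.rpow_le_rpow_of_exponent_le (by linarith) hνα.le) hK0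
  rw [abs_le] at e1 w1 ⊢
  constructor <;> nlinarith [e1.1, e1.2, w1.1, w1.2]

lemma drift_asymptotics {ν : ℝ} (hν : ν ≠ 0) (hν1 : ν < 1)
    (hνα : max ν 0 - min β 2 < ν - α) {ε : ℝ} (hε : 0 < ε) :
    ∃ r₀ : ℝ, 2 ≤ r₀ ∧ ∀ x : 𝕏, r₀ ≤ ‖(x : Plane)‖ →
      |∫ y, lyapunov ν y ∂(P x) - ‖(x : Plane)‖ ^ ν -
        ν * criticalFun α pR pT cR cT ν * ‖(x : Plane)‖ ^ (ν - α)| ≤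
      ε * ‖(x : Plane)‖ ^ (ν - α) := by
  have hα0 : 0 < α := by linarith [h.α_mem.1]
  have hb1 : 1 ≤ min β 2 := le_min (by linarith [h.α_mem.1, h.β_gt]) one_le_two
  obtain ⟨K, hK0, hK⟩ := h.drift_decomposition hν hν1 hb1 (min_le_right _ _) (min_le_left _ _)
  have hD1 := tailDensity_radial h.α_mem hν1
  have hD2 := tailDensity_transverse h.α_mem hν1
  have hpT := h.pT_pos
  have hpR := h.pR_pos
  set δ := ε / (2 * |ν|) / 2 with hδ
  have hν' : 0 < |ν| := abs_pos.2 hν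
  have hδ0 : 0 < δ := by positivity
  obtain ⟨r₁, hr₁, H1⟩ := hD1.uniform_asymptotics h.uniformTail_radial h.prob hα0 h.cR_pos.le
    (h.measurable_θR.max measurable_const) (fun ω => le_max_right _ _) hδ0
  obtain ⟨r₂, hr₂, H2⟩ := hD2.uniform_asymptotics h.uniformTail_transverse h.prob hα0
    (by linarith [h.cT_pos]) (by have := h.measurable_θT; fun_prop) (fun ω => abs_nonneg _) hδ0
  have hlim : Tendsto (fun r : ℝ => K * r ^ (-(ν - α - (max ν 0 - min β 2)))) atTop (𝓝 (K * 0)) :=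
    (tendsto_rpow_neg_atTop (by linarith)).const_mul K
  rw [mul_zero] at hlim
  obtain ⟨r₃, hr₃⟩ := eventually_atTop.1 (hlim.eventually (gt_mem_nhds (half_pos hε)))
  refine ⟨max 2 (max r₁ (max r₂ r₃)), le_max_left _ _, fun x hx => ?_⟩
  simp only [max_le_iff] at hx
  obtain ⟨hx2, hx₁, hx₂, hx₃⟩ := hx
  have hr0 : 0 < ‖(x : Plane)‖ := by linarith
  have hx0 : (x : Plane) ≠ 0 := norm_pos_iff.1 hr0
  obtain ⟨i1, e1⟩ := hK x hx2
  have u1 := H1 _ hx₁ x hx0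
  have u2 := H2 _ hx₂ x hx0
  have u3 := (hr₃ _ hx₃).le
  rw [h.two_criticalFun_eq hν1]
  generalize (∫ s in Set.Ioi (0 : ℝ), (1 - (1 + s) ^ (ν - 1)) * s ^ (-α)) = J1 at *
  generalize (∫ s in Set.Ioi (0 : ℝ), s * (1 + s ^ 2) ^ (ν / 2 - 1) * s ^ (-α)) = J2 at *
  generalize (∫ ω, (∫ s in (0 : ℝ)..(max (θR ω) 0 / ‖(x : Plane)‖),
      (1 - (1 + s) ^ (ν - 1))) ∂(Pr x)) = I1 at *
  generalize (∫ ω, (∫ s in (0 : ℝ)..(|θT ω| / ‖(x : Plane)‖),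
      s * (1 + s ^ 2) ^ (ν / 2 - 1)) ∂(Pr x)) = I2 at *
  generalize (∫ y, lyapunov ν y ∂(P x)) = E at *
  set r := ‖(x : Plane)‖ with hr
  have hrp : 0 < r ^ (ν - α) := by positivity
  have w2 : K * r ^ (max ν 0 - min β 2) ≤ ε / 2 * r ^ (ν - α) := by
    calc K * r ^ (max ν 0 - min β 2) =
          K * r ^ (-(ν - α - (max ν 0 - min β 2))) * r ^ (ν - α) := by
          rw [mul_assoc, ← Real.rpow_add hr0]; ring_nf
      _ ≤ _ := mul_le_mul_of_nonneg_right u3 hrp.le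
  have e2 : ν * r ^ ν * (pT * I2 - pR * I1) = ν * r ^ (ν - α) *
      (pT * (r ^ α * I2) - pR * (r ^ α * I1)) := by
    have : r ^ ν = r ^ (ν - α) * r ^ α := by rw [← Real.rpow_add hr0]; ring_nf
    rw [this]; ring
  have w1 : |ν * r ^ ν * (pT * I2 - pR * I1) -
      ν * (pT * (2 * cT * J2) - pR * (cR * J1)) * r ^ (ν - α)| ≤ ε / 2 * r ^ (ν - α) := by
    rw [e2, show ν * r ^ (ν - α) * (pT * (r ^ α * I2) - pR * (r ^ α * I1)) -
      ν * (pT * (2 * cT * J2) - pR * (cR * J1)) * r ^ (ν - α) =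
      ν * (pT * (r ^ α * I2 - 2 * cT * J2) - pR * (r ^ α * I1 - cR * J1)) * r ^ (ν - α) by ring,
      abs_mul, abs_of_pos hrp]
    apply mul_le_mul_of_nonneg_right _ hrp.le
    rw [abs_mul]
    have z : |pT * (r ^ α * I2 - 2 * cT * J2) - pR * (r ^ α * I1 - cR * J1)| ≤ δ := by
      have hs : pT = 1 - pR := h.pT_eq
      have y1 := abs_le.1 u1
      have y2 := abs_le.1 u2
      rw [abs_le]
      constructor <;> nlinarith [mul_le_mul_of_nonneg_left y1.1 hpR.le,
        mul_le_mul_of_nonneg_left y1.2 hpR.le, mul_le_mul_of_nonneg_left y2.1 hpT.le,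
        mul_le_mul_of_nonneg_left y2.2 hpT.le]
    calc |ν| * _ ≤ |ν| * δ := mul_le_mul_of_nonneg_left z hν'.le
      _ = ε / 2 / 2 := by rw [hδ]; field_simp
      _ ≤ ε / 2 := by linarith
  rw [abs_le] at e1 w1 ⊢
  constructor <;> linarith [e1.1, e1.2, w1.1, w1.2]

lemma min_gt : α < min β 2 := lt_min h.β_gt h.α_mem.2

lemma exists_negative_drift {ν : ℝ} (hν0 : ν ≠ 0) (hν1 : ν < 1)
    (hνα : max ν 0 - min β 2 < ν - α) (hneg : ν * criticalFun α pR pT cR cT ν < 0) :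
    ∃ d > 0, ∃ A : ℝ, 2 ≤ A ∧ ∀ x : 𝕏, A ≤ ‖(x : Plane)‖ →
      ∫ y, lyapunov ν y ∂(P x) ≤ lyapunov ν x - d * ‖(x : Plane)‖ ^ (ν - α) := by
  set F := ν * criticalFun α pR pT cR cT ν with hF
  obtain ⟨A, hA2, hA⟩ := h.drift_asymptotics hν0 hν1 hνα (by linarith : 0 < -F / 2)
  refine ⟨-F / 2, by linarith, A, hA2, fun x hx => ?_⟩
  rw [lyapunov_of_one_le ν (by linarith)]
  have := (abs_le.1 (hA x hx)).2
  rw [← hF] at this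
  linarith

lemma exists_positive_drift {ν : ℝ} (hν0 : ν ≠ 0) (hν1 : ν < 1)
    (hνα : max ν 0 - min β 2 < ν - α) (hpos : 0 < ν * criticalFun α pR pT cR cT ν) :
    ∃ d > 0, ∃ A : ℝ, 2 ≤ A ∧ ∀ x : 𝕏, A ≤ ‖(x : Plane)‖ →
      lyapunov ν x + d * ‖(x : Plane)‖ ^ (ν - α) ≤ ∫ y, lyapunov ν y ∂(P x) := by
  set F := ν * criticalFun α pR pT cR cT ν with hF
  obtain ⟨A, hA2, hA⟩ := h.drift_asymptotics hν0 hν1 hνα (by linarith : 0 < F / 2)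
  refine ⟨F / 2, by linarith, A, hA2, fun x hx => ?_⟩
  rw [lyapunov_of_one_le ν (by linarith)]
  have := (abs_le.1 (hA x hx)).1
  rw [← hF] at this
  linarith

end IsRadialTransverseChain

end Drift

/-! ### From drift conditions to survival bounds. -/

section Comparison

variable {𝕏 : Set Plane} {P : Kernel 𝕏 𝕏} [IsMarkovKernel P]

/-- Upper bound on survival probabilities from a function that contracts in a shell and is large
outside it. -/
lemma survival_le_of_contraction {a r m lam : ℝ} {f : 𝕏 → ℝ} (hf1 : ∀ x, 1 ≤ f x)
    (hfi : ∀ x : 𝕏, a < ‖(x : Plane)‖ → Integrable f (P x)) (hm : 0 < m)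
    (hfm : ∀ x : 𝕏, r < ‖(x : Plane)‖ → m ≤ f x) (hl : 0 ≤ lam)
    (hd : ∀ x : 𝕏, a < ‖(x : Plane)‖ → ‖(x : Plane)‖ ≤ r → ∫ y, f y ∂(P x) ≤ lam * f x)
    (hl1 : lam ≤ 1) (n : ℕ) (x : 𝕏) : survival P a n x ≤ f x * (m⁻¹ + lam ^ n) := by
  have hmi : 0 < m⁻¹ := inv_pos.2 hm
  induction n generalizing x with
  | zero =>
    have h1 := survival_le_one P a 0 x
    have h2 := hf1 x
    rw [pow_zero]
    nlinarith
  | succ n ih =>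
    have hfx : 0 < f x := one_pos.trans_le (hf1 x)
    have hln : 0 ≤ lam ^ (n + 1) := pow_nonneg hl _
    rcases le_or_gt ‖(x : Plane)‖ a with hx | hx
    · rw [survival_of_le P hx]; positivity
    rcases le_or_gt ‖(x : Plane)‖ r with hxr | hxr
    · rw [survival_succ P hx]
      calc ∫ y, survival P a n y ∂(P x) ≤ ∫ y, f y * (m⁻¹ + lam ^ n) ∂(P x) :=
            integral_mono (integrable_survival P a n _) ((hfi x hx).mul_const _) ih
        _ = (∫ y, f y ∂(P x)) * (m⁻¹ + lam ^ n) := integral_mul_const _ _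
        _ ≤ lam * f x * (m⁻¹ + lam ^ n) :=
            mul_le_mul_of_nonneg_right (hd x hx hxr) (by positivity)
        _ = f x * (lam * m⁻¹ + lam ^ (n + 1)) := by ring
        _ ≤ f x * (m⁻¹ + lam ^ (n + 1)) := by
            apply mul_le_mul_of_nonneg_left _ hfx.le
            nlinarith
    -- Beyond radius r no drift is used: there f ≥ m already makes the claimed bound at least 1.
    · calc survival P a (n + 1) x ≤ 1 := survival_le_one P a _ x
        _ = m * m⁻¹ := (mul_inv_cancel₀ hm.ne').symm
        _ ≤ f x * (m⁻¹ + lam ^ (n + 1)) :=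
          mul_le_mul (hfm x hxr) (by linarith) hmi.le hfx.le

/-- The chain started far out is unlikely to come back to the ball of radius `ρ` soon. -/
lemma one_sub_survival_le {a ρ κ C : ℝ} {f : 𝕏 → ℝ} (haρ : a ≤ ρ) (hf0 : ∀ x, 0 ≤ f x)
    (hf : ∀ x : 𝕏, ‖(x : Plane)‖ ≤ ρ → κ ≤ f x)
    (hκ : 0 < κ) (hC : 0 ≤ C)
    (hfi : ∀ x : 𝕏, ρ < ‖(x : Plane)‖ → Integrable f (P x))
    (hd : ∀ x : 𝕏, ρ < ‖(x : Plane)‖ → ∫ y, f y ∂(P x) ≤ f x + C) (n : ℕ) (x : 𝕏) :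
    1 - survival P a n x ≤ κ⁻¹ * (f x + n * C) := by
  induction n generalizing x with
  | zero =>
    rcases le_or_gt ‖(x : Plane)‖ ρ with hx | hx
    · have : 1 ≤ κ⁻¹ * f x := by
        rw [← inv_mul_cancel₀ hκ.ne']; exact mul_le_mul_of_nonneg_left (hf x hx) (by positivity)
      have := survival_nonneg P a 0 x
      simp only [Nat.cast_zero, zero_mul, add_zero]
      linarith
    · rw [survival_zero_of_lt P (haρ.trans_lt hx)]
      have := hf0 x
      simp only [sub_self]
      positivity
  | succ n ih =>
    rcases le_or_gt ‖(x : Plane)‖ ρ with hx | hx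
    · have h1 : 1 ≤ κ⁻¹ * f x := by
        rw [← inv_mul_cancel₀ hκ.ne']; exact mul_le_mul_of_nonneg_left (hf x hx) (by positivity)
      have h2 := survival_nonneg P a (n + 1) x
      have h3 : 0 ≤ κ⁻¹ * ((n + 1 : ℕ) * C) := by positivity
      rw [mul_add]
      linarith
    · rw [survival_succ P (haρ.trans_lt hx)]
      have hi := integrable_survival P a n (P x)
      have h1 : 1 - ∫ y, survival P a n y ∂(P x) = ∫ y, (1 - survival P a n y) ∂(P x) := by
        rw [integral_sub (integrable_const _) hi]; simp
      rw [h1]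
      calc ∫ y, (1 - survival P a n y) ∂(P x) ≤ ∫ y, κ⁻¹ * (f y + n * C) ∂(P x) :=
            integral_mono ((integrable_const _).sub hi)
              (((hfi x hx).add (integrable_const _)).const_mul _) ih
        _ = κ⁻¹ * (∫ y, f y ∂(P x) + n * C) := by
            rw [integral_const_mul, integral_add (hfi x hx) (integrable_const _)]; simp
        _ ≤ κ⁻¹ * (f x + C + n * C) := by
            have := hd x hx
            gcongr
        _ = κ⁻¹ * (f x + (n + 1 : ℕ) * C) := by push_cast; ring

/-- Lower bound on survival probabilities from a function that is submartingale-like in a shell. -/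
lemma le_survival_of_submartingale {a r : ℝ} {N : ℕ} {g : 𝕏 → ℝ}
    (hga : ∀ x : 𝕏, ‖(x : Plane)‖ ≤ a → g x ≤ 0)
    (hgr : ∀ x : 𝕏, r < ‖(x : Plane)‖ → ∀ n ≤ N, g x ≤ survival P a n x) (hg1 : ∀ x, g x ≤ 1)
    (hgi : ∀ x : 𝕏, a < ‖(x : Plane)‖ → Integrable g (P x))
    (hd : ∀ x : 𝕏, a < ‖(x : Plane)‖ → ‖(x : Plane)‖ ≤ r → g x ≤ ∫ y, g y ∂(P x))
    (n : ℕ) (hn : n ≤ N) (x : 𝕏) : g x ≤ survival P a n x := by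
  induction n generalizing x with
  | zero =>
    rcases le_or_gt ‖(x : Plane)‖ a with hx | hx
    · exact (hga x hx).trans (survival_nonneg P a 0 x)
    · rw [survival_zero_of_lt P hx]; exact hg1 x
  | succ n ih =>
    rcases le_or_gt ‖(x : Plane)‖ a with hx | hx
    · exact (hga x hx).trans (survival_nonneg P a _ x)
    rcases le_or_gt ‖(x : Plane)‖ r with hxr | hxr
    · rw [survival_succ P hx]
      exact (hd x hx hxr).trans (integral_mono (hgi x hx) (integrable_survival P a n _)
        (ih (by omega)))
    · exact hgr x hxr _ hn

/-- If from every point outside the ball of radius `a` the chain moves inwards by `δ` with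
probability at least `p`, then it enters the ball within `k` steps with probability at least
`p ^ k` from points at distance at most `k * δ`. -/
lemma survival_le_one_sub_pow {a δ p : ℝ} (hp : 0 ≤ p) (hp1 : p ≤ 1)
    (h : ∀ x : 𝕏, a < ‖(x : Plane)‖ → p ≤ (P x).real {y | ‖(y : Plane)‖ ≤ ‖(x : Plane)‖ - δ})
    (k : ℕ) (x : 𝕏) (hx : ‖(x : Plane)‖ ≤ a + k * δ) : survival P a k x ≤ 1 - p ^ k := by
  induction k generalizing x with
  | zero =>
    rw [survival_of_le P (by simpa using hx)]; simp
  | succ k ih =>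
    rcases le_or_gt ‖(x : Plane)‖ a with hxa | hxa
    · rw [survival_of_le P hxa, sub_nonneg]
      exact pow_le_one₀ hp hp1
    · rw [survival_succ P hxa]
      set S : Set 𝕏 := {y | ‖(y : Plane)‖ ≤ ‖(x : Plane)‖ - δ} with hS
      have hSm : MeasurableSet S := measurableSet_le (by fun_prop) measurable_const
      calc ∫ y, survival P a k y ∂(P x) ≤ ∫ y, (1 - S.indicator (fun _ => p ^ k) y) ∂(P x) := by
            refine integral_mono (integrable_survival P a k _)
              ((integrable_const _).sub ((integrable_const _).indicator hSm)) fun y => ?_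
            by_cases hy : y ∈ S
            · simp only [Set.indicator_of_mem hy]
              refine ih y ?_
              have : ‖(y : Plane)‖ ≤ ‖(x : Plane)‖ - δ := hy
              push_cast at hx
              linarith
            · simp only [Set.indicator_of_notMem hy, sub_zero]
              exact survival_le_one P a k y
        _ = 1 - (P x).real S * p ^ k := by
            rw [integral_sub (integrable_const _) ((integrable_const _).indicator hSm),
              integral_indicator_const _ hSm]
            simp
        _ ≤ 1 - p ^ (k + 1) := by
            have := mul_le_mul_of_nonneg_right (h x hxa) (pow_nonneg hp k)
            rw [pow_succ]
            linarith

end Comparison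

/-! ### Outward and inward steps of uniformly positive probability. -/

section OneStepEstimates

variable {Ω : Type*} [MeasurableSpace Ω] {𝕏 : Set Plane} {P : Kernel 𝕏 𝕏} [IsMarkovKernel P]
  {Pr : 𝕏 → Measure Ω} {χ θR θT : Ω → ℝ} {α β pR pT cR cT : ℝ}

lemma UniformTail.exists_lower_bound {ι : Type*} {μ : ι → Measure Ω} {A : Set ι} {Y : Ω → ℝ} {c : ℝ}
    (h : UniformTail μ A Y α c) (hc : 0 < c) (R : ℝ) :
    ∃ y > 0, R ≤ y ∧ ∃ q > 0, ∀ i ∈ A, q ≤ (μ i).real {ω | y < Y ω} := by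
  obtain ⟨y₀, hy₀, H⟩ := h (c / 2) (half_pos hc)
  have hy : 0 < max y₀ R := lt_max_of_lt_left hy₀
  refine ⟨max y₀ R, hy, le_max_right _ _, c / 2 / (max y₀ R) ^ α, by positivity, fun i hi => ?_⟩
  have := (abs_le.1 (H (max y₀ R) (le_max_left _ _) i hi)).1
  rw [div_le_iff₀ (by positivity)]
  linarith

lemma indicator_one_le_indicator_one {ι : Type*} {S : Set ι} {T : Set ℝ} {t : ℝ} {i : ι}
    (hST : i ∈ S → t ∈ T) :
    S.indicator (1 : ι → ℝ≥0∞) i ≤ T.indicator (1 : ℝ → ℝ≥0∞) t := by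
  by_cases hω : i ∈ S
  · rw [Set.indicator_of_mem hω, Set.indicator_of_mem (hST hω)]; rfl
  · rw [Set.indicator_of_notMem hω]; exact zero_le

namespace IsRadialTransverseChain

variable (h : IsRadialTransverseChain 𝕏 P Pr χ θR θT α β pR pT cR cT)

include h

/-- A transverse jump leads to a point of norm at least |θT|, wherever it starts, and |θT| exceeds
any level with uniformly positive probability. -/
lemma exists_outward_step (R : ℝ) :
    ∃ δ > 0, ∀ x : 𝕏, (x : Plane) ≠ 0 → δ ≤ (P x).real {y | R < ‖(y : Plane)‖} := by
  obtain ⟨y, hy0, hyR, q, hq, H⟩ := h.uniformTail_transverse.exists_lower_bound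
    (by linarith [h.cT_pos]) R
  refine ⟨pT * q, mul_pos h.pT_pos hq, fun x hx => ?_⟩
  have := h.isProbabilityMeasure x hx
  have hm : MeasurableSet {y : 𝕏 | R < ‖(y : Plane)‖} := measurableSet_norm_gt R
  have hT := h.measurable_θT
  have h1 : P x {y | R < ‖(y : Plane)‖} = ∫⁻ y, (Set.Ioi R).indicator 1 ‖(y : Plane)‖ ∂(P x) :=
    (lintegral_indicator_one hm).symm
  have h2 : ENNReal.ofReal (pT * q) ≤ P x {y | R < ‖(y : Plane)‖} := by
    rw [h1, h.lintegral_norm hx (measurable_one.indicator measurableSet_Ioi),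
      ENNReal.ofReal_mul h.pT_pos.le]
    refine le_trans ?_ le_add_self
    gcongr
    calc ENNReal.ofReal q ≤ ENNReal.ofReal ((Pr x).real {ω | y < |θT ω|}) :=
          ENNReal.ofReal_le_ofReal (H x hx)
      _ = ∫⁻ ω, {ω | y < |θT ω|}.indicator 1 ω ∂(Pr x) := by
          rw [ofReal_measureReal, lintegral_indicator_one (measurableSet_lt measurable_const
            (by fun_prop))]
      _ ≤ _ := by
          refine lintegral_mono fun ω => indicator_one_le_indicator_one fun hω => ?_
          have hω' : y < |θT ω| := hω
          have hlt : R < √(‖(x : Plane)‖ ^ 2 + θT ω ^ 2) := by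
            refine (hyR.trans_lt hω').trans_le ?_
            rw [← Real.sqrt_sq_eq_abs]
            exact Real.sqrt_le_sqrt (by nlinarith [sq_nonneg ‖(x : Plane)‖])
          exact hlt
  rw [← ofReal_measureReal] at h2
  exact (ENNReal.ofReal_le_ofReal_iff measureReal_nonneg).1 h2

/-- Mean zero and the outward tail force the inward part of `θR` to have mean at least e = yq. Jumps
below e/3 account for at most e/3 of it, and by the b-th moment so do jumps above M; the rest comes
from jumps between e/3 and M. From norm at least M such a jump does not cross the origin. -/
lemma exists_inward_step :
    ∃ M : ℝ, 2 ≤ M ∧ ∃ δ > 0, ∃ p > 0, ∀ x : 𝕏, M ≤ ‖(x : Plane)‖ →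
      p ≤ (P x).real {y | ‖(y : Plane)‖ ≤ ‖(x : Plane)‖ - δ} := by
  obtain ⟨y, hy0, -, q, hq, H⟩ := h.uniformTail_radial.exists_lower_bound h.cR_pos 0
  have hb : 1 < min β 2 := lt_min (by linarith [h.α_mem.1, h.β_gt]) one_lt_two
  set b := min β 2 with hbdef
  obtain ⟨B, hB0, hB⟩ := h.exists_moment_bound (b := b) (by linarith) (min_le_left _ _)
  set e := y * q with he
  have he0 : 0 < e := mul_pos hy0 hq
  have hlim : Tendsto (fun r : ℝ => B * r ^ (-(b - 1))) atTop (𝓝 (B * 0)) :=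
    (tendsto_rpow_neg_atTop (by linarith)).const_mul B
  rw [mul_zero] at hlim
  obtain ⟨M₀, hM₀⟩ := eventually_atTop.1 (hlim.eventually (gt_mem_nhds (by positivity : 0 < e / 3)))
  set M := max M₀ 2 with hM
  have hM2 : 2 ≤ M := le_max_right _ _
  refine ⟨M, hM2, e / 3, by positivity, pR * (e / (3 * M)), mul_pos h.pR_pos (by positivity),
    fun x hx => ?_⟩
  have hr0 : 0 < ‖(x : Plane)‖ := by linarith
  have hx0 : (x : Plane) ≠ 0 := norm_pos_iff.1 hr0
  have := h.isProbabilityMeasure x hx0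
  have hR := h.measurable_θR
  obtain ⟨hi, hz⟩ := h.mean_θR x hx0
  have hip : Integrable (fun ω => max (θR ω) 0) (Pr x) := hi.pos_part
  have hin : Integrable (fun ω => max (-(θR ω)) 0) (Pr x) := hi.neg_part
  set S : Set Ω := {ω | e / 3 ≤ max (-(θR ω)) 0} ∩ {ω | max (-(θR ω)) 0 ≤ M} with hS
  have hSm : MeasurableSet S :=
    (measurableSet_le measurable_const (by fun_prop)).inter
      (measurableSet_le (by fun_prop) measurable_const)
  have e1 : ∫ ω, max (-(θR ω)) 0 ∂(Pr x) = ∫ ω, max (θR ω) 0 ∂(Pr x) := by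
    have : ∫ ω, θR ω ∂(Pr x) = ∫ ω, max (θR ω) 0 ∂(Pr x) - ∫ ω, max (-(θR ω)) 0 ∂(Pr x) := by
      rw [← integral_sub hip hin]
      refine integral_congr_ae (ae_of_all _ fun ω => ?_)
      simp only
      rcases le_total 0 (θR ω) with h0 | h0
      · rw [max_eq_left h0, max_eq_right (by linarith)]; ring
      · rw [max_eq_right h0, max_eq_left (by linarith)]; ring
    rw [hz] at this
    linarith
  have e2 : e ≤ ∫ ω, max (-(θR ω)) 0 ∂(Pr x) := by
    rw [e1]
    have m1 := mul_meas_ge_le_integral_of_nonneg (μ := Pr x)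
      (ae_of_all _ fun ω => le_max_right (θR ω) 0) hip y
    have m2 : (Pr x).real {ω | y < max (θR ω) 0} ≤ (Pr x).real {ω | y ≤ max (θR ω) 0} :=
      measureReal_mono fun ω (hω : y < max (θR ω) 0) => show y ≤ max (θR ω) 0 from hω.le
    have m3 := H x hx0
    calc e ≤ y * (Pr x).real {ω | y ≤ max (θR ω) 0} :=
          mul_le_mul_of_nonneg_left (m3.trans m2) hy0.le
      _ ≤ _ := m1
  have e3 : ∫ ω, max (-(θR ω)) 0 ∂(Pr x) ≤ e / 3 + M * (Pr x).real S + e / 3 := by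
    have hpt : ∀ ω, max (-(θR ω)) 0 ≤ e / 3 + S.indicator (fun _ => M) ω +
        max (-(θR ω)) 0 ^ b * M ^ (-(b - 1)) := by
      intro ω
      set X := max (-(θR ω)) 0 with hX
      have hX0 : 0 ≤ X := le_max_right _ _
      have hp : 0 ≤ X ^ b * M ^ (-(b - 1)) := by positivity
      have hi0 : 0 ≤ S.indicator (fun _ => M) ω := Set.indicator_nonneg (fun _ _ => by linarith) ω
      rcases lt_or_ge X (e / 3) with c1 | c1
      · linarith
      rcases le_or_gt X M with c2 | c2
      · rw [Set.indicator_of_mem (show ω ∈ S from ⟨c1, c2⟩)]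
        linarith
      · have hXp : 0 < X := by linarith
        have : X ≤ X ^ b * M ^ (-(b - 1)) := by
          calc X = X ^ b * X ^ (-(b - 1)) := by
                rw [← Real.rpow_add hXp]; simp
            _ ≤ X ^ b * M ^ (-(b - 1)) := by
                apply mul_le_mul_of_nonneg_left _ (by positivity)
                exact Real.rpow_le_rpow_of_nonpos (by linarith) c2.le (by linarith)
        linarith
    have hI : Integrable (fun ω => e / 3 + S.indicator (fun _ => M) ω) (Pr x) :=
      (integrable_const _).add ((integrable_const _).indicator hSm)
    calc ∫ ω, max (-(θR ω)) 0 ∂(Pr x) ≤ ∫ ω, (e / 3 + S.indicator (fun _ => M) ω +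
          max (-(θR ω)) 0 ^ b * M ^ (-(b - 1))) ∂(Pr x) :=
          integral_mono hin (hI.add ((hB x hx0).1.mul_const _)) hpt
      _ = e / 3 + M * (Pr x).real S +
          (∫ ω, max (-(θR ω)) 0 ^ b ∂(Pr x)) * M ^ (-(b - 1)) := by
          rw [integral_add hI ((hB x hx0).1.mul_const _), integral_mul_const,
            integral_add (integrable_const _) ((integrable_const _).indicator hSm),
            integral_indicator_const _ hSm]
          simp [mul_comm]
      _ ≤ e / 3 + M * (Pr x).real S + B * M ^ (-(b - 1)) := by
          have := (hB x hx0).2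
          gcongr
      _ ≤ _ := by
          have := (hM₀ M (le_max_left _ _)).le
          linarith
  have e4 : e / (3 * M) ≤ (Pr x).real S := by
    rw [div_le_iff₀ (by positivity)]
    linarith
  have hm : MeasurableSet {y : 𝕏 | ‖(y : Plane)‖ ≤ ‖(x : Plane)‖ - e / 3} :=
    measurableSet_le (by fun_prop) measurable_const
  have h1 : P x {y | ‖(y : Plane)‖ ≤ ‖(x : Plane)‖ - e / 3} =
      ∫⁻ y, (Set.Iic (‖(x : Plane)‖ - e / 3)).indicator 1 ‖(y : Plane)‖ ∂(P x) :=
    (lintegral_indicator_one hm).symm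
  have h2 : ENNReal.ofReal (pR * (e / (3 * M))) ≤ P x {y | ‖(y : Plane)‖ ≤ ‖(x : Plane)‖ - e / 3} := by
    rw [h1, h.lintegral_norm hx0 (measurable_one.indicator measurableSet_Iic),
      ENNReal.ofReal_mul h.pR_pos.le]
    refine le_trans ?_ le_self_add
    gcongr
    calc ENNReal.ofReal (e / (3 * M)) ≤ ENNReal.ofReal ((Pr x).real S) :=
          ENNReal.ofReal_le_ofReal e4
      _ = ∫⁻ ω, S.indicator 1 ω ∂(Pr x) := by
          rw [ofReal_measureReal, lintegral_indicator_one hSm]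
      _ ≤ _ := by
          refine lintegral_mono fun ω => indicator_one_le_indicator_one fun hω => ?_
          obtain ⟨c1, c2⟩ := hω
          simp only [Set.mem_ofPred_eq] at c1 c2
          have hneg : 0 < -(θR ω) := by
            by_contra! hc
            rw [max_eq_right hc] at c1
            linarith
          rw [max_eq_left hneg.le] at c1 c2
          have hle : |‖(x : Plane)‖ + θR ω| ≤ ‖(x : Plane)‖ - e / 3 := by
            rw [abs_of_nonneg (by linarith)]; linarith
          exact hle
  rw [← ofReal_measureReal] at h2
  exact (ENNReal.ofReal_le_ofReal_iff measureReal_nonneg).1 h2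

/-- A radius beyond which every ball can be reached by successive inward jumps. -/
lemma exists_radius_reachable :
    ∃ a₀ : ℝ, 2 ≤ a₀ ∧ ∀ a ≥ a₀, ∀ A : ℝ, ∃ N : ℕ, ∃ η > 0, ∀ x : 𝕏, ‖(x : Plane)‖ ≤ A →
      survival P a N x ≤ 1 - η := by
  obtain ⟨M, hM, δ, hδ, p, hp, H⟩ := h.exists_inward_step
  refine ⟨M, hM, fun a ha A => ?_⟩
  obtain ⟨N, hN⟩ := exists_nat_gt ((A - a) / δ)
  rw [div_lt_iff₀ hδ] at hN
  have hp1 : 0 < min p 1 := lt_min hp one_pos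
  refine ⟨N, min p 1 ^ N, by positivity, fun x hx => ?_⟩
  exact survival_le_one_sub_pow hp1.le (min_le_right _ _) (fun y hy =>
    (min_le_left _ _).trans (H y (ha.trans hy.le))) N x (by linarith)

end IsRadialTransverseChain

end OneStepEstimates

/-! ### Polynomial decay of survival and finite moments. -/

section UpperMoments

variable {Ω : Type*} [MeasurableSpace Ω] {𝕏 : Set Plane} {P : Kernel 𝕏 𝕏} [IsMarkovKernel P]
  {Pr : 𝕏 → Measure Ω} {χ θR θT : Ω → ℝ} {α β pR pT cR cT : ℝ}

/-- Here lam^n ≤ exp(-c n^γ), and exp(u) ≥ u^k/k! with k > s/γ beats the required power. -/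
lemma exists_pow_le_rpow {c γ s : ℝ} (hc : 0 < c) (hγ : 0 < γ) :
    ∃ C : ℝ, 0 ≤ C ∧ ∀ n : ℕ, 0 < n → ∀ lam : ℝ, 0 ≤ lam → lam ≤ 1 - c * (n : ℝ) ^ (γ - 1) →
      lam ^ n ≤ C * (n : ℝ) ^ (-s) := by
  obtain ⟨k, hk⟩ := exists_nat_gt (s / γ)
  rw [div_lt_iff₀ hγ] at hk
  refine ⟨k.factorial / c ^ k, by positivity, fun n hn lam hl0 hl => ?_⟩
  have hn0 : (0 : ℝ) < n := by exact_mod_cast hn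
  have hn1 : (1 : ℝ) ≤ n := by exact_mod_cast hn
  have h1 : lam ≤ Real.exp (-(c * (n : ℝ) ^ (γ - 1))) :=
    hl.trans (by linarith [Real.add_one_le_exp (-(c * (n : ℝ) ^ (γ - 1)))])
  have h2 : lam ^ n ≤ Real.exp (-(c * (n : ℝ) ^ γ)) := by
    calc lam ^ n ≤ (Real.exp (-(c * (n : ℝ) ^ (γ - 1)))) ^ n := pow_le_pow_left₀ hl0 h1 n
      _ = Real.exp (-(c * (n : ℝ) ^ γ)) := by
        rw [← Real.exp_nat_mul]
        congr 1
        have : (n : ℝ) ^ γ = n * (n : ℝ) ^ (γ - 1) := by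
          rw [Real.rpow_sub_one hn0.ne']; field_simp
        rw [this]; ring
  have hu : 0 < c * (n : ℝ) ^ γ := by positivity
  have h3 := Real.pow_div_factorial_le_exp (c * (n : ℝ) ^ γ) hu.le k
  have hpk : 0 < (c * (n : ℝ) ^ γ) ^ k := by positivity
  have hfk : (0 : ℝ) < k.factorial := by exact_mod_cast k.factorial_pos
  calc lam ^ n ≤ Real.exp (-(c * (n : ℝ) ^ γ)) := h2
    _ = (Real.exp (c * (n : ℝ) ^ γ))⁻¹ := Real.exp_neg _
    _ ≤ ((c * (n : ℝ) ^ γ) ^ k / k.factorial)⁻¹ := inv_anti₀ (by positivity) h3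
    _ = k.factorial / c ^ k * (n : ℝ) ^ (-(γ * k)) := by
        rw [inv_div, mul_pow, Real.rpow_neg hn0.le, Real.rpow_mul hn0.le, Real.rpow_natCast]
        field_simp
    _ ≤ k.factorial / c ^ k * (n : ℝ) ^ (-s) := by
        apply mul_le_mul_of_nonneg_left _ (by positivity)
        exact Real.rpow_le_rpow_of_exponent_le hn1 (by linarith)

/-- A multiplicative drift condition turned into polynomial decay of the survival probabilities. -/
lemma exists_survival_le_rpow {a d ν s : ℝ} (ha : 1 ≤ a) (hd0 : 0 < d) (hν : 0 < ν) (hα : 0 < α)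
    (hs : 0 < s) (hsα : s * α < 1) {f : 𝕏 → ℝ} (hf1 : ∀ x, 1 ≤ f x)
    (hfi : ∀ x : 𝕏, a < ‖(x : Plane)‖ → Integrable f (P x))
    (hfν : ∀ x : 𝕏, 1 ≤ ‖(x : Plane)‖ → ‖(x : Plane)‖ ^ ν ≤ f x)
    (hd : ∀ x : 𝕏, a < ‖(x : Plane)‖ →
      ∫ y, f y ∂(P x) ≤ f x * (1 - d * ‖(x : Plane)‖ ^ (-α))) (x : 𝕏) :
    ∃ C : ℝ, ∀ n : ℕ, 0 < n → survival P a n x ≤ C * (n : ℝ) ^ (-(s * ν)) := by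
  -- Capping at 1 keeps the contraction factor 1 - c r^(-α) nonnegative.
  set c := min d 1 with hc
  have hc0 : 0 < c := lt_min hd0 one_pos
  obtain ⟨C, hC0, hC⟩ := exists_pow_le_rpow (s := s * ν) hc0 (sub_pos.2 hsα)
  refine ⟨f x * (1 + C), fun n hn => ?_⟩
  have hn0 : (0 : ℝ) < n := by exact_mod_cast hn
  have hn1 : (1 : ℝ) ≤ n := by exact_mod_cast hn
  -- Since sα < 1, n steps are many more than the r^α needed to leave the shell, while r^(-ν) =
  -- n^(-sν) is the target rate.
  set r := (n : ℝ) ^ s with hr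
  have hr1 : 1 ≤ r := Real.one_le_rpow hn1 hs.le
  have hr0 : 0 < r := by linarith
  have hrα : r ^ (-α) ≤ 1 := Real.rpow_le_one_of_one_le_of_nonpos hr1 (by linarith)
  have hrα0 : 0 < r ^ (-α) := by positivity
  have hcd : c ≤ d := min_le_left _ _
  have hc1 : c ≤ 1 := min_le_right _ _
  have key := survival_le_of_contraction (P := P) (a := a) (r := r) (m := r ^ ν)
    (lam := 1 - c * r ^ (-α)) hf1 hfi (by positivity)
    (fun y hy => (Real.rpow_le_rpow hr0.le hy.le hν.le).trans (hfν y (hr1.trans hy.le)))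
    (by nlinarith) (fun y hy hyr => by
      refine (hd y hy).trans ?_
      rw [mul_comm]
      apply mul_le_mul_of_nonneg_right _ (zero_le_one.trans (hf1 y))
      have h1 : r ^ (-α) ≤ ‖(y : Plane)‖ ^ (-α) :=
        Real.rpow_le_rpow_of_nonpos (by linarith) hyr (by linarith)
      have h2 : c * r ^ (-α) ≤ d * ‖(y : Plane)‖ ^ (-α) := mul_le_mul hcd h1 hrα0.le hd0.le
      linarith) (by nlinarith) n x
  refine key.trans ?_
  have e1 : (r ^ ν)⁻¹ = (n : ℝ) ^ (-(s * ν)) := by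
    rw [hr, ← Real.rpow_mul hn0.le, Real.rpow_neg hn0.le]
  have e2 : (1 - c * r ^ (-α)) ^ n ≤ C * (n : ℝ) ^ (-(s * ν)) := by
    refine hC n hn _ (by nlinarith) (le_of_eq ?_)
    rw [hr, ← Real.rpow_mul hn0.le]
    congr 3
    ring
  rw [e1, mul_assoc, add_mul, one_mul]
  exact mul_le_mul_of_nonneg_left (by linarith) (zero_le_one.trans (hf1 x))

lemma one_le_lyapunov {ν : ℝ} (hν : 0 ≤ ν) (x : 𝕏) : 1 ≤ lyapunov ν x :=
  Real.one_le_rpow (le_max_right _ _) hν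

/-- The sum is the expected passage time truncated at N. One step lowers its mean by 1 - `survival P
a N x`, a definite amount wherever the ball can be reached within N steps; this makes it a corrector
for the Lyapunov function. -/
lemma integral_sum_survival {a : ℝ} {x : 𝕏} (hx : a < ‖(x : Plane)‖) (N : ℕ) :
    ∫ y, ∑ k ∈ Finset.range N, survival P a k y ∂(P x) =
      ∑ k ∈ Finset.range N, survival P a k x + survival P a N x - 1 := by
  rw [integral_finsetSum _ fun k _ => integrable_survival P a k _]
  simp only [← survival_succ P hx]
  have h1 := Finset.sum_range_succ' (fun k => survival P a k x) N
  rw [Finset.sum_range_succ, survival_zero_of_lt P hx] at h1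
  linarith

namespace IsRadialTransverseChain

variable (h : IsRadialTransverseChain 𝕏 P Pr χ θR θT α β pR pT cR cT)

include h

/-- Polynomial upper bound on the survival probabilities outside a ball into which the chain
can be driven from any bounded region. -/
lemma survival_upper_bound {ν : ℝ} (hν0 : 0 < ν) (hν1 : ν < 1)
    (hneg : criticalFun α pR pT cR cT ν < 0) {a : ℝ} (ha : 2 ≤ a)
    (hreach : ∀ A : ℝ, ∃ N : ℕ, ∃ η > 0, ∀ x : 𝕏, ‖(x : Plane)‖ ≤ A → survival P a N x ≤ 1 - η)
    {s : ℝ} (hs : 0 < s) (hsα : s * α < 1) (x : 𝕏) :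
    ∃ C : ℝ, ∀ n : ℕ, 0 < n → survival P a n x ≤ C * (n : ℝ) ^ (-(s * ν)) := by
  have hα0 : 0 < α := by linarith [h.α_mem.1]
  have hνα : max ν 0 - min β 2 < ν - α := by
    rw [max_eq_left hν0.le]; linarith [h.min_gt]
  obtain ⟨C, hC0, hC⟩ := h.exists_drift_bound hν0.ne' hν1 hνα
  obtain ⟨d, hd0, A, hA2, hA⟩ := h.exists_negative_drift hν0.ne' hν1 hνα
    (mul_neg_of_pos_of_neg hν0 hneg)
  obtain ⟨N, η, hη, hN⟩ := hreach A
  -- In the region a < ‖y‖ < A the drift of the Lyapunov function may be as large as C; the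
  -- corrector loses at least Bη = C + d there, which leaves a net drift of at most -d.
  set B := (C + d) / η with hB
  have hB0 : 0 ≤ B := by positivity
  set ψ : 𝕏 → ℝ := fun y => ∑ k ∈ Finset.range N, survival P a k y with hψ
  have hψ0 : ∀ y, 0 ≤ ψ y := fun y => Finset.sum_nonneg fun k _ => survival_nonneg P a k y
  have hψN : ∀ y, ψ y ≤ N := fun y => by
    have := Finset.sum_le_sum fun k (_ : k ∈ Finset.range N) => survival_le_one P a k y
    simpa using this
  have hψi : ∀ μ : Measure 𝕏, ∀ [IsFiniteMeasure μ], Integrable ψ μ := fun μ _ =>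
    integrable_finsetSum _ fun k _ => integrable_survival P a k μ
  set f : 𝕏 → ℝ := fun y => lyapunov ν y + B * ψ y with hf
  have hfi : ∀ y : 𝕏, a < ‖(y : Plane)‖ → Integrable f (P y) := fun y hy =>
    (hC y (by linarith)).1.add ((hψi (P y)).const_mul B)
  have hfint : ∀ y : 𝕏, a < ‖(y : Plane)‖ → ∫ z, f z ∂(P y) =
      ∫ z, lyapunov ν z ∂(P y) + B * (ψ y + survival P a N y - 1) := fun y hy => by
    rw [integral_add (hC y (by linarith)).1 ((hψi (P y)).const_mul B), integral_const_mul,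
      integral_sum_survival hy]
  have hdrift : ∀ y : 𝕏, a < ‖(y : Plane)‖ →
      ∫ z, f z ∂(P y) ≤ f y - d * ‖(y : Plane)‖ ^ (ν - α) := by
    intro y hy
    rw [hfint y hy]
    rcases le_or_gt A ‖(y : Plane)‖ with hyA | hyA
    · have h1 := hA y hyA
      have h2 := survival_le_one P a N y
      have h3 : B * (ψ y + survival P a N y - 1) ≤ B * ψ y :=
        mul_le_mul_of_nonneg_left (by linarith) hB0
      simp only [hf]
      linarith
    · have h1 := (abs_le.1 (hC y (by linarith)).2).2
      have h2 := hN y hyA.le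
      have hp : ‖(y : Plane)‖ ^ (ν - α) ≤ 1 :=
        Real.rpow_le_one_of_one_le_of_nonpos (by linarith) (by linarith [h.α_mem.1])
      have h3 : B * (ψ y + survival P a N y - 1) ≤ B * (ψ y - η) :=
        mul_le_mul_of_nonneg_left (by linarith) hB0
      have h4 : B * η = C + d := by rw [hB]; field_simp
      have h5 : C * ‖(y : Plane)‖ ^ (ν - α) ≤ C * 1 := mul_le_mul_of_nonneg_left hp hC0
      have h6 : d * ‖(y : Plane)‖ ^ (ν - α) ≤ d * 1 := mul_le_mul_of_nonneg_left hp hd0.le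
      simp only [hf]
      rw [lyapunov_of_one_le ν (by linarith)]
      nlinarith
  have hf1 : ∀ y, 1 ≤ f y := fun y => by
    have := one_le_lyapunov hν0.le y
    have := mul_nonneg hB0 (hψ0 y)
    simp only [hf]
    linarith
  -- Outside the ball f ≤ (1 + BN)‖y‖^ν, so the additive drift -d‖y‖^(ν-α) becomes multiplicative at
  -- the price of this factor.
  refine exists_survival_le_rpow (d := d / (1 + B * N)) (f := f) (by linarith) (by positivity) hν0
    hα0 hs hsα hf1 hfi (fun y hy => ?_) (fun y hy => (hdrift y hy).trans ?_) x
  · have := mul_nonneg hB0 (hψ0 y)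
    simp only [hf]
    rw [lyapunov_of_one_le ν hy]
    linarith
  · have hr0 : 0 < ‖(y : Plane)‖ := by linarith
    have h1 : f y ≤ (1 + B * N) * ‖(y : Plane)‖ ^ ν := by
      have h2 := one_le_lyapunov hν0.le y
      have h3 := mul_le_mul_of_nonneg_left (hψN y) hB0
      simp only [hf]
      rw [lyapunov_of_one_le ν (by linarith)] at h2 ⊢
      have : 0 ≤ B * N := by positivity
      nlinarith
    have h4 : f y * (d / (1 + B * N) * ‖(y : Plane)‖ ^ (-α)) ≤ d * ‖(y : Plane)‖ ^ (ν - α) := by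
      calc f y * (d / (1 + B * N) * ‖(y : Plane)‖ ^ (-α)) ≤
            (1 + B * N) * ‖(y : Plane)‖ ^ ν * (d / (1 + B * N) * ‖(y : Plane)‖ ^ (-α)) :=
            mul_le_mul_of_nonneg_right h1 (by positivity)
        _ = d * ‖(y : Plane)‖ ^ (ν - α) := by
            rw [sub_eq_add_neg ν α, Real.rpow_add hr0]
            have : 1 + B * N ≠ 0 := by positivity
            field_simp
    linarith

lemma passageMoment_lt_top_of_lt {ν : ℝ} (hν : ν ∈ Set.Ioo (0 : ℝ) 1)
    (hroot : criticalFun α pR pT cR cT ν = 0) {a : ℝ} (ha : 2 ≤ a)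
    (hreach : ∀ A : ℝ, ∃ N : ℕ, ∃ η > 0, ∀ x : 𝕏, ‖(x : Plane)‖ ≤ A → survival P a N x ≤ 1 - η)
    {q : ℝ} (hq : 0 < q) (hqν : q < ν / α) (x : 𝕏) :
    (∃ q' > q, ∃ C : ℝ, ∀ n : ℕ, 0 < n → survival P a n x ≤ C * (n : ℝ) ^ (-q')) ∧
      passageMoment P a q x < ∞ := by
  have hα0 : 0 < α := by linarith [h.α_mem.1]
  rw [lt_div_iff₀ hα0] at hqν
  -- With qα < ν' < ν the drift at ν' is negative, and some s < 1/α satisfies sν' > q.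
  obtain ⟨ν', hν'1, hν'2⟩ := exists_between hqν
  have hν'0 : 0 < ν' := (mul_pos hq hα0).trans hν'1
  have hneg := criticalFun_neg_of_lt_root h.α_mem (mul_pos h.pR_pos h.cR_pos) hν'2 hν.2 hroot
  have hlt : q / ν' < 1 / α := by
    rw [div_lt_div_iff₀ hν'0 hα0]; linarith
  obtain ⟨s, hs1, hs2⟩ := exists_between hlt
  have hs0 : 0 < s := (div_pos hq hν'0).trans hs1
  rw [div_lt_iff₀ hν'0] at hs1
  rw [lt_div_iff₀ hα0] at hs2
  obtain ⟨C, hC⟩ := h.survival_upper_bound hν'0 (hν'2.trans hν.2) hneg ha hreach hs0 hs2 x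
  exact ⟨⟨s * ν', hs1, C, hC⟩, passageMoment_lt_top P hq hs1 hC⟩

end IsRadialTransverseChain

end UpperMoments

/-! ### Lower bounds on survival and infinite moments. -/

section LowerMoments

variable {Ω : Type*} [MeasurableSpace Ω] {𝕏 : Set Plane} {P : Kernel 𝕏 𝕏} [IsMarkovKernel P]
  {Pr : 𝕏 → Measure Ω} {χ θR θT : Ω → ℝ} {α β pR pT cR cT : ℝ}

lemma rpow_sub_scaled_rpow_le {ν ν' R t : ℝ} (hν0 : 0 < ν) (hν : ν < ν') (hR : 0 < R) (ht : 0 < t) :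
    t ^ ν - R ^ (ν - ν') * t ^ ν' ≤ R ^ ν := by
  have h0 : 0 ≤ R ^ (ν - ν') * t ^ ν' := by positivity
  rcases le_or_gt t R with h | h
  · have := Real.rpow_le_rpow ht.le h hν0.le
    linarith
  · have h1 : t ^ ν ≤ R ^ (ν - ν') * t ^ ν' := by
      calc t ^ ν = t ^ (ν - ν') * t ^ ν' := by rw [← Real.rpow_add ht]; ring_nf
        _ ≤ _ := mul_le_mul_of_nonneg_right
          (Real.rpow_le_rpow_of_nonpos hR h.le (by linarith)) (by positivity)
    have : 0 ≤ R ^ ν := by positivity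
    linarith

lemma scaled_rpow_le {ν ν' R η t m : ℝ} (hν : ν < ν') (hR : 0 < R) (ht : 0 < t) (hη0 : 0 < η)
    (htR : t ≤ η * R) (hη : η ^ (ν' - ν) ≤ m) : R ^ (ν - ν') * t ^ ν' ≤ m * t ^ ν := by
  have h1 : t ^ ν' = t ^ (ν' - ν) * t ^ ν := by rw [← Real.rpow_add ht]; ring_nf
  have h2 : t ^ (ν' - ν) ≤ (η * R) ^ (ν' - ν) := Real.rpow_le_rpow ht.le htR (by linarith)
  rw [Real.mul_rpow hη0.le hR.le] at h2
  have h3 : R ^ (ν - ν') * R ^ (ν' - ν) = 1 := by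
    rw [← Real.rpow_add hR]; simp
  calc R ^ (ν - ν') * t ^ ν' = R ^ (ν - ν') * t ^ (ν' - ν) * t ^ ν := by rw [h1]; ring
    _ ≤ R ^ (ν - ν') * (η ^ (ν' - ν) * R ^ (ν' - ν)) * t ^ ν := by gcongr
    _ = η ^ (ν' - ν) * (R ^ (ν - ν') * R ^ (ν' - ν)) * t ^ ν := by ring
    _ ≤ m * t ^ ν := by rw [h3, mul_one]; gcongr

namespace IsRadialTransverseChain

variable (h : IsRadialTransverseChain 𝕏 P Pr χ θR θT α β pR pT cR cT)

include h

/-- Uses the decreasing function f_{-κ}, whose mean increases by at most C ρ^(-κ-α) per step outside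
radius ρ. Starting at Kρ its value is at most ρ^(-κ)/4, and δρ^α steps add at most another quarter,
so the level ρ^(-κ) is reached with probability at most 1/2. -/
lemma exists_stay_far :
    ∃ K : ℝ, 1 ≤ K ∧ ∃ δ > 0, ∀ ρ ≥ 2, ∀ a ≤ ρ, ∀ x : 𝕏, K * ρ ≤ ‖(x : Plane)‖ →
      ∀ n : ℕ, n ≤ δ * ρ ^ α → 1 / 2 ≤ survival P a n x := by
  set κ := (min β 2 - α) / 2 with hκ
  have hgap := h.min_gt
  have hα0 : 0 < α := by linarith [h.α_mem.1]
  have hκ0 : 0 < κ := by rw [hκ]; linarith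
  obtain ⟨C, hC0, hC⟩ := h.exists_drift_bound (ν := -κ) (by linarith) (by linarith)
    (by rw [max_eq_right (by linarith)]; linarith)
  have hK1 : 1 ≤ (4 : ℝ) ^ κ⁻¹ := Real.one_le_rpow (by norm_num) (by positivity)
  refine ⟨4 ^ κ⁻¹, hK1, 1 / (4 * (C + 1)), by positivity, fun ρ hρ a ha x hx n hn => ?_⟩
  have hρ0 : 0 < ρ := by linarith
  have hr1 : 1 ≤ ‖(x : Plane)‖ := by nlinarith
  have key := one_sub_survival_le (P := P) (a := a) (ρ := ρ) (κ := ρ ^ (-κ))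
    (C := C * ρ ^ (-κ - α)) (f := lyapunov (-κ)) ha (fun y => (lyapunov_pos _ y).le)
    (fun y hy => Real.rpow_le_rpow_of_nonpos (by positivity) (max_le hy (by linarith)) (by linarith))
    (by positivity) (by positivity) (fun y hy => (hC y (by linarith)).1) (fun y hy => by
      have h1 := (abs_le.1 (hC y (by linarith)).2).2
      rw [lyapunov_of_one_le _ (by linarith)]
      have h2 : C * ‖(y : Plane)‖ ^ (-κ - α) ≤ C * ρ ^ (-κ - α) :=
        mul_le_mul_of_nonneg_left (Real.rpow_le_rpow_of_nonpos hρ0 hy.le (by linarith)) hC0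
      linarith) n x
  have e1 : lyapunov (-κ) x ≤ 1 / 4 * ρ ^ (-κ) := by
    rw [lyapunov_of_one_le _ hr1]
    calc ‖(x : Plane)‖ ^ (-κ) ≤ (4 ^ κ⁻¹ * ρ) ^ (-κ) :=
          Real.rpow_le_rpow_of_nonpos (by positivity) hx (by linarith)
      _ = 1 / 4 * ρ ^ (-κ) := by
          rw [Real.mul_rpow (by positivity) hρ0.le, ← Real.rpow_mul (by norm_num),
            show κ⁻¹ * -κ = -1 by field_simp, Real.rpow_neg_one]
          norm_num
  have e2 : n * (C * ρ ^ (-κ - α)) ≤ 1 / 4 * ρ ^ (-κ) := by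
    calc n * (C * ρ ^ (-κ - α)) ≤ 1 / (4 * (C + 1)) * ρ ^ α * (C * ρ ^ (-κ - α)) :=
          mul_le_mul_of_nonneg_right hn (by positivity)
      _ = C / (4 * (C + 1)) * (ρ ^ α * ρ ^ (-κ - α)) := by ring
      _ = C / (4 * (C + 1)) * ρ ^ (-κ) := by rw [← Real.rpow_add hρ0]; ring_nf
      _ ≤ 1 / 4 * ρ ^ (-κ) := by
          apply mul_le_mul_of_nonneg_right _ (by positivity)
          rw [div_le_div_iff₀ (by positivity) (by norm_num)]
          linarith
  have e3 : (ρ ^ (-κ))⁻¹ * (lyapunov (-κ) x + n * (C * ρ ^ (-κ - α))) ≤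
      (ρ ^ (-κ))⁻¹ * (1 / 2 * ρ ^ (-κ)) :=
    mul_le_mul_of_nonneg_left (by linarith) (by positivity)
  have e4 : (ρ ^ (-κ))⁻¹ * (1 / 2 * ρ ^ (-κ)) = 1 / 2 := by
    have : ρ ^ (-κ) ≠ 0 := by positivity
    field_simp
  linarith

/-- The function f_ν has positive drift but is unbounded, so overshoots could carry its mean.
Subtracting R^(ν-ν') f_{ν'} with ν < ν' < 1 bounds it above by R^ν and keeps the drift nonnegative
up to radius ηR; beyond that radius survival is at least 1/2. -/
lemma survival_lower_bound {ν : ℝ} (hν0 : 0 < ν) (hν1 : ν < 1)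
    (hpos : 0 < criticalFun α pR pT cR cT ν) :
    ∃ A : ℝ, ∀ a ≥ A, ∃ A' : ℝ, ∃ c > 0, ∀ᶠ n : ℕ in atTop, ∀ x : 𝕏, A' < ‖(x : Plane)‖ →
      c * (n : ℝ) ^ (-(ν / α)) ≤ survival P a n x := by
  have hα0 : 0 < α := by linarith [h.α_mem.1]
  have hgap := h.min_gt
  obtain ⟨ν', hνν', hν'1⟩ := exists_between hν1
  have hν'0 : 0 < ν' := hν0.trans hνν'
  obtain ⟨d, hd0, A, hA2, hA⟩ := h.exists_positive_drift hν0.ne' hν1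
    (by rw [max_eq_left hν0.le]; linarith) (mul_pos hν0 hpos)
  obtain ⟨C₁, -, hC₁⟩ := h.exists_drift_bound hν0.ne' hν1 (by rw [max_eq_left hν0.le]; linarith)
  obtain ⟨C, hC0, hC⟩ := h.exists_drift_bound hν'0.ne' hν'1
    (by rw [max_eq_left hν'0.le]; linarith)
  obtain ⟨K, hK1, δ, hδ, hfar⟩ := h.exists_stay_far
  -- The first entry lets the drift d absorb that of the subtracted term; the second makes that term
  -- at most half of f_ν at the starting point.
  set m := min (d / (C + 1)) (1 / 2) with hm
  have hm0 : 0 < m := lt_min (by positivity) (by norm_num)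
  set η := m ^ (ν' - ν)⁻¹ with hη
  have hη0 : 0 < η := by positivity
  have hηm : η ^ (ν' - ν) ≤ m := by
    rw [hη, ← Real.rpow_mul hm0.le, inv_mul_cancel₀ (by linarith), Real.rpow_one]
  have hη1 : η ≤ 1 := Real.rpow_le_one hm0.le ((min_le_right _ _).trans (by norm_num))
    (inv_nonneg.2 (by linarith))
  have hKη : 1 ≤ K / η := by rw [one_le_div hη0]; linarith
  refine ⟨A, fun a ha => ?_⟩
  have ha0 : 0 < a := by linarith
  -- Beyond this radius ½‖x‖^ν - a^ν ≥ 1, so g(x) ≥ ½R^(-ν); the constant rewrites R^(-ν) in terms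
  -- of n.
  refine ⟨(2 * (a ^ ν + 1)) ^ ν⁻¹, 1 / 2 * ((K / η) ^ (-ν) * δ ^ (ν / α)), by positivity, ?_⟩
  have hρlim : Tendsto (fun n : ℕ => ((n : ℝ) / δ) ^ (1 / α)) atTop atTop :=
    (tendsto_rpow_atTop (by positivity)).comp (tendsto_natCast_atTop_atTop.atTop_div_const hδ)
  filter_upwards [hρlim.eventually_ge_atTop a, eventually_gt_atTop 0] with n hρa hn x hx
  have hn0 : (0 : ℝ) < n := by exact_mod_cast hn
  -- The radius for which the time horizon δρ^α of `exists_stay_far` equals n.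
  set ρ := ((n : ℝ) / δ) ^ (1 / α) with hρ
  have hρ2 : 2 ≤ ρ := by linarith
  have hρ0 : 0 < ρ := by linarith
  have hρα : δ * ρ ^ α = n := by
    rw [hρ, ← Real.rpow_mul (by positivity), one_div, inv_mul_cancel₀ hα0.ne', Real.rpow_one]
    field_simp
  set R := K / η * ρ with hR
  have hR0 : 0 < R := by positivity
  have hR1 : 1 ≤ R := by nlinarith
  have hηR : η * R = K * ρ := by rw [hR]; field_simp
  have hRν : (K / η) ^ (-ν) * δ ^ (ν / α) * (n : ℝ) ^ (-(ν / α)) = R ^ (-ν) := by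
    rw [hR, Real.mul_rpow (by positivity) hρ0.le, hρ, ← Real.rpow_mul (by positivity),
      Real.div_rpow hn0.le hδ.le, show 1 / α * -ν = -(ν / α) by ring, Real.rpow_neg hδ.le]
    field_simp
  have hRν0 : 0 < R ^ (-ν) := by positivity
  have hRR : R ^ ν * R ^ (-ν) = 1 := by rw [← Real.rpow_add hR0]; simp
  have hfar' : ∀ y : 𝕏, K * ρ ≤ ‖(y : Plane)‖ → ∀ k ≤ n, 1 / 2 ≤ survival P a k y :=
    fun y hy k hk => hfar ρ hρ2 a hρa y hy k (by rw [hρα]; exact_mod_cast hk)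
  rw [mul_assoc, hRν]
  rcases le_or_gt ‖(x : Plane)‖ (K * ρ) with hxr | hxr
  swap
  · have h1 := hfar' x hxr.le n le_rfl
    have h2 : R ^ (-ν) ≤ 1 := Real.rpow_le_one_of_one_le_of_nonpos hR1 (by linarith)
    linarith
  set g : 𝕏 → ℝ := fun y =>
    1 / 2 * R ^ (-ν) * (lyapunov ν y - R ^ (ν - ν') * lyapunov ν' y - a ^ ν) with hg
  have hg2 : ∀ y, g y ≤ 1 / 2 := by
    intro y
    have h1 := rpow_sub_scaled_rpow_le hν0 hνν' hR0
      (lt_of_lt_of_le one_pos (le_max_right ‖(y : Plane)‖ 1))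
    have h2 : 0 < a ^ ν := by positivity
    have h3 : lyapunov ν y - R ^ (ν - ν') * lyapunov ν' y - a ^ ν ≤ R ^ ν := by
      unfold lyapunov; linarith
    calc g y ≤ 1 / 2 * R ^ (-ν) * R ^ ν := mul_le_mul_of_nonneg_left h3 (by positivity)
      _ = 1 / 2 * (R ^ ν * R ^ (-ν)) := by ring
      _ = 1 / 2 := by rw [hRR, mul_one]
  have hi1 : ∀ y : 𝕏, a < ‖(y : Plane)‖ → Integrable (lyapunov ν) (P y) :=
    fun y hy => (hC₁ y (by linarith)).1
  have hi2 : ∀ y : 𝕏, a < ‖(y : Plane)‖ → Integrable (lyapunov ν') (P y) :=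
    fun y hy => (hC y (by linarith)).1
  have key := le_survival_of_submartingale (P := P) (a := a) (r := K * ρ) (N := n) (g := g)
    (fun y hy => by
      have h1 : lyapunov ν y ≤ a ^ ν :=
        Real.rpow_le_rpow (by positivity) (max_le hy (by linarith)) hν0.le
      have h2 : 0 ≤ R ^ (ν - ν') * lyapunov ν' y := mul_nonneg (by positivity) (lyapunov_pos _ _).le
      exact mul_nonpos_of_nonneg_of_nonpos (by positivity) (by linarith))
    (fun y hy k hk => (hg2 y).trans (hfar' y hy.le k hk))
    (fun y => (hg2 y).trans (by norm_num))
    (fun y hy => (((hi1 y hy).sub ((hi2 y hy).const_mul _)).sub (integrable_const _)).const_mul _)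
    (fun y hy hyr => by
      have hy0 : 0 < ‖(y : Plane)‖ := by linarith
      have e : ∫ z, g z ∂(P y) = 1 / 2 * R ^ (-ν) * (∫ z, lyapunov ν z ∂(P y) -
          R ^ (ν - ν') * ∫ z, lyapunov ν' z ∂(P y) - a ^ ν) := by
        have i1 : Integrable (fun z => lyapunov ν z - R ^ (ν - ν') * lyapunov ν' z) (P y) :=
          (hi1 y hy).sub ((hi2 y hy).const_mul _)
        rw [integral_const_mul, integral_sub i1 (integrable_const _),
          integral_sub (hi1 y hy) ((hi2 y hy).const_mul _), integral_const_mul]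
        simp
      rw [e]
      apply mul_le_mul_of_nonneg_left _ (by positivity)
      have h1 := hA y (by linarith)
      have h2 := (abs_le.1 (hC y (by linarith)).2).2
      rw [← lyapunov_of_one_le ν' (by linarith)] at h2
      have h3 := scaled_rpow_le hνν' hR0 hy0 hη0 (by rw [hηR]; exact hyr) hηm
      have h4 : R ^ (ν - ν') * (C * ‖(y : Plane)‖ ^ (ν' - α)) ≤ d * ‖(y : Plane)‖ ^ (ν - α) := by
        have h5 : C * m ≤ d := by
          calc C * m ≤ (C + 1) * (d / (C + 1)) :=
                mul_le_mul (by linarith) (min_le_left _ _) hm0.le (by positivity)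
            _ = d := by field_simp
        calc R ^ (ν - ν') * (C * ‖(y : Plane)‖ ^ (ν' - α)) =
              C * (R ^ (ν - ν') * ‖(y : Plane)‖ ^ ν') * ‖(y : Plane)‖ ^ (-α) := by
              rw [sub_eq_add_neg ν' α, Real.rpow_add hy0]; ring
          _ ≤ C * (m * ‖(y : Plane)‖ ^ ν) * ‖(y : Plane)‖ ^ (-α) := by gcongr
          _ = C * m * ‖(y : Plane)‖ ^ (ν - α) := by
              rw [sub_eq_add_neg ν α, Real.rpow_add hy0]; ring
          _ ≤ _ := by gcongr
      have h6 : R ^ (ν - ν') * ∫ z, lyapunov ν' z ∂(P y) ≤ R ^ (ν - ν') *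
          (lyapunov ν' y + C * ‖(y : Plane)‖ ^ (ν' - α)) :=
        mul_le_mul_of_nonneg_left (by linarith) (by positivity)
      rw [mul_add] at h6
      linarith) n le_rfl x
  refine le_trans ?_ key
  have hx0 : 0 < ‖(x : Plane)‖ := lt_of_le_of_lt (by positivity) hx
  have haν : 0 < a ^ ν := by positivity
  have h1 : 2 * (a ^ ν + 1) ≤ ‖(x : Plane)‖ ^ ν := by
    have := Real.rpow_le_rpow (by positivity) hx.le hν0.le
    rwa [← Real.rpow_mul (by positivity), inv_mul_cancel₀ hν0.ne', Real.rpow_one] at this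
  have hx1 : 1 ≤ ‖(x : Plane)‖ := by
    by_contra! hc
    have := Real.rpow_le_one hx0.le hc.le hν0.le
    linarith
  have h2 := scaled_rpow_le hνν' hR0 hx0 hη0 (by rw [hηR]; exact hxr) (hηm.trans (min_le_right _ _))
  have h3 : 1 ≤ lyapunov ν x - R ^ (ν - ν') * lyapunov ν' x - a ^ ν := by
    rw [lyapunov_of_one_le _ hx1, lyapunov_of_one_le _ hx1]
    linarith
  calc 1 / 2 * R ^ (-ν) = 1 / 2 * R ^ (-ν) * 1 := by ring
    _ ≤ g x := mul_le_mul_of_nonneg_left h3 (by positivity)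

/-- The survival bound holds only for large radii and distant starting points. One outward step
reaches such a point with positive probability, and a smaller ball is only harder to hit. -/
lemma passageMoment_eq_top_of_gt {ν : ℝ} (hν : ν ∈ Set.Ioo (0 : ℝ) 1)
    (hroot : criticalFun α pR pT cR cT ν = 0) {a : ℝ} (ha : 0 ≤ a) {q : ℝ} (hqν : ν / α < q)
    {x : 𝕏} (hx : a < ‖(x : Plane)‖) : passageMoment P a q x = ∞ := by
  have hα0 : 0 < α := by linarith [h.α_mem.1]
  have hx0 : (x : Plane) ≠ 0 := norm_pos_iff.1 (by linarith)
  have hqν' := (div_lt_iff₀ hα0).1 hqν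
  obtain ⟨ν', hν'1, hν'2⟩ := exists_between (lt_min hqν' hν.2)
  have hν'0 : 0 < ν' := hν.1.trans hν'1
  obtain ⟨hν'q, hν'lt⟩ := lt_min_iff.1 hν'2
  have hpos := criticalFun_pos_of_root_lt h.α_mem (mul_pos h.pR_pos h.cR_pos) hν'1 hν'lt hroot
  obtain ⟨A, hA⟩ := h.survival_lower_bound hν'0 hν'lt hpos
  obtain ⟨A', c, hc, hev⟩ := hA (max a A) (le_max_right _ _)
  obtain ⟨δ, hδ, hstep⟩ := h.exists_outward_step A'
  obtain ⟨n₀, hn₀⟩ := eventually_atTop.1 hev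
  have hq0 : 0 < q := (div_pos hν.1 hα0).trans hqν
  refine passageMoment_eq_top P (q' := ν' / α) (c := δ * c) hq0 ((div_lt_iff₀ hα0).2 hν'q)
    (by positivity) ?_
  filter_upwards [eventually_ge_atTop (n₀ + 2)] with k hk
  obtain ⟨n, rfl⟩ : ∃ n, k = n + 1 := ⟨k - 1, by omega⟩
  have hn : n₀ ≤ n := by omega
  have hn1 : (0 : ℝ) < n := by exact_mod_cast (show 0 < n by omega)
  rw [survival_succ P hx]
  have hm : MeasurableSet {y : 𝕏 | A' < ‖(y : Plane)‖} := measurableSet_norm_gt A'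
  calc δ * c * ((n + 1 : ℕ) : ℝ) ^ (-(ν' / α)) ≤ δ * c * (n : ℝ) ^ (-(ν' / α)) := by
        apply mul_le_mul_of_nonneg_left _ (by positivity)
        exact Real.rpow_le_rpow_of_nonpos hn1 (by push_cast; linarith)
          (neg_nonpos.2 (by positivity))
    _ = δ * (c * (n : ℝ) ^ (-(ν' / α))) := by ring
    _ ≤ (P x).real {y | A' < ‖(y : Plane)‖} * (c * (n : ℝ) ^ (-(ν' / α))) :=
        mul_le_mul_of_nonneg_right (hstep x hx0) (by positivity)
    _ = ∫ y, {y : 𝕏 | A' < ‖(y : Plane)‖}.indicator (fun _ => c * (n : ℝ) ^ (-(ν' / α))) y ∂(P x) := by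
        rw [integral_indicator_const _ hm, smul_eq_mul]
    _ ≤ ∫ y, survival P a n y ∂(P x) := by
        refine integral_mono ((integrable_const _).indicator hm) (integrable_survival P a n _)
          fun y => ?_
        by_cases hy : A' < ‖(y : Plane)‖
        · rw [Set.indicator_of_mem (show y ∈ {y : 𝕏 | A' < ‖(y : Plane)‖} from hy)]
          exact (hn₀ n hn y hy).trans (survival_antitone_radius P (le_max_left _ _) n y)
        · rw [Set.indicator_of_notMem (show y ∉ {y : 𝕏 | A' < ‖(y : Plane)‖} from hy)]
          exact survival_nonneg P a n y

end IsRadialTransverseChain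

end LowerMoments

/-! ### Infinitely many returns and transience. -/

section Transience

variable {𝕏 : Set Plane} (P : Kernel 𝕏 𝕏) [IsMarkovKernel P]

/-- The paths visiting the ball of radius `a` infinitely often. -/
def infinitelyOftenSet (𝕏 : Set Plane) (a : ℝ) : Set (ℕ → 𝕏) :=
  {ξ | ∀ N, ∃ n, N ≤ n ∧ ‖(ξ n : Plane)‖ ≤ a}

lemma measurableSet_infinitelyOftenSet (a : ℝ) : MeasurableSet (infinitelyOftenSet 𝕏 a) := by
  have : infinitelyOftenSet 𝕏 a =
      ⋂ N : ℕ, ⋃ n : ℕ, ⋃ _ : N ≤ n, {ξ : ℕ → 𝕏 | a < ‖(ξ n : Plane)‖}ᶜ := by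
    ext ξ
    simp [infinitelyOftenSet]
  rw [this]
  exact MeasurableSet.iInter fun N => MeasurableSet.iUnion fun n => MeasurableSet.iUnion fun _ =>
    (measurableSet_norm_gt_at a n).compl

lemma preimage_shift_infinitelyOftenSet (a : ℝ) :
    (fun (ξ : ℕ → 𝕏) n => ξ (n + 1)) ⁻¹' infinitelyOftenSet 𝕏 a = infinitelyOftenSet 𝕏 a := by
  ext ξ
  constructor
  · intro H N
    obtain ⟨n, hn, hle⟩ := H N
    exact ⟨n + 1, by omega, hle⟩
  · intro H N
    obtain ⟨n, hn, hle⟩ := H (N + 1)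
    obtain ⟨m, rfl⟩ : ∃ m, n = m + 1 := ⟨n - 1, by omega⟩
    exact ⟨m, by omega, hle⟩

/-- The probability of visiting the ball of radius `a` infinitely often. -/
def returnProb (a : ℝ) (x : 𝕏) : ℝ :=
  (chainLaw P (Measure.dirac x)).real (infinitelyOftenSet 𝕏 a)

lemma measurable_returnProb (a : ℝ) : Measurable (returnProb P a) :=
  (measurable_chainLaw_dirac P (measurableSet_infinitelyOftenSet a)).ennreal_toReal

lemma returnProb_nonneg (a : ℝ) (x : 𝕏) : 0 ≤ returnProb P a x := measureReal_nonneg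

lemma returnProb_le_one (a : ℝ) (x : 𝕏) : returnProb P a x ≤ 1 := measureReal_le_one

/-- Harmonicity: the event is invariant under the shift. -/
lemma returnProb_eq_integral (a : ℝ) (x : 𝕏) :
    returnProb P a x = ∫ y, returnProb P a y ∂(P x) := by
  have h1 := chainLaw_preimage_shift P x (measurableSet_infinitelyOftenSet a)
  rw [preimage_shift_infinitelyOftenSet] at h1
  unfold returnProb
  rw [measureReal_def, h1, integral_eq_lintegral_of_nonneg_ae (ae_of_all _ fun _ => measureReal_nonneg)
    (measurable_returnProb P a).aestronglyMeasurable]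
  congr 1
  exact lintegral_congr fun y => (ofReal_measureReal).symm

lemma returnProb_le {a b : ℝ} {x : 𝕏} (h : ∀ n, 1 - survival P a n x ≤ b) :
    returnProb P a x ≤ b := by
  have hsub : infinitelyOftenSet 𝕏 a ⊆ ⋃ n, (survivalSet 𝕏 a n)ᶜ := by
    intro ξ hξ
    obtain ⟨n, -, hn⟩ := hξ 0
    refine Set.mem_iUnion.2 ⟨n, fun hc => ?_⟩
    exact absurd (hc n le_rfl) (not_lt.2 hn)
  have hmono : Monotone fun n => (survivalSet 𝕏 a n)ᶜ := by
    intro m n hmn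
    exact Set.compl_subset_compl.2 fun ξ hξ k hk => hξ k (hk.trans hmn)
  have hb : 0 ≤ b := by
    have := survival_le_one P a 0 x
    linarith [h 0]
  refine ENNReal.toReal_le_of_le_ofReal hb ((measure_mono hsub).trans ?_)
  rw [hmono.measure_iUnion]
  refine iSup_le fun n => ?_
  rw [← ofReal_measureReal, probReal_compl_eq_one_sub (measurableSet_survivalSet a n)]
  exact ENNReal.ofReal_le_ofReal (h n)

variable {P}

/-- A bounded harmonic function is bounded by its supremum far away, if the chain can leave every
bounded region. -/
lemma harmonic_le {u : 𝕏 → ℝ} (hu : Measurable u) (hu0 : ∀ x, 0 ≤ u x) (hu1 : ∀ x, u x ≤ 1)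
    (hharm : ∀ x, u x = ∫ y, u y ∂(P x)) {R b δ ε : ℝ} (hb0 : 0 ≤ b) (hδ : 0 < δ) (hε : 0 < ε)
    (hδ1 : δ ≤ 1) (hε1 : ε ≤ 1) (hb : ∀ x : 𝕏, R < ‖(x : Plane)‖ → u x ≤ b)
    (hout : ∀ x : 𝕏, (x : Plane) ≠ 0 → δ ≤ (P x).real {y | R < ‖(y : Plane)‖})
    (horig : ∀ x : 𝕏, (x : Plane) = 0 → ε ≤ (P x).real {y : 𝕏 | (y : Plane) ≠ 0}) (x : 𝕏) :
    u x ≤ b := by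
  have hδε : δ * ε ≤ 1 := by nlinarith
  have hint : ∀ x, Integrable u (P x) := fun x =>
    Integrable.of_bound hu.aestronglyMeasurable 1 (ae_of_all _ fun y => by
      rw [Real.norm_of_nonneg (hu0 y)]; exact hu1 y)
  have step : ∀ (t s q : ℝ) (S : Set 𝕏), MeasurableSet S → 0 ≤ t → (∀ y, u y ≤ b + t) →
      0 ≤ s → (∀ y ∈ S, u y ≤ b + t - s) → ∀ x, q ≤ (P x).real S → u x ≤ b + t - s * q := by
    intro t s q S hS _ ht hs hSle x hq
    rw [hharm x]
    calc ∫ y, u y ∂(P x) ≤ ∫ y, (b + t - S.indicator (fun _ => s) y) ∂(P x) := by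
          refine integral_mono (hint x)
            ((integrable_const _).sub ((integrable_const _).indicator hS)) fun y => ?_
          by_cases hy : y ∈ S
          · simp only [Set.indicator_of_mem hy]; exact hSle y hy
          · simp only [Set.indicator_of_notMem hy, sub_zero]; exact ht y
      _ = b + t - (P x).real S * s := by
          rw [integral_sub (integrable_const _) ((integrable_const _).indicator hS),
            integral_indicator_const _ hS]
          simp
      _ ≤ _ := by nlinarith
  -- The excess over b shrinks by the factor 1 - δε: from a nonzero point the next state is far out
  -- with probability at least δ, and from the origin the next state is nonzero with probability at
  -- least ε.
  have claim : ∀ (k : ℕ) (x : 𝕏), u x ≤ b + (1 - δ * ε) ^ k := by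
    intro k
    induction k with
    | zero => intro x; rw [pow_zero]; linarith [hu1 x]
    | succ k ih =>
      have ht : 0 ≤ (1 - δ * ε) ^ k := pow_nonneg (by linarith) k
      set t := (1 - δ * ε) ^ k with htdef
      have h1 : ∀ x : 𝕏, (x : Plane) ≠ 0 → u x ≤ b + t - t * δ := fun x hx =>
        step t t δ {y | R < ‖(y : Plane)‖} (measurableSet_norm_gt R) ht ih ht
          (fun y hy => by linarith [hb y hy]) x (hout x hx)
      intro x
      have hts : t * (δ * ε) ≤ t * δ := mul_le_mul_of_nonneg_left (by nlinarith) ht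
      rw [pow_succ, ← htdef]
      by_cases hx : (x : Plane) = 0
      · have hm : MeasurableSet {y : 𝕏 | (y : Plane) ≠ 0} :=
          (measurableSet_eq_fun measurable_subtype_coe measurable_const).compl
        have := step t (t * δ) ε {y : 𝕏 | (y : Plane) ≠ 0} hm ht ih (by positivity)
          (fun y hy => h1 y hy) x (horig x hx)
        linarith
      · linarith [h1 x hx]
  have hlim : Tendsto (fun k : ℕ => b + (1 - δ * ε) ^ k) atTop (𝓝 (b + 0)) :=
    (tendsto_pow_atTop_nhds_zero_of_lt_one (by linarith) (by
      have := mul_pos hδ hε; linarith)).const_add b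
  rw [add_zero] at hlim
  exact ge_of_tendsto' hlim fun k => claim k x

lemma isTransient_of_returnProb {A : ℝ} (h : ∀ a ≥ A, ∀ x : 𝕏, returnProb P a x = 0) :
    IsTransient P := by
  intro μ₀ _
  have h1 : ∀ j : ℕ, ∀ᵐ ξ ∂(chainLaw P μ₀), ξ ∉ infinitelyOftenSet 𝕏 (max A j) := by
    intro j
    rw [← measure_eq_zero_iff_ae_notMem,
      chainLaw_eq_lintegral P μ₀ (measurableSet_infinitelyOftenSet _)]
    have h2 : ∀ x : 𝕏, chainLaw P (Measure.dirac x) (infinitelyOftenSet 𝕏 (max A j)) = 0 :=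
      fun x => (measureReal_eq_zero_iff).1 (h _ (le_max_left _ _) x)
    simp [h2]
  filter_upwards [ae_all_iff.2 h1] with ξ hξ
  rw [tendsto_atTop]
  intro b
  obtain ⟨j, hj⟩ := exists_nat_ge b
  have h3 : ¬ ∀ N, ∃ n, N ≤ n ∧ ‖(ξ n : Plane)‖ ≤ max A j := hξ j
  push Not at h3
  obtain ⟨N, hN⟩ := h3
  filter_upwards [eventually_ge_atTop N] with n hn
  exact (hj.trans (le_max_right _ _)).trans (hN n hn).le

variable {Ω : Type*} [MeasurableSpace Ω] {Pr : 𝕏 → Measure Ω} {χ θR θT : Ω → ℝ}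
  {α β pR pT cR cT : ℝ}

namespace IsRadialTransverseChain

variable (h : IsRadialTransverseChain 𝕏 P Pr χ θR θT α β pR pT cR cT)

include h

lemma exists_leave_origin :
    ∃ ε > 0, ε ≤ 1 ∧ ∀ x : 𝕏, (x : Plane) = 0 → ε ≤ (P x).real {y : 𝕏 | (y : Plane) ≠ 0} := by
  by_cases hex : ∃ x : 𝕏, (x : Plane) = 0
  · obtain ⟨x₀, hx₀⟩ := hex
    have hset : {y : 𝕏 | (y : Plane) ≠ 0} = {x₀}ᶜ := by
      ext y
      simp only [Set.mem_ofPred_eq, Set.mem_compl_iff, Set.mem_singleton_iff, Subtype.ext_iff, hx₀]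
    have hlt := h.origin_not_absorbing x₀ hx₀
    refine ⟨(P x₀).real {y : 𝕏 | (y : Plane) ≠ 0}, ?_, measureReal_le_one, fun x hx => ?_⟩
    · rw [hset, probReal_compl_eq_one_sub (measurableSet_singleton x₀), gt_iff_lt, sub_pos,
        measureReal_def]
      exact (ENNReal.toReal_lt_toReal (measure_ne_top _ _) ENNReal.one_ne_top).2 hlt
    · have : x = x₀ := Subtype.ext (hx.trans hx₀.symm)
      rw [this]
  · exact ⟨1, one_pos, le_rfl, fun x hx => absurd ⟨x, hx⟩ hex⟩

/-- For ν < 0 close to 0 the supermartingale f_ν bounds the chance of a visit to the ball from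
radius R by (R/a)^ν. `harmonic_le` spreads this bound to all starting points, and R → ∞ gives zero.
-/
lemma isTransient_of_criticalFun_pos (hpos : 0 < criticalFun α pR pT cR cT 0) :
    IsTransient P := by
  have hgap := h.min_gt
  -- The lower limit α - min β 2 keeps the error of inward jumps below the order of the drift.
  have hev : ∀ᶠ ν in 𝓝[<] (0 : ℝ), 0 < criticalFun α pR pT cR cT ν ∧ ν ∈ Set.Ioo (α - min β 2) 0 :=
    (((continuousAt_criticalFun_zero h.α_mem).eventually (lt_mem_nhds hpos)).filter_mono
      nhdsWithin_le_nhds).and (Ioo_mem_nhdsLT (by linarith))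
  obtain ⟨ν, hFν, hν1, hν0⟩ := hev.exists
  obtain ⟨d, hd0, A, hA2, hA⟩ := h.exists_negative_drift hν0.ne (by linarith)
    (by rw [max_eq_right hν0.le]; linarith) (mul_neg_of_neg_of_pos hν0 hFν)
  obtain ⟨C, -, hC⟩ := h.exists_drift_bound hν0.ne (by linarith)
    (by rw [max_eq_right hν0.le]; linarith)
  obtain ⟨ε, hε, hε1, horig⟩ := h.exists_leave_origin
  refine isTransient_of_returnProb (A := A) fun a ha x => ?_
  have ha0 : 0 < a := by linarith
  have hret : ∀ y : 𝕏, returnProb P a y ≤ (a ^ ν)⁻¹ * lyapunov ν y := fun y => by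
    refine returnProb_le P fun n => ?_
    have := one_sub_survival_le (P := P) (a := a) (ρ := a) (κ := a ^ ν) (C := 0)
      (f := lyapunov ν) le_rfl (fun z => (lyapunov_pos _ z).le)
      (fun z hz => Real.rpow_le_rpow_of_nonpos (by positivity) (max_le hz (by linarith)) hν0.le)
      (by positivity) le_rfl (fun z hz => (hC z (by linarith)).1) (fun z hz => by
        have h1 := hA z (by linarith)
        have h2 : 0 ≤ d * ‖(z : Plane)‖ ^ (ν - α) := by positivity
        linarith) n y
    simpa using this
  have hbd : ∀ R : ℝ, 1 ≤ R → returnProb P a x ≤ (a ^ ν)⁻¹ * R ^ ν := by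
    intro R hR
    obtain ⟨δ, hδ, hout⟩ := h.exists_outward_step R
    refine harmonic_le (P := P) (R := R) (δ := min δ 1) (measurable_returnProb P a)
      (returnProb_nonneg P a) (returnProb_le_one P a) (returnProb_eq_integral P a) (by positivity)
      (lt_min hδ one_pos) hε (min_le_right _ _) hε1 (fun y hy => (hret y).trans ?_)
      (fun y hy => (min_le_left _ _).trans (hout y hy)) horig x
    rw [lyapunov_of_one_le _ (hR.trans hy.le)]
    exact mul_le_mul_of_nonneg_left (Real.rpow_le_rpow_of_nonpos (by linarith) hy.le hν0.le)
      (by positivity)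
  have hlim : Tendsto (fun R : ℝ => (a ^ ν)⁻¹ * R ^ ν) atTop (𝓝 ((a ^ ν)⁻¹ * 0)) := by
    have := tendsto_rpow_neg_atTop (y := -ν) (by linarith)
    rw [neg_neg] at this
    exact this.const_mul _
  rw [mul_zero] at hlim
  exact le_antisymm (ge_of_tendsto hlim ((eventually_ge_atTop 1).mono hbd)) (returnProb_nonneg P a x)

end IsRadialTransverseChain

end Transience

end HeavyTailPlane

end

/-! ### The dichotomy and the moment threshold. -/

theorem theorem2p9 {Ω : Type*} [MeasurableSpace Ω]
    (𝕏 : Set HeavyTailPlane.Plane) (P : Kernel 𝕏 𝕏) [IsMarkovKernel P]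
    (Pr : 𝕏 → Measure Ω) (χ θR θT : Ω → ℝ) (α β pR pT cR cT : ℝ)
    (h : HeavyTailPlane.IsRadialTransverseChain 𝕏 P Pr χ θR θT α β pR pT cR cT) :
    (0 < pR * cR + 2 * pT * cT * Real.cos (Real.pi * α / 2) →
      HeavyTailPlane.IsNullRecurrent P ∧
      (∃! ν : ℝ, ν ∈ Set.Ioo (0 : ℝ) 1 ∧ HeavyTailPlane.IsCriticalRoot α pR pT cR cT ν) ∧
      ∀ ν ∈ Set.Ioo (0 : ℝ) 1, HeavyTailPlane.IsCriticalRoot α pR pT cR cT ν →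
        ∃ a₀ : ℝ, ∀ a : ℝ, a₀ ≤ a → ∀ q : ℝ, 0 < q →
          (q < ν / α → ∀ x : 𝕏, HeavyTailPlane.passageMoment P a q x < ∞) ∧
          (ν / α < q → ∀ x : 𝕏, a < ‖(x : HeavyTailPlane.Plane)‖ →
            HeavyTailPlane.passageMoment P a q x = ∞)) ∧
    (pR * cR + 2 * pT * cT * Real.cos (Real.pi * α / 2) < 0 →
      HeavyTailPlane.IsTransient P) := by
  have hα0 : 0 < α := by linarith [h.α_mem.1]
  have hR := mul_pos h.pR_pos h.cR_pos
  constructor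
  · intro hcase
    obtain ⟨a₀, ha₀, hreach⟩ := h.exists_radius_reachable
    obtain ⟨ν, hν, hroot⟩ := HeavyTailPlane.exists_criticalRoot (cR := cR) h.α_mem
      (mul_pos h.pT_pos h.cT_pos) hcase
    refine ⟨⟨?_, ⟨a₀, fun a ha x hx => ?_⟩⟩, ⟨ν, ⟨hν, hroot⟩, ?_⟩, ?_⟩
    · refine HeavyTailPlane.isRecurrent_of_survival P (a := a₀) (by linarith) fun x => ?_
      have hq : 0 < ν / α := div_pos hν.1 hα0
      obtain ⟨⟨q', hq', C, hC⟩, -⟩ := h.passageMoment_lt_top_of_lt hν hroot ha₀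
        (hreach a₀ le_rfl) (half_pos hq) (half_lt_self hq) x
      have hlim : Tendsto (fun n : ℕ => C * (n : ℝ) ^ (-q')) atTop (𝓝 (C * 0)) :=
        ((tendsto_rpow_neg_atTop (by linarith)).comp tendsto_natCast_atTop_atTop).const_mul C
      rw [mul_zero] at hlim
      refine tendsto_of_tendsto_of_tendsto_of_le_of_le' tendsto_const_nhds hlim
        (Eventually.of_forall fun n => HeavyTailPlane.survival_nonneg P a₀ n x) ?_
      filter_upwards [eventually_gt_atTop 0] with n hn using hC n hn
    -- Null recurrence is the case q = 1, which lies above the threshold because ν < 1 < α.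
    · refine h.passageMoment_eq_top_of_gt hν hroot (by linarith) ?_ hx
      rw [div_lt_one hα0]
      linarith [hν.2, h.α_mem.1]
    · rintro ν' ⟨hν', hroot'⟩
      rcases lt_trichotomy ν' ν with hlt | heq | hlt
      · exact absurd hroot'
          (HeavyTailPlane.criticalFun_neg_of_lt_root h.α_mem hR hlt hν.2 hroot).ne
      · exact heq
      · exact absurd hroot'
          (HeavyTailPlane.criticalFun_pos_of_root_lt h.α_mem hR hlt hν'.2 hroot).ne'
    · intro ν' hν' hroot'
      refine ⟨a₀, fun a ha q hq => ⟨fun hlt x => ?_, fun hgt x hx => ?_⟩⟩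
      · exact (h.passageMoment_lt_top_of_lt hν' hroot' (ha₀.trans ha) (hreach a ha) hq hlt x).2
      · exact h.passageMoment_eq_top_of_gt hν' hroot' (by linarith) hgt hx
  · intro hcase
    refine h.isTransient_of_criticalFun_pos ?_
    rw [HeavyTailPlane.criticalFun_zero h.α_mem]
    exact mul_pos_of_neg_of_neg
      (div_neg_of_pos_of_neg Real.pi_pos (HeavyTailPlane.sin_pi_mul_neg h.α_mem)) hcase
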